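/- Let $A$ be a fixed $m\times p$ matrix of rank $p$ and $B$ a fixed $n\times p$ matrix, and for $\beta\in\mathbb R^p$ let $X\mid\beta\sim N_m(A\beta,I)$ and $Y\mid\beta\sim N_n(B\beta,I)$ be independent, with densities $p(x\mid\beta)$ and $p(y\mid\beta)$. A predictive density estimator $\hat q$ assigns to every $x\in\mathbb R^m$ a probability density $\hat q(\cdot\mid x)$ on $\mathbb R^n$ (jointly measurable in $(x,y)$); its Kullback–Leibler risk is $$R_{\mathrm{KL}}(\beta,\hat q)=\int p(x\mid\beta)\int p(y\mid\beta)\log\frac{p(y\mid\beta)}{\hat q(y\mid x)}\,dy\,dx\in[0,\infty],$$ and $\hat q$ is minimax if $\sup_\beta R_{\mathrm{KL}}(\beta,\hat q)\le\sup_\beta R_{\mathrm{KL}}(\beta,\hat q')$ for every predictive density estimator $\hat q'$. A (possibly improper) prior density is a measurable $\pi:\mathbb R^p\to[0,\infty)$ that is not almost everywhere zero; its Bayes predictive density is $$\hat p_\pi(y\mid x)=\frac{\int p(y\mid\beta)\,p(x\mid\beta)\,\pi(\beta)\,d\beta}{\int p(x\mid\beta)\,\pi(\beta)\,d\beta}.$$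 Put $\Sigma_A=(A'A)^{-1}$, $\Sigma_C=(A'A+B'B)^{-1}$, and let $m_\pi(z;\Sigma)=\int N_p(z;\beta,\Sigma)\,\pi(\beta)\,d\beta$, where $N_p(\cdot;\beta,\Sigma)$ is the density of $N_p(\beta,\Sigma)$. There are an invertible $p\times p$ matrix $W$ and a diagonal matrix $D=\operatorname{diag}(d_1,\dots,d_p)$ with $\Sigma_A=WW'$ and $\Sigma_C=WDW'$. Suppose that $m_\pi(z;WW')=m_\pi(z;\Sigma_A)$ is finite for all $z$. Then $\hat p_\pi$ is a minimax predictive density estimator if $\pi$ satisfies $$\operatorname{trace}\{H(\pi(\beta))\,[\Sigma_A-\Sigma_C]\}\le 0$$ in either of the following senses: (a) $\pi$ has a weak Hessian $H(\pi)$ with locally integrable entries, and the inequality holds for almost every $\beta$; (b) $\pi$ is locally integrable and the inequality holds in the sense of distributions, that is, $\int\pi(\beta)\operatorname{trace}\{H(\varphi(\beta))[\Sigma_A-\Sigma_C]\}\,d\beta\le0$ for every nonnegative $\varphi\in C_c^\infty(\mathbb R^p)$. Consequently, for any $W$ and $D$ as above, if $r=\#\{i: d_i<1\}\ge3$, then every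 scaled harmonic prior $$\pi_H(\beta)=\kappa\Bigl(\sum_{i:\,d_i<1}\frac{\bigl((W^{-1}\beta)_i\bigr)^2}{1-d_i}\Bigr)^{-(r-2)/2},\qquad\kappa>0,$$ is a prior density (set to $0$ on the null set where the sum vanishes), has $m_{\pi_H}(z;\Sigma_A)<\infty$ for all $z$, satisfies (b), and yields a minimax predictive density $\hat p_{\pi_H}$. -/

import Mathlib

open MeasureTheory Matrix
open scoped ENNReal ContDiff

noncomputable section

namespace PredReg

/-- The density at `z` of the `k`-dimensional normal distribution with mean `μ` and (positive
definite) covariance matrix `S`, with respect to Lebesgue measure on `ℝ^k = (Fin k → ℝ)`. -/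
def normalDensity {k : ℕ} (S : Matrix (Fin k) (Fin k) ℝ) (μ z : Fin k → ℝ) : ℝ :=
  (2 * Real.pi) ^ (-(k : ℝ) / 2) * S.det ^ (-(1 : ℝ) / 2) *
    Real.exp (-((z - μ) ⬝ᵥ (S⁻¹ *ᵥ (z - μ))) / 2)

/-- The density of `N_k(M β, I)` at `z`: this is `p(x | β)` for `M = A` and `p(y | β)` for
`M = B`. -/
def modelDensity {k p : ℕ} (M : Matrix (Fin k) (Fin p) ℝ) (β : Fin p → ℝ) (z : Fin k → ℝ) : ℝ :=
  normalDensity 1 (M *ᵥ β) z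

/-- `Σ_A = (A'A)⁻¹`. -/
def covA {m p : ℕ} (A : Matrix (Fin m) (Fin p) ℝ) : Matrix (Fin p) (Fin p) ℝ :=
  (Aᵀ * A)⁻¹

/-- `Σ_C = (A'A + B'B)⁻¹`. -/
def covC {m n p : ℕ} (A : Matrix (Fin m) (Fin p) ℝ) (B : Matrix (Fin n) (Fin p) ℝ) :
    Matrix (Fin p) (Fin p) ℝ :=
  (Aᵀ * A + Bᵀ * B)⁻¹

/-- A (possibly improper) prior density on `ℝ^p`: measurable, nonnegative, not almost everywhere
zero. -/
structure IsPrior {p : ℕ} (π : (Fin p → ℝ) → ℝ) : Prop where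
  measurable : Measurable π
  nonneg : ∀ β, 0 ≤ π β
  not_ae_zero : ¬ ∀ᵐ β, π β = 0

/-- The marginal density `m_π(z; S) = ∫ N_p(z; β, S) π(β) dβ`, with values in `[0, ∞]`. -/
def marginal {p : ℕ} (π : (Fin p → ℝ) → ℝ) (S : Matrix (Fin p) (Fin p) ℝ) (z : Fin p → ℝ) :
    ℝ≥0∞ :=
  ∫⁻ β, ENNReal.ofReal (normalDensity S β z * π β)

/-- The Bayes predictive density `p̂_π(y | x) = ∫ p(y | β) π(β | x) dβ`, where
`π(β | x) = p(x | β) π(β) / ∫ p(x | β) π(β) dβ` is the posterior density. -/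
def bayesPred {m n p : ℕ} (A : Matrix (Fin m) (Fin p) ℝ) (B : Matrix (Fin n) (Fin p) ℝ)
    (π : (Fin p → ℝ) → ℝ) (x : Fin m → ℝ) (y : Fin n → ℝ) : ℝ≥0∞ :=
  (∫⁻ β, ENNReal.ofReal (modelDensity B β y * (modelDensity A β x * π β))) /
    ∫⁻ β, ENNReal.ofReal (modelDensity A β x * π β)

/-- Predictive density estimators `q x y = q̂(y | x)`: jointly measurable, and a probability density
in `y` for every `x`. -/
structure IsPredDensity {m n : ℕ} (q : (Fin m → ℝ) → (Fin n → ℝ) → ℝ≥0∞) : Prop where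
  measurable : Measurable (Function.uncurry q)
  lintegral_eq_one : ∀ x, ∫⁻ y, q x y = 1

/-- The Kullback–Leibler loss `L(β, q) = ∫ p(y | β) log (p(y | β) / q(y)) dy`, in `[0, ∞]`. -/
def klLoss {n p : ℕ} (B : Matrix (Fin n) (Fin p) ℝ) (β : Fin p → ℝ)
    (q : (Fin n → ℝ) → ℝ≥0∞) : ℝ≥0∞ :=
  InformationTheory.klDiv
    ((volume : Measure (Fin n → ℝ)).withDensity (fun y => ENNReal.ofReal (modelDensity B β y)))
    ((volume : Measure (Fin n → ℝ)).withDensity q)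

/-- The Kullback–Leibler risk `R(β, q) = ∫ p(x | β) L(β, q(· | x)) dx`, in `[0, ∞]`. -/
def klRisk {m n p : ℕ} (A : Matrix (Fin m) (Fin p) ℝ) (B : Matrix (Fin n) (Fin p) ℝ)
    (β : Fin p → ℝ) (q : (Fin m → ℝ) → (Fin n → ℝ) → ℝ≥0∞) : ℝ≥0∞ :=
  ∫⁻ x, ENNReal.ofReal (modelDensity A β x) * klLoss B β (q x)

/-- `q` is a minimax predictive density estimator under Kullback–Leibler risk: it is a predictive
density estimator, and no other one has a smaller maximal risk over `β ∈ ℝ^p`. -/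
def IsMinimax {m n p : ℕ} (A : Matrix (Fin m) (Fin p) ℝ) (B : Matrix (Fin n) (Fin p) ℝ)
    (q : (Fin m → ℝ) → (Fin n → ℝ) → ℝ≥0∞) : Prop :=
  IsPredDensity q ∧
    ∀ q' : (Fin m → ℝ) → (Fin n → ℝ) → ℝ≥0∞, IsPredDensity q' →
      (⨆ β, klRisk A B β q) ≤ ⨆ β, klRisk A B β q'

/-- The Hessian matrix of `f : ℝ^p → ℝ` at `β`. -/
def hessian {p : ℕ} (f : (Fin p → ℝ) → ℝ) (β : Fin p → ℝ) : Matrix (Fin p) (Fin p) ℝ :=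
  Matrix.of fun i j => iteratedFDeriv ℝ 2 f β ![Pi.single i 1, Pi.single j 1]

/-- `H` is the weak (locally integrable) Hessian of the locally integrable function `f`. -/
structure HasWeakHessian {p : ℕ} (f : (Fin p → ℝ) → ℝ)
    (H : (Fin p → ℝ) → Matrix (Fin p) (Fin p) ℝ) : Prop where
  locallyIntegrable : LocallyIntegrable f
  locallyIntegrable_hessian : ∀ i j, LocallyIntegrable (fun β => H β i j)
  integral_eq : ∀ i j, ∀ φ : (Fin p → ℝ) → ℝ, ContDiff ℝ ∞ φ → HasCompactSupport φ →
    ∫ β, f β * hessian φ β i j = ∫ β, H β i j * φ β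

/-- `trace {H(f) Q} ≤ 0` in the sense of distributions, for a symmetric matrix `Q` and a locally
integrable function `f`, whose distributional Hessian need not be a function. For `Q = I` this is
superharmonicity. -/
def DistribTraceHessianNonpos {p : ℕ} (f : (Fin p → ℝ) → ℝ)
    (Q : Matrix (Fin p) (Fin p) ℝ) : Prop :=
  LocallyIntegrable f ∧
    ∀ φ : (Fin p → ℝ) → ℝ, ContDiff ℝ ∞ φ → HasCompactSupport φ → (∀ β, 0 ≤ φ β) →
      ∫ β, f β * (hessian φ β * Q).trace ≤ 0

/-- The simultaneous diagonalization `Σ_A = W W'`, `Σ_C = W diag(d) W'` with `W` invertible. -/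
structure Diagonalizes {m n p : ℕ} (A : Matrix (Fin m) (Fin p) ℝ) (B : Matrix (Fin n) (Fin p) ℝ)
    (W : Matrix (Fin p) (Fin p) ℝ) (d : Fin p → ℝ) : Prop where
  isUnit : IsUnit W
  covA_eq : covA A = W * Wᵀ
  covC_eq : covC A B = W * Matrix.diagonal d * Wᵀ

/-- The indices with `d_i < 1`. -/
def activeSet {p : ℕ} (d : Fin p → ℝ) : Finset (Fin p) :=
  Finset.univ.filter fun i => d i < 1

/-- The scaled harmonic prior `‖u‖^{-(r-2)}`, where `u ∈ ℝ^r` is the vector with coordinates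
`(W⁻¹β)_i / √(1 - d_i)` over the `r` indices with `d_i < 1`. -/
def scaledHarmonic {p : ℕ} (W : Matrix (Fin p) (Fin p) ℝ) (d : Fin p → ℝ) (β : Fin p → ℝ) : ℝ :=
  Real.sqrt (∑ i ∈ activeSet d, (W⁻¹ *ᵥ β) i ^ 2 / (1 - d i)) ^
    (-(((activeSet d).card : ℝ) - 2))

end PredReg

end

/-! The uniform prior gives a predictive density with constant risk, and that constant is the
minimax value. So it suffices that `bayesPred` for π has risk at most that constant at every β.

Pass to coordinates V = W⁻¹, in which Σ_A becomes the identity and Σ_C becomes diag(d) with 0 < d_i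
≤ 1. Let ẑ_A be the least squares estimator from x and ẑ_C the one from (x, y) (`statA`, `statC`),
and let m₁ and m_d be the smoothings of π by the Gaussian kernels with variances 1 and d, which are
its marginals at Σ_A and Σ_C up to one common factor. Sufficiency gives p̂_π / p̂_U = m_d(ẑ_C) /
m₁(ẑ_A), where p̂_U belongs to the uniform prior (`Whitening.priorPred_eq_flatPred_mul`).

Domination. Since log t ≤ t - 1, a predictive density q₂ has risk at most that of q₁ as soon as
E_β[q₁ / q₂] ≤ 1 (`klRisk_add_one_le`). With q₁ = p̂_U and q₂ = p̂_π this is E_β[m₁(ẑ_A) / m_d(ẑ_C)]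
≤ 1. Suppose that m₁ ≤ m_d everywhere. Then the numerator may be replaced by m_d(ẑ_A). The
difference ẑ_A - ẑ_C is translation invariant and independent of ẑ_C, and averaging m_d(z + ẑ_A -
ẑ_C) over it gives m₁(z) (`LocationModel.lintegral_smoothing`). What remains is E_β[m₁(ẑ_C) /
m_d(ẑ_C)], which is at most 1 by the same inequality used again (`Whitening.klRisk_priorPred_le`).

Monotonicity of smoothing. Let the variances run along d + s(1 - d), 0 ≤ s ≤ 1. By the heat equation
the s-derivative of the smoothed prior is half the integral of π against trace{H(kernel)(Σ_A -
Σ_C)}, because Σ_A - Σ_C = W diag(1 - d) W'. The distributional hypothesis makes it nonpositive once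
it is extended from test functions to Gaussian kernels by a cutoff (`integral_mul_kernel_nonpos`,
`smooth_one_le_smooth`). A weak Hessian reduces to the distributional case by the definition of weak
derivatives.

Lower bound. For the proper priors exp(-t‖Vβ‖₁) the Bayes predictive density minimizes the
integrated risk, and its expected ratio to p̂_U is at most a bound that tends to 1 as t → 0,
uniformly in β. The same comparison inequality then bounds the risk of p̂_U by the maximal risk of
any competitor (`Whitening.klRisk_flatPred_le_iSup`).

Harmonic priors. The power (ε + Q)^(-(r-2)/2) of the quadratic form Q has nonpositive weighted
Laplacian, by explicit differentiation; integrating by parts and letting ε → 0 gives the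
distributional inequality. The singularity is integrable because it is bounded by a product of r
one-dimensional singularities of order less than 1. -/

noncomputable section

namespace PredReg

/-! ### Comparison of Kullback–Leibler divergences -/

/-- The pointwise inequality behind the comparison of two Kullback–Leibler losses. -/
lemma klFun_comparison {p q₁ q₂ : ℝ} (hp : 0 < p) (h₁ : 0 < q₁) (h₂ : 0 < q₂) :
    InformationTheory.klFun (p / q₂) * q₂ + p + q₁ ≤
      InformationTheory.klFun (p / q₁) * q₁ + p * (q₁ / q₂) + q₂ := by
  have e : ∀ q : ℝ, 0 < q → InformationTheory.klFun (p / q) * q =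
      p * (Real.log p - Real.log q) + q - p := by
    intro q hq
    rw [InformationTheory.klFun_apply, Real.log_div hp.ne' hq.ne']
    field_simp
  -- The claim is p times this inequality at q₁ / q₂. The terms p + q₁ and q₂ are distributed so
  -- that both sides are sums of nonnegative quantities, which lets the inequality pass to [0, ∞]
  -- without subtraction.
  have h := Real.log_le_sub_one_of_pos (div_pos h₁ h₂)
  rw [Real.log_div h₁.ne' h₂.ne'] at h
  have h' := mul_le_mul_of_nonneg_left h hp.le
  rw [e _ h₁, e _ h₂]
  nlinarith

lemma klFun_comparison_ennreal {p q₁ q₂ : ℝ≥0∞} (hp : p ≠ 0) (hp' : p ≠ ⊤) (h₁ : q₁ ≠ 0)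
    (h₁' : q₁ ≠ ⊤) (h₂ : q₂ ≠ 0) (h₂' : q₂ ≠ ⊤) :
    q₂ * ENNReal.ofReal (InformationTheory.klFun (p / q₂).toReal) + (p + q₁) ≤
      q₁ * ENNReal.ofReal (InformationTheory.klFun (p / q₁).toReal) + (p * (q₁ / q₂) + q₂) := by
  have kp := ENNReal.toReal_pos hp hp'
  have k₁ := ENNReal.toReal_pos h₁ h₁'
  have k₂ := ENNReal.toReal_pos h₂ h₂'
  have main := klFun_comparison kp k₁ k₂
  rw [← ENNReal.ofReal_toReal hp', ← ENNReal.ofReal_toReal h₁', ← ENNReal.ofReal_toReal h₂']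
  generalize p.toReal = a at *
  generalize q₁.toReal = b at *
  generalize q₂.toReal = c at *
  rw [← ENNReal.ofReal_div_of_pos k₂, ← ENNReal.ofReal_div_of_pos k₁, ← ENNReal.ofReal_div_of_pos k₂,
    ENNReal.toReal_ofReal (by positivity), ENNReal.toReal_ofReal (by positivity),
    ← ENNReal.ofReal_mul k₂.le, ← ENNReal.ofReal_mul k₁.le, ← ENNReal.ofReal_mul kp.le]
  have n₁ := InformationTheory.klFun_nonneg (x := a / b) (by positivity)
  have n₂ := InformationTheory.klFun_nonneg (x := a / c) (by positivity)
  rw [← ENNReal.ofReal_add (by positivity) (by positivity),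
    ← ENNReal.ofReal_add (by positivity) (by positivity),
    ← ENNReal.ofReal_add (by positivity) (by positivity),
    ← ENNReal.ofReal_add (by positivity) (by positivity)]
  apply ENNReal.ofReal_le_ofReal
  linarith

/-- The Kullback–Leibler divergence of two measures given by densities. -/
lemma klDiv_withDensity {α : Type*} [MeasurableSpace α] {μ : Measure α} [SigmaFinite μ]
    {p q : α → ℝ≥0∞} (hp : Measurable p) (hq : Measurable q)
    [IsFiniteMeasure (μ.withDensity p)] [IsFiniteMeasure (μ.withDensity q)]
    (h0 : ∀ᵐ x ∂μ, q x ≠ 0) :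
    InformationTheory.klDiv (μ.withDensity p) (μ.withDensity q) =
      ∫⁻ x, q x * ENNReal.ofReal (InformationTheory.klFun (p x / q x).toReal) ∂μ := by
  have hfin : ∀ᵐ x ∂μ, q x ≠ ⊤ := by
    have : ∫⁻ x, q x ∂μ ≠ ⊤ := by
      have := measure_ne_top (μ.withDensity q) Set.univ
      rwa [withDensity_apply _ MeasurableSet.univ, setLIntegral_univ] at this
    filter_upwards [ae_lt_top hq this] with x hx using hx.ne
  have hac : μ.withDensity p ≪ μ.withDensity q :=
    (withDensity_absolutelyContinuous μ p).trans (withDensity_absolutelyContinuous' hq.aemeasurable h0)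
  have hpq : μ.withDensity p = (μ.withDensity q).withDensity (fun x => p x / q x) := by
    change _ = (μ.withDensity q).withDensity (p / q)
    rw [← withDensity_mul _ hq (hp.div hq)]
    apply withDensity_congr_ae
    filter_upwards [h0, hfin] with x h1 h2
    simp only [Pi.mul_apply, Pi.div_apply]
    rw [ENNReal.mul_div_cancel h1 h2]
  have hrn : (μ.withDensity p).rnDeriv (μ.withDensity q) =ᵐ[μ.withDensity q]
      fun x => p x / q x := by
    conv_lhs => rw [hpq]
    exact Measure.rnDeriv_withDensity _ (hp.div hq)
  rw [InformationTheory.klDiv_eq_lintegral_klFun_of_ac hac]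
  rw [lintegral_congr_ae (g := fun x => ENNReal.ofReal (InformationTheory.klFun (p x / q x).toReal))]
  · rw [lintegral_withDensity_eq_lintegral_mul _ hq]
    · rfl
    · have : Measurable fun x => p x / q x := hp.div hq
      exact (InformationTheory.measurable_klFun.comp this.ennreal_toReal).ennreal_ofReal
  · filter_upwards [hrn] with x hx
    rw [hx]

/-- Comparison of two Kullback–Leibler losses without logarithms. -/
lemma klDiv_add_one_le {α : Type*} [MeasurableSpace α] {μ : Measure α} [SigmaFinite μ]
    {p q₁ q₂ : α → ℝ≥0∞} (hp : Measurable p) (h₁ : Measurable q₁) (h₂ : Measurable q₂)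
    (hp1 : ∫⁻ x, p x ∂μ = 1) (h₁1 : ∫⁻ x, q₁ x ∂μ = 1) (h₂1 : ∫⁻ x, q₂ x ∂μ = 1)
    (hp0 : ∀ x, p x ≠ 0) (hpt : ∀ x, p x ≠ ⊤) (h₂0 : ∀ x, q₂ x ≠ 0) :
    InformationTheory.klDiv (μ.withDensity p) (μ.withDensity q₂) + 1 ≤
      InformationTheory.klDiv (μ.withDensity p) (μ.withDensity q₁) +
        ∫⁻ x, p x * (q₁ x / q₂ x) ∂μ := by
  have fin : ∀ q : α → ℝ≥0∞, ∫⁻ x, q x ∂μ = 1 → IsFiniteMeasure (μ.withDensity q) := by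
    intro q h
    refine ⟨?_⟩
    rw [withDensity_apply _ MeasurableSet.univ, setLIntegral_univ, h]
    exact ENNReal.one_lt_top
  have aefin : ∀ q : α → ℝ≥0∞, Measurable q → ∫⁻ x, q x ∂μ = 1 → ∀ᵐ x ∂μ, q x ≠ ⊤ := by
    intro q hq h
    filter_upwards [ae_lt_top hq (by rw [h]; exact ENNReal.one_ne_top)] with x hx using hx.ne
  have := fin p hp1
  have := fin q₁ h₁1
  have := fin q₂ h₂1
  -- If absolute continuity fails, the right-hand side is infinite. If it holds, positivity of p
  -- forces q₁ to be positive almost everywhere.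
  by_cases hac : μ.withDensity p ≪ μ.withDensity q₁
  swap
  · rw [InformationTheory.klDiv_of_not_ac hac]; simp
  have h₁0 : ∀ᵐ x ∂μ, q₁ x ≠ 0 := by
    have e1 : μ ≪ μ.withDensity p :=
      withDensity_absolutelyContinuous' hp.aemeasurable (Filter.Eventually.of_forall hp0)
    apply (e1.trans hac).ae_le
    exact (ae_withDensity_iff h₁).2 (Filter.Eventually.of_forall fun x h => h)
  rw [klDiv_withDensity hp h₂ (Filter.Eventually.of_forall h₂0), klDiv_withDensity hp h₁ h₁0]
  have key : ∫⁻ x, (q₂ x * ENNReal.ofReal (InformationTheory.klFun (p x / q₂ x).toReal) +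
      (p x + q₁ x)) ∂μ ≤ ∫⁻ x, (q₁ x * ENNReal.ofReal (InformationTheory.klFun (p x / q₁ x).toReal) +
      (p x * (q₁ x / q₂ x) + q₂ x)) ∂μ := by
    apply lintegral_mono_ae
    filter_upwards [h₁0, aefin _ h₁ h₁1, aefin _ h₂ h₂1] with x a b c
    exact klFun_comparison_ennreal (hp0 x) (hpt x) a b (h₂0 x) c
  have hm : Measurable fun x => p x * (q₁ x / q₂ x) := hp.mul (h₁.div h₂)
  have hpq : Measurable fun x => p x + q₁ x := hp.add h₁
  have hm2 : Measurable fun x => p x * (q₁ x / q₂ x) + q₂ x := hm.add h₂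
  rw [lintegral_add_right _ hpq, lintegral_add_right _ hm2, lintegral_add_left hp,
    lintegral_add_right _ h₂, hp1, h₁1, h₂1, ← add_assoc, ← add_assoc] at key
  exact (ENNReal.add_le_add_iff_right ENNReal.one_ne_top).1 key

/-! ### Gaussian product kernels in linear coordinates -/

/-- Tonelli's theorem for a product of functions of the coordinates. -/
lemma lintegral_prod_coord {k : ℕ} (f : Fin k → ℝ → ℝ≥0∞) (hf : ∀ i, Measurable (f i)) :
    ∫⁻ x : Fin k → ℝ, ∏ i, f i (x i) = ∏ i, ∫⁻ t, f i t := by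
  induction k with
  | zero => simp [volume_pi]
  | succ n ih =>
    rw [← (volume_preserving_piFinSuccAbove (fun _ : Fin (n + 1) => ℝ) 0).symm.lintegral_comp_emb
      (MeasurableEquiv.measurableEmbedding _)]
    have e : ∀ a : ℝ × (Fin n → ℝ), ∏ i, f i
        ((MeasurableEquiv.piFinSuccAbove (fun _ : Fin (n + 1) => ℝ) 0).symm a i) =
        f 0 a.1 * ∏ i : Fin n, f i.succ (a.2 i) := by
      intro a
      rw [Fin.prod_univ_succ]
      rfl
    simp_rw [e]
    have hm : Measurable fun a : Fin n → ℝ => ∏ i : Fin n, f i.succ (a i) :=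
      Finset.measurable_prod _ fun i _ => (hf i.succ).comp (measurable_pi_apply i)
    rw [Measure.volume_eq_prod, lintegral_prod_mul (hf 0).aemeasurable hm.aemeasurable,
      ih _ (fun i => hf i.succ), Fin.prod_univ_succ]

lemma lintegral_comp_mulVec {p : ℕ} {V : Matrix (Fin p) (Fin p) ℝ} (hV : V.det ≠ 0)
    {f : (Fin p → ℝ) → ℝ≥0∞} (hf : Measurable f) :
    ∫⁻ u, f (V *ᵥ u) = ENNReal.ofReal |V.det⁻¹| * ∫⁻ v, f v := by
  have h := Real.map_matrix_volume_pi_eq_smul_volume_pi hV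
  have h2 : ∫⁻ v, f v ∂(Measure.map (toLin' V) volume) = ∫⁻ u, f (V *ᵥ u) := by
    rw [lintegral_map hf (LinearMap.continuous_of_finiteDimensional _).measurable]
    simp [Matrix.toLin'_apply]
  rw [← h2, h, lintegral_smul_measure, smul_eq_mul]

/-- The centred normal density on `ℝ` with variance `a`. -/
def normal1 (a v : ℝ) : ℝ := (Real.sqrt (2 * Real.pi * a))⁻¹ * Real.exp (-(v ^ 2) / (2 * a))

lemma normal1_pos {a : ℝ} (ha : 0 < a) (v : ℝ) : 0 < normal1 a v := by
  unfold normal1; positivity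

lemma continuous_normal1 (a : ℝ) : Continuous (normal1 a) := by
  unfold normal1; fun_prop

lemma normal1_neg (a v : ℝ) : normal1 a (-v) = normal1 a v := by simp [normal1]

lemma normal1_eq_gaussianPDFReal {a : ℝ} (ha : 0 < a) (v : ℝ) :
    normal1 a v = ProbabilityTheory.gaussianPDFReal 0 ⟨a, ha.le⟩ v := by
  simp only [normal1, ProbabilityTheory.gaussianPDFReal, sub_zero]
  rfl

lemma lintegral_normal1 {a : ℝ} (ha : 0 < a) : ∫⁻ v, ENNReal.ofReal (normal1 a v) = 1 := by
  simp_rw [normal1_eq_gaussianPDFReal ha]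
  exact ProbabilityTheory.lintegral_gaussianPDFReal_eq_one 0 (v := ⟨a, ha.le⟩)
    (by intro h; exact ha.ne' (congrArg NNReal.toReal h))

/-- The product of centred normal densities with variances `a i` in the coordinates `V u`. -/
def gk {p : ℕ} (V : Matrix (Fin p) (Fin p) ℝ) (a : Fin p → ℝ) (u : Fin p → ℝ) : ℝ :=
  ∏ i, normal1 (a i) ((V *ᵥ u) i)

section gk
variable {p : ℕ} {V : Matrix (Fin p) (Fin p) ℝ} {a : Fin p → ℝ}

lemma gk_pos (ha : ∀ i, 0 < a i) (u : Fin p → ℝ) : 0 < gk V a u :=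
  Finset.prod_pos fun i _ => normal1_pos (ha i) _

lemma continuous_mulVec_apply {k l : ℕ} (M : Matrix (Fin k) (Fin l) ℝ) (i : Fin k) :
    Continuous fun u : Fin l → ℝ => (M *ᵥ u) i :=
  (continuous_apply i).comp (Continuous.matrix_mulVec continuous_const continuous_id)

lemma continuous_gk : Continuous (gk V a) :=
  continuous_finsetProd _ fun i _ => (continuous_normal1 _).comp (continuous_mulVec_apply V i)

lemma gk_neg (u : Fin p → ℝ) : gk V a (-u) = gk V a u := by
  simp [gk, Matrix.mulVec_neg, normal1_neg]

lemma gk_sub_comm (u v : Fin p → ℝ) : gk V a (u - v) = gk V a (v - u) := by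
  rw [← gk_neg, neg_sub]

/-- Change variables to V u and apply Tonelli. The kernel is not normalized: its mass is the
Jacobian factor, which does not depend on the variances, so it cancels in all later quotients of
smoothings. -/
lemma lintegral_gk_mul (hV : V.det ≠ 0) (ha : ∀ i, 0 < a i) (f : Fin p → ℝ → ℝ≥0∞)
    (hf : ∀ i, Measurable (f i)) :
    ∫⁻ u, ENNReal.ofReal (gk V a u) * ∏ i, f i ((V *ᵥ u) i) =
      ENNReal.ofReal |V.det⁻¹| * ∏ i, ∫⁻ t, ENNReal.ofReal (normal1 (a i) t) * f i t := by
  have hm : ∀ i, Measurable fun t => ENNReal.ofReal (normal1 (a i) t) * f i t := fun i =>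
    (continuous_normal1 _).measurable.ennreal_ofReal.mul (hf i)
  rw [← lintegral_prod_coord _ hm, ← lintegral_comp_mulVec hV]
  · apply lintegral_congr
    intro u
    rw [gk, ENNReal.ofReal_prod_of_nonneg fun i _ => (normal1_pos (ha i) _).le,
      Finset.prod_mul_distrib]
  · exact Finset.measurable_prod _ fun i _ => (hm i).comp (measurable_pi_apply i)

lemma lintegral_gk (hV : V.det ≠ 0) (ha : ∀ i, 0 < a i) :
    ∫⁻ u, ENNReal.ofReal (gk V a u) = ENNReal.ofReal |V.det⁻¹| := by
  have h := lintegral_gk_mul hV ha (fun _ _ => 1) (fun _ => measurable_const)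
  simpa [lintegral_normal1 (ha _)] using h

/-- Isolating the value at 0 reduces comparisons of kernels to comparisons of quadratic forms, with
no normalizing constants to compute. -/
lemma gk_eq_exp (ha : ∀ i, 0 < a i) (u : Fin p → ℝ) :
    gk V a u = gk V a 0 * Real.exp (-(∑ i, (V *ᵥ u) i ^ 2 / a i) / 2) := by
  simp only [gk, normal1, Finset.prod_mul_distrib]
  simp only [Matrix.mulVec_zero, Pi.zero_apply]
  rw [← Real.exp_sum, ← Real.exp_sum]
  have : ∑ i, -(V *ᵥ u) i ^ 2 / (2 * a i) = -(∑ i, (V *ᵥ u) i ^ 2 / a i) / 2 := by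
    rw [neg_div, Finset.sum_div, ← Finset.sum_neg_distrib]
    refine Finset.sum_congr rfl fun i _ => ?_
    have := (ha i).ne'
    field_simp
  rw [this]
  simp

end gk

/-! ### The normal linear model -/

section model
variable {k p : ℕ} (M : Matrix (Fin k) (Fin p) ℝ)

lemma modelDensity_eq_exp (β : Fin p → ℝ) (z : Fin k → ℝ) :
    modelDensity M β z = (2 * Real.pi) ^ (-(k : ℝ) / 2) *
      Real.exp (-((z - M *ᵥ β) ⬝ᵥ (z - M *ᵥ β)) / 2) := by
  simp [modelDensity, normalDensity]

lemma modelDensity_eq_gk (β : Fin p → ℝ) (z : Fin k → ℝ) :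
    modelDensity M β z = gk (1 : Matrix (Fin k) (Fin k) ℝ) (fun _ => 1) (z - M *ᵥ β) := by
  rw [gk_eq_exp (fun _ => one_pos), modelDensity_eq_exp]
  congr 1
  · simp only [gk, normal1, Matrix.one_mulVec]
    simp only [Pi.zero_apply, Finset.prod_const, Finset.card_univ, Fintype.card_fin]
    rw [Real.sqrt_eq_rpow, ← Real.rpow_neg (by positivity)]
    simp only [mul_one, ne_eq, OfNat.ofNat_ne_zero, not_false_eq_true, zero_pow, neg_zero,
      zero_div, Real.exp_zero]
    rw [← Real.rpow_natCast, ← Real.rpow_mul (by positivity)]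
    congr 1
    ring
  · simp [dotProduct, sq]

lemma modelDensity_pos (β : Fin p → ℝ) (z : Fin k → ℝ) : 0 < modelDensity M β z := by
  rw [modelDensity_eq_gk]; exact gk_pos (fun _ => one_pos) _

lemma continuous_modelDensity : Continuous fun q : (Fin p → ℝ) × (Fin k → ℝ) =>
    modelDensity M q.1 q.2 := by
  simp_rw [modelDensity_eq_gk]
  exact continuous_gk.comp (continuous_snd.sub
    (Continuous.matrix_mulVec continuous_const continuous_fst))

lemma lintegral_modelDensity (β : Fin p → ℝ) :
    ∫⁻ z, ENNReal.ofReal (modelDensity M β z) = 1 := by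
  simp_rw [modelDensity_eq_gk]
  rw [lintegral_sub_right_eq_self
    (fun z => ENNReal.ofReal (gk (1 : Matrix (Fin k) (Fin k) ℝ) (fun _ => 1) z)),
    lintegral_gk (by simp) (fun _ => one_pos)]
  simp

lemma modelDensity_add (β η : Fin p → ℝ) (z : Fin k → ℝ) :
    modelDensity M (β + η) (z + M *ᵥ η) = modelDensity M β z := by
  rw [modelDensity_eq_gk, modelDensity_eq_gk, Matrix.mulVec_add]
  congr 1
  abel

/-- The square of a residual, expanded. -/
lemma residual_dotProduct_self (β : Fin p → ℝ) (z : Fin k → ℝ) :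
    (z - M *ᵥ β) ⬝ᵥ (z - M *ᵥ β) = z ⬝ᵥ z - 2 * ((Mᵀ *ᵥ z) ⬝ᵥ β) + β ⬝ᵥ ((Mᵀ * M) *ᵥ β) := by
  have h1 : z ⬝ᵥ (M *ᵥ β) = (Mᵀ *ᵥ z) ⬝ᵥ β := by
    rw [Matrix.dotProduct_mulVec, Matrix.mulVec_transpose]
  have h2 : (M *ᵥ β) ⬝ᵥ (M *ᵥ β) = β ⬝ᵥ ((Mᵀ * M) *ᵥ β) := by
    rw [← Matrix.mulVec_mulVec, Matrix.dotProduct_mulVec β, Matrix.vecMul_transpose]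
  have h3 : (M *ᵥ β) ⬝ᵥ z = z ⬝ᵥ (M *ᵥ β) := dotProduct_comm _ _
  simp only [sub_dotProduct, dotProduct_sub]
  rw [h3, h2, h1]
  ring

end model

/-- The weighted square in the coordinates `V u`, expanded around `z`. -/
lemma sum_sq_div_sub {p : ℕ} {V : Matrix (Fin p) (Fin p) ℝ} {a : Fin p → ℝ}
    (z β : Fin p → ℝ) :
    ∑ i, (V *ᵥ (z - β)) i ^ 2 / a i = ∑ i, (V *ᵥ z) i ^ 2 / a i
      - 2 * (((Vᵀ * diagonal (fun i => (a i)⁻¹) * V) *ᵥ z) ⬝ᵥ β)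
      + β ⬝ᵥ ((Vᵀ * diagonal (fun i => (a i)⁻¹) * V) *ᵥ β) := by
  have key : ∀ u w : Fin p → ℝ, ((Vᵀ * diagonal (fun i => (a i)⁻¹) * V) *ᵥ u) ⬝ᵥ w =
      ∑ i, (V *ᵥ u) i * (V *ᵥ w) i / a i := by
    intro u w
    rw [← Matrix.mulVec_mulVec, ← Matrix.mulVec_mulVec, Matrix.mulVec_transpose,
      ← Matrix.dotProduct_mulVec]
    simp only [dotProduct, Matrix.mulVec_diagonal]
    refine Finset.sum_congr rfl fun i _ => ?_
    rw [div_eq_mul_inv]; ring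
  rw [dotProduct_comm β, key, key, Finset.mul_sum, ← Finset.sum_sub_distrib,
    ← Finset.sum_add_distrib]
  refine Finset.sum_congr rfl fun i _ => ?_
  rw [Matrix.mulVec_sub, Pi.sub_apply]
  ring

/-! ### Location families and invariant factors -/

/-- The integral against a function that is equivariant under translations factorizes. -/
lemma lintegral_equivariant {p : ℕ} {E : Type*} [AddGroup E] [MeasurableSpace E] [MeasurableAdd E]
    (μ : Measure E) [SFinite μ] [μ.IsAddRightInvariant] {ι : (Fin p → ℝ) → E}
    {ζ : E → Fin p → ℝ} (hζ : Measurable ζ) (hζι : ∀ e η, ζ (e + ι η) = ζ e + η)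
    {F : E → (Fin p → ℝ) → ℝ≥0∞} (hF : Measurable (Function.uncurry F))
    (hFι : ∀ e η z, F (e + ι η) z = F e z) {g : (Fin p → ℝ) → ℝ≥0∞} (hg : Measurable g) :
    (∫⁻ e, F e (ζ e) ∂μ) * ∫⁻ z, g z = ∫⁻ e, g (ζ e) * (∫⁻ z, F e z) ∂μ := by
  have hFζ : Measurable fun e => F e (ζ e) := hF.comp (measurable_id.prodMk hζ)
  have m1 : Measurable (Function.uncurry fun (e : E) (η : Fin p → ℝ) =>
      F e (ζ e) * g (ζ e - η)) :=
    (hFζ.comp measurable_fst).mul (hg.comp ((hζ.comp measurable_fst).sub measurable_snd))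
  have m2 : Measurable (Function.uncurry fun (η : Fin p → ℝ) (e : E) =>
      F e (ζ e + η) * g (ζ e)) :=
    (hF.comp (measurable_snd.prodMk ((hζ.comp measurable_snd).add measurable_fst))).mul
      (hg.comp (hζ.comp measurable_snd))
  calc (∫⁻ e, F e (ζ e) ∂μ) * ∫⁻ z, g z
      = ∫⁻ e, F e (ζ e) * (∫⁻ z, g z) ∂μ := (lintegral_mul_const _ hFζ).symm
    _ = ∫⁻ e, (∫⁻ η, F e (ζ e) * g (ζ e - η)) ∂μ := by
        refine lintegral_congr fun e => ?_
        have : Measurable fun η => g (ζ e - η) := hg.comp (measurable_const.sub measurable_id)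
        rw [lintegral_const_mul _ this, lintegral_sub_left_eq_self]
    _ = ∫⁻ η, ∫⁻ e, F e (ζ e) * g (ζ e - η) ∂μ := lintegral_lintegral_swap m1.aemeasurable
    _ = ∫⁻ η, ∫⁻ e, F e (ζ e + η) * g (ζ e) ∂μ := by
        refine lintegral_congr fun η => ?_
        rw [← lintegral_add_right_eq_self _ (ι η)]
        refine lintegral_congr fun e => ?_
        rw [hζι, hFι, add_sub_cancel_right]
    _ = ∫⁻ e, (∫⁻ η, F e (ζ e + η) * g (ζ e)) ∂μ := lintegral_lintegral_swap m2.aemeasurable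
    _ = ∫⁻ e, g (ζ e) * (∫⁻ z, F e z) ∂μ := by
        refine lintegral_congr fun e => ?_
        have : Measurable fun η => F e (ζ e + η) :=
          hF.comp (measurable_const.prodMk (measurable_const.add measurable_id))
        rw [lintegral_mul_const _ this, lintegral_add_left_eq_self, mul_comm]

/-- A family of densities on `E` with parameter in `ℝ^p`, a sufficient statistic `ζ` whose law is a
location family with the (unnormalized) kernel `κ`. -/
structure LocationModel {p : ℕ} {E : Type*} [AddGroup E] [MeasurableSpace E]
    (μ : Measure E) (P : (Fin p → ℝ) → E → ℝ≥0∞) (ι : (Fin p → ℝ) → E) (ζ : E → Fin p → ℝ)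
    (κ : (Fin p → ℝ) → ℝ≥0∞) (Φ : E → ℝ≥0∞) : Prop where
  measurable_stat : Measurable ζ
  stat_add : ∀ e η, ζ (e + ι η) = ζ e + η
  measurable_kernel : Measurable κ
  measurable_factor : Measurable Φ
  factor_add : ∀ e η, Φ (e + ι η) = Φ e
  eq_mul : ∀ β e, P β e = Φ e * κ (ζ e - β)
  lintegral_eq_one : ∫⁻ e, P 0 e ∂μ = 1

section LocationModel
variable {p : ℕ} {E : Type*} [AddGroup E] [MeasurableSpace E] [MeasurableAdd E]
    {μ : Measure E} [SFinite μ] [μ.IsAddRightInvariant] {P : (Fin p → ℝ) → E → ℝ≥0∞}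
    {ι : (Fin p → ℝ) → E} {ζ : E → Fin p → ℝ} {κ : (Fin p → ℝ) → ℝ≥0∞} {Φ : E → ℝ≥0∞}

/-- Take g = κ in `lintegral_equivariant`: the total mass of κ appears on the left, and on the right
κ(ζ e) recombines with Φ e into the density at parameter 0, which integrates to 1. Thus the law of
the statistic comes out without disintegrating the measure. -/
lemma LocationModel.lintegral_stat_mul (M : LocationModel μ P ι ζ κ Φ) (β : Fin p → ℝ)
    {h : (Fin p → ℝ) → ℝ≥0∞} (hh : Measurable h) :
    (∫⁻ e, P β e * h (ζ e) ∂μ) * ∫⁻ z, κ z = ∫⁻ z, κ (z - β) * h z := by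
  have hκ := M.measurable_kernel
  have hΦ := M.measurable_factor
  have hm : Measurable fun z => κ (z - β) * h z :=
    (hκ.comp (measurable_id.sub measurable_const)).mul hh
  have e := lintegral_equivariant μ M.measurable_stat M.stat_add
    (F := fun e z => Φ e * (κ (z - β) * h z))
    ((hΦ.comp measurable_fst).mul (hm.comp measurable_snd))
    (fun e η z => by simp only [M.factor_add]) hκ
  have e1 : ∀ e, P β e * h (ζ e) = Φ e * (κ (ζ e - β) * h (ζ e)) := fun e => by
    rw [M.eq_mul, mul_assoc]
  simp_rw [e1]
  rw [e]
  have e2 : ∀ e, κ (ζ e) * ∫⁻ z, Φ e * (κ (z - β) * h z) =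
      P 0 e * ∫⁻ z, κ (z - β) * h z := fun e => by
    rw [lintegral_const_mul _ hm, M.eq_mul, sub_zero]; ring
  simp_rw [e2]
  have hP : Measurable fun e => P 0 e := by
    simp_rw [M.eq_mul]
    exact hΦ.mul (hκ.comp (M.measurable_stat.sub measurable_const))
  rw [lintegral_mul_const _ hP, M.lintegral_eq_one, one_mul]

/-- If `ζ'` is another equivariant statistic whose law under `P 0` has the kernel `κ'`, then
smoothing with `κ` and moving by `ζ' - ζ` is smoothing with `κ'`. -/
lemma LocationModel.lintegral_smoothing (M : LocationModel μ P ι ζ κ Φ)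
    (hκs : ∀ z, κ (-z) = κ z)
    {ζ' : E → Fin p → ℝ} (hζ' : Measurable ζ') (hζ'ι : ∀ e η, ζ' (e + ι η) = ζ' e + η)
    {κ' : (Fin p → ℝ) → ℝ≥0∞} (hκ's : ∀ z, κ' (-z) = κ' z)
    (hlaw : ∀ f : (Fin p → ℝ) → ℝ≥0∞, Measurable f →
      (∫⁻ e, P 0 e * f (ζ' e) ∂μ) * ∫⁻ z, κ z = ∫⁻ z, κ' z * f z)
    (β : Fin p → ℝ) {π h : (Fin p → ℝ) → ℝ≥0∞} (hπ : Measurable π) (hh : Measurable h) :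
    (∫⁻ e, P β e * ((∫⁻ b, κ (ζ' e - b) * π b) * h (ζ e)) ∂μ) * ∫⁻ z, κ z =
      ∫⁻ z, κ (z - β) * ((∫⁻ b, κ' (z - b) * π b) * h z) := by
  have hκ := M.measurable_kernel
  have hΦ := M.measurable_factor
  have hζ := M.measurable_stat
  have conv : ∀ (k : (Fin p → ℝ) → ℝ≥0∞), (∀ z, k (-z) = k z) → ∀ z,
      ∫⁻ b, k (z - b) * π b = ∫⁻ w, k w * π (z + w) := by
    intro k hk z
    rw [← lintegral_add_left_eq_self _ z]
    refine lintegral_congr fun w => ?_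
    rw [← hk w]; congr 2; abel
  have hP : Measurable fun e => P 0 e := by
    simp_rw [M.eq_mul]
    exact hΦ.mul (hκ.comp (hζ.sub measurable_const))
  have hmm : Measurable fun z => ∫⁻ b, κ (z - b) * π b := by
    apply Measurable.lintegral_prod_right'
      (f := fun q : (Fin p → ℝ) × (Fin p → ℝ) => κ (q.1 - q.2) * π q.2)
    exact (hκ.comp (measurable_fst.sub measurable_snd)).mul (hπ.comp measurable_snd)
  -- The displacement ζ' - ζ is translation invariant. Averaging the κ-smoothing over it adds its
  -- law to κ, and the result is the kernel κ' of ζ' = ζ + (ζ' - ζ).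
  have inner : ∀ z, ∫⁻ e, P 0 e * (∫⁻ b, κ (ζ' e - ζ e + z - b) * π b) ∂μ =
      ∫⁻ b, κ' (z - b) * π b := by
    intro z
    rw [conv κ' hκ's, ← hlaw (fun w => π (z + w)) (hπ.comp (measurable_const.add measurable_id))]
    have hF : Measurable (Function.uncurry fun (e : E) (w : Fin p → ℝ) =>
        Φ e * (κ w * π (ζ' e - ζ e + z + w))) := by
      refine (hΦ.comp measurable_fst).mul ((hκ.comp measurable_snd).mul (hπ.comp ?_))
      exact ((((hζ'.comp measurable_fst).sub (hζ.comp measurable_fst)).add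
        measurable_const)).add measurable_snd
    have e := lintegral_equivariant μ hζ M.stat_add hF
      (fun e η w => by simp only [M.factor_add, hζ'ι, M.stat_add, add_sub_add_right_eq_sub]) hκ
    have e1 : ∀ e, Φ e * (κ (ζ e) * π (ζ' e - ζ e + z + ζ e)) = P 0 e * π (z + ζ' e) := by
      intro e
      have : ζ' e - ζ e + z + ζ e = z + ζ' e := by abel
      rw [M.eq_mul, sub_zero, this, mul_assoc]
    simp_rw [e1] at e
    rw [e]
    refine lintegral_congr fun e => ?_
    rw [conv κ hκs, M.eq_mul, sub_zero, lintegral_const_mul]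
    · ring
    · exact hκ.mul (hπ.comp (measurable_const.add measurable_id))
  have hF : Measurable (Function.uncurry fun (e : E) (z : Fin p → ℝ) =>
      Φ e * (κ (z - β) * ((∫⁻ b, κ (ζ' e - ζ e + z - b) * π b) * h z))) := by
    refine (hΦ.comp measurable_fst).mul ((hκ.comp (measurable_snd.sub measurable_const)).mul
      ((hmm.comp ?_).mul (hh.comp measurable_snd)))
    exact ((hζ'.comp measurable_fst).sub (hζ.comp measurable_fst)).add measurable_snd
  -- The second use of equivariance separates ζ from the invariant displacement: ζ e is replaced by
  -- a free variable z with kernel κ(z - β), and the displacement is then averaged under parameter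
  -- 0.
  have e := lintegral_equivariant μ hζ M.stat_add hF
    (fun e η w => by simp only [M.factor_add, hζ'ι, M.stat_add, add_sub_add_right_eq_sub]) hκ
  have e1 : ∀ e, P β e * ((∫⁻ b, κ (ζ' e - b) * π b) * h (ζ e)) =
      Φ e * (κ (ζ e - β) * ((∫⁻ b, κ (ζ' e - ζ e + ζ e - b) * π b) * h (ζ e))) := by
    intro e
    rw [M.eq_mul, sub_add_cancel, mul_assoc]
  simp_rw [e1]
  rw [e]
  have hG : Measurable (Function.uncurry fun (e : E) (z : Fin p → ℝ) =>
      P 0 e * (κ (z - β) * ((∫⁻ b, κ (ζ' e - ζ e + z - b) * π b) * h z))) := by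
    refine (hP.comp measurable_fst).mul ((hκ.comp (measurable_snd.sub measurable_const)).mul
      ((hmm.comp ?_).mul (hh.comp measurable_snd)))
    exact ((hζ'.comp measurable_fst).sub (hζ.comp measurable_fst)).add measurable_snd
  calc _ = ∫⁻ e, (∫⁻ z, P 0 e * (κ (z - β) *
        ((∫⁻ b, κ (ζ' e - ζ e + z - b) * π b) * h z))) ∂μ := by
        refine lintegral_congr fun e => ?_
        have m1 : Measurable fun z => κ (z - β) *
            ((∫⁻ b, κ (ζ' e - ζ e + z - b) * π b) * h z) :=
          (hκ.comp (measurable_id.sub measurable_const)).mul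
            ((hmm.comp (measurable_const.add measurable_id)).mul hh)
        rw [lintegral_const_mul _ m1, lintegral_const_mul _ m1, M.eq_mul, sub_zero]
        ring
    _ = ∫⁻ z, ∫⁻ e, P 0 e * (κ (z - β) *
        ((∫⁻ b, κ (ζ' e - ζ e + z - b) * π b) * h z)) ∂μ :=
        lintegral_lintegral_swap hG.aemeasurable
    _ = _ := by
        refine lintegral_congr fun z => ?_
        rw [← inner z]
        have m1 : Measurable fun e => P 0 e * ∫⁻ b, κ (ζ' e - ζ e + z - b) * π b :=
          hP.mul (hmm.comp ((hζ'.sub hζ).add measurable_const))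
        rw [mul_left_comm, ← lintegral_mul_const _ m1]
        refine lintegral_congr fun e => ?_
        ring

end LocationModel

/-- A location model built from positive real densities. -/
lemma LocationModel.of_real {p : ℕ} {E : Type*} [AddGroup E] [MeasurableSpace E]
    {μ : Measure E} {P : (Fin p → ℝ) → E → ℝ} {ι : (Fin p → ℝ) → E} {ζ : E → Fin p → ℝ}
    {k : (Fin p → ℝ) → ℝ} (hζ : Measurable ζ) (hζι : ∀ e η, ζ (e + ι η) = ζ e + η)
    (hk : Measurable k) (hk0 : ∀ u, 0 < k u) (hP : Measurable (P 0)) (hP0 : ∀ e, 0 < P 0 e)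
    (hadd : ∀ η e, P η (e + ι η) = P 0 e)
    (hdec : ∀ β e, P β e * k (ζ e) = P 0 e * k (ζ e - β))
    (h1 : ∫⁻ e, ENNReal.ofReal (P 0 e) ∂μ = 1) :
    LocationModel μ (fun β e => ENNReal.ofReal (P β e)) ι ζ (fun u => ENNReal.ofReal (k u))
      (fun e => ENNReal.ofReal (P 0 e / k (ζ e))) where
  measurable_stat := hζ
  stat_add := hζι
  measurable_kernel := hk.ennreal_ofReal
  measurable_factor := (hP.div (hk.comp hζ)).ennreal_ofReal
  factor_add e η := by
    have h := hdec η (e + ι η)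
    rw [hadd, hζι, add_sub_cancel_right] at h
    rw [hζι, (div_eq_div_iff (hk0 _).ne' (hk0 _).ne').2 h.symm]
  eq_mul β e := by
    rw [← ENNReal.ofReal_mul (div_pos (hP0 _) (hk0 _)).le]
    congr 1
    rw [div_mul_eq_mul_div, ← hdec, mul_div_cancel_right₀ _ (hk0 _).ne']
  lintegral_eq_one := h1

/-! ### Whitening coordinates and least squares statistics -/

/-- Coordinates `V u` that turn `A'A` into the identity and `A'A + B'B` into a diagonal matrix. -/
structure Whitening {m n p : ℕ} (A : Matrix (Fin m) (Fin p) ℝ) (B : Matrix (Fin n) (Fin p) ℝ)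
    (V : Matrix (Fin p) (Fin p) ℝ) (d : Fin p → ℝ) : Prop where
  det_ne_zero : V.det ≠ 0
  -- The entries are written as inverses to make this the case of unit variances of the form used in
  -- `normalSolution_mul` and its companions.
  gram_eq : Aᵀ * A = Vᵀ * diagonal (fun _ => (1 : ℝ)⁻¹) * V
  info_eq : Aᵀ * A + Bᵀ * B = Vᵀ * diagonal (fun i => (d i)⁻¹) * V
  pos : ∀ i, 0 < d i
  le_one : ∀ i, d i ≤ 1

/-- The solution of the normal equations. -/
def normalSolution {p : ℕ} (V : Matrix (Fin p) (Fin p) ℝ) (a : Fin p → ℝ) (c : Fin p → ℝ) :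
    Fin p → ℝ :=
  (V⁻¹ * diagonal a * V⁻¹ᵀ) *ᵥ c

section normalSolution
variable {p : ℕ} {V : Matrix (Fin p) (Fin p) ℝ} {a : Fin p → ℝ}

lemma continuous_normalSolution : Continuous (normalSolution V a) :=
  Continuous.matrix_mulVec continuous_const continuous_id

lemma normalSolution_mul (hV : V.det ≠ 0) (ha : ∀ i, 0 < a i) :
    (V⁻¹ * diagonal a * V⁻¹ᵀ) * (Vᵀ * diagonal (fun i => (a i)⁻¹) * V) = 1 := by
  have hu : IsUnit V.det := hV.isUnit
  have h1 : V⁻¹ᵀ * Vᵀ = 1 := by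
    rw [← Matrix.transpose_mul, Matrix.mul_nonsing_inv _ hu, Matrix.transpose_one]
  have h2 : diagonal a * diagonal (fun i => (a i)⁻¹) = (1 : Matrix (Fin p) (Fin p) ℝ) := by
    rw [Matrix.diagonal_mul_diagonal, ← Matrix.diagonal_one]
    congr 1
    funext i
    exact mul_inv_cancel₀ (ha i).ne'
  calc _ = V⁻¹ * diagonal a * (V⁻¹ᵀ * Vᵀ) * diagonal (fun i => (a i)⁻¹) * V := by
        simp only [Matrix.mul_assoc]
    _ = V⁻¹ * (diagonal a * diagonal (fun i => (a i)⁻¹)) * V := by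
        rw [h1, Matrix.mul_one, Matrix.mul_assoc V⁻¹]
    _ = 1 := by rw [h2, Matrix.mul_one, Matrix.nonsing_inv_mul _ hu]

lemma mul_normalSolution (hV : V.det ≠ 0) (ha : ∀ i, 0 < a i) (c : Fin p → ℝ) :
    (Vᵀ * diagonal (fun i => (a i)⁻¹) * V) *ᵥ normalSolution V a c = c := by
  rw [normalSolution, Matrix.mulVec_mulVec,
    mul_eq_one_comm.1 (normalSolution_mul hV ha), Matrix.one_mulVec]

lemma normalSolution_add (hV : V.det ≠ 0) (ha : ∀ i, 0 < a i) (c η : Fin p → ℝ) :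
    normalSolution V a (c + (Vᵀ * diagonal (fun i => (a i)⁻¹) * V) *ᵥ η) =
      normalSolution V a c + η := by
  rw [normalSolution, normalSolution, Matrix.mulVec_add, Matrix.mulVec_mulVec _ (V⁻¹ * _ * _),
    normalSolution_mul hV ha, Matrix.one_mulVec]

/-- Completing the square at the solution of the normal equations. The β-dependent exponent is the
one in `modelDensity_eq_zero_mul`, which is how the estimator becomes a sufficient statistic. -/
lemma gk_normalSolution_sub (hV : V.det ≠ 0) (ha : ∀ i, 0 < a i) (c β : Fin p → ℝ) :
    gk V a (normalSolution V a c - β) = gk V a (normalSolution V a c) *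
      Real.exp (-(-2 * (c ⬝ᵥ β) + β ⬝ᵥ ((Vᵀ * diagonal (fun i => (a i)⁻¹) * V) *ᵥ β)) / 2) := by
  rw [gk_eq_exp ha, gk_eq_exp ha (normalSolution V a c), sum_sq_div_sub, mul_normalSolution hV ha,
    mul_assoc (gk V a 0), ← Real.exp_add]
  congr 2
  ring

end normalSolution

lemma measurable_modelDensity {k p : ℕ} (M : Matrix (Fin k) (Fin p) ℝ) (β : Fin p → ℝ) :
    Measurable (modelDensity M β) := by
  have : modelDensity M β = fun z => gk (1 : Matrix (Fin k) (Fin k) ℝ) (fun _ => 1) (z - M *ᵥ β) :=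
    funext (modelDensity_eq_gk M β)
  rw [this]
  exact (continuous_gk.comp (continuous_id.sub continuous_const)).measurable

/-- The exponential family form: the data meet β only through Mᵀ z. -/
lemma modelDensity_eq_zero_mul {k p : ℕ} (M : Matrix (Fin k) (Fin p) ℝ) (β : Fin p → ℝ)
    (z : Fin k → ℝ) : modelDensity M β z = modelDensity M 0 z *
      Real.exp (-(-2 * ((Mᵀ *ᵥ z) ⬝ᵥ β) + β ⬝ᵥ ((Mᵀ * M) *ᵥ β)) / 2) := by
  rw [modelDensity_eq_exp, modelDensity_eq_exp, residual_dotProduct_self, Matrix.mulVec_zero,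
    sub_zero, mul_assoc (_ ^ _), ← Real.exp_add]
  congr 2
  ring

section Whitening
variable {m n p : ℕ} {A : Matrix (Fin m) (Fin p) ℝ} {B : Matrix (Fin n) (Fin p) ℝ}
  {V : Matrix (Fin p) (Fin p) ℝ} {d : Fin p → ℝ}

/-- The least squares estimator of `β` from `x`. -/
def statA (A : Matrix (Fin m) (Fin p) ℝ) (V : Matrix (Fin p) (Fin p) ℝ) (x : Fin m → ℝ) :
    Fin p → ℝ :=
  normalSolution V (fun _ => 1) (Aᵀ *ᵥ x)

/-- The least squares estimator of `β` from `x` and `y`. -/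
def statC (A : Matrix (Fin m) (Fin p) ℝ) (B : Matrix (Fin n) (Fin p) ℝ)
    (V : Matrix (Fin p) (Fin p) ℝ) (d : Fin p → ℝ) (e : (Fin m → ℝ) × (Fin n → ℝ)) : Fin p → ℝ :=
  normalSolution V d (Aᵀ *ᵥ e.1 + Bᵀ *ᵥ e.2)

lemma continuous_statA : Continuous (statA A V) :=
  continuous_normalSolution.comp (Continuous.matrix_mulVec continuous_const continuous_id)

lemma continuous_statC : Continuous (statC A B V d) :=
  continuous_normalSolution.comp
    ((Continuous.matrix_mulVec continuous_const continuous_fst).add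
      (Continuous.matrix_mulVec continuous_const continuous_snd))

lemma Whitening.statA_add (h : Whitening A B V d) (x : Fin m → ℝ) (η : Fin p → ℝ) :
    statA A V (x + A *ᵥ η) = statA A V x + η := by
  rw [statA, Matrix.mulVec_add, Matrix.mulVec_mulVec, h.gram_eq]
  exact normalSolution_add h.det_ne_zero (fun _ => one_pos) _ _

lemma Whitening.statC_add (h : Whitening A B V d) (e : (Fin m → ℝ) × (Fin n → ℝ))
    (η : Fin p → ℝ) : statC A B V d (e + (A *ᵥ η, B *ᵥ η)) = statC A B V d e + η := by
  rw [statC, Prod.fst_add, Prod.snd_add, Matrix.mulVec_add, Matrix.mulVec_add,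
    Matrix.mulVec_mulVec, Matrix.mulVec_mulVec, add_add_add_comm, ← Matrix.add_mulVec, h.info_eq]
  exact normalSolution_add h.det_ne_zero h.pos _ _

/-- The likelihood and the kernel at the estimator have the same β-dependent exponential by
`gram_eq`, so their quotient is the factor free of β. `locationModelC` does the same for the pair
(x, y) with `info_eq`, where the exponents of the two likelihoods add up. -/
lemma Whitening.locationModelA (h : Whitening A B V d) :
    LocationModel (E := Fin m → ℝ) volume (fun β x => ENNReal.ofReal (modelDensity A β x))
      (fun η => A *ᵥ η) (statA A V)
      (fun u => ENNReal.ofReal (gk V (fun _ => 1) u))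
      (fun x => ENNReal.ofReal (modelDensity A 0 x / gk V (fun _ => 1) (statA A V x))) := by
  have hpos : ∀ u, 0 < gk V (fun _ => 1) u := gk_pos fun _ => one_pos
  have hP := measurable_modelDensity A 0
  have hadd : ∀ η x, modelDensity A η (x + A *ᵥ η) = modelDensity A 0 x := by
    intro η x
    have := modelDensity_add A 0 η x
    rwa [zero_add] at this
  have hdec : ∀ β x, modelDensity A β x * gk V (fun _ => 1) (statA A V x) =
      modelDensity A 0 x * gk V (fun _ => 1) (statA A V x - β) := by
    intro β x
    rw [statA, gk_normalSolution_sub h.det_ne_zero fun _ => one_pos, modelDensity_eq_zero_mul A β,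
      h.gram_eq]
    ring
  exact LocationModel.of_real (P := modelDensity A) (k := gk V (fun _ => 1)) (E := Fin m → ℝ) (ι := fun η => A *ᵥ η)
    continuous_statA.measurable h.statA_add continuous_gk.measurable hpos hP
    (modelDensity_pos A 0) hadd hdec (lintegral_modelDensity A 0)

lemma Whitening.locationModelC (h : Whitening A B V d) :
    LocationModel (E := (Fin m → ℝ) × (Fin n → ℝ)) volume (fun β (e : (Fin m → ℝ) × (Fin n → ℝ)) =>
        ENNReal.ofReal (modelDensity A β e.1 * modelDensity B β e.2))
      (fun η => (A *ᵥ η, B *ᵥ η)) (statC A B V d)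
      (fun u => ENNReal.ofReal (gk V d u))
      (fun e => ENNReal.ofReal (modelDensity A 0 e.1 * modelDensity B 0 e.2 /
        gk V d (statC A B V d e))) := by
  have mA := measurable_modelDensity A 0
  have mB := measurable_modelDensity B 0
  have hadd : ∀ η (e : (Fin m → ℝ) × (Fin n → ℝ)),
      modelDensity A η (e + (A *ᵥ η, B *ᵥ η)).1 * modelDensity B η (e + (A *ᵥ η, B *ᵥ η)).2 =
        modelDensity A 0 e.1 * modelDensity B 0 e.2 := by
    intro η e
    have h1 := modelDensity_add A 0 η e.1
    have h2 := modelDensity_add B 0 η e.2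
    rw [zero_add] at h1 h2
    rw [Prod.fst_add, Prod.snd_add, h1, h2]
  have hdec : ∀ β (e : (Fin m → ℝ) × (Fin n → ℝ)),
      modelDensity A β e.1 * modelDensity B β e.2 * gk V d (statC A B V d e) =
        modelDensity A 0 e.1 * modelDensity B 0 e.2 * gk V d (statC A B V d e - β) := by
    intro β e
    rw [statC, gk_normalSolution_sub h.det_ne_zero h.pos, modelDensity_eq_zero_mul A β,
      modelDensity_eq_zero_mul B β, ← h.info_eq, Matrix.add_mulVec, add_dotProduct, dotProduct_add]
    have : ∀ a b c x y : ℝ, a * x * (b * y) * c = a * b * (c * (x * y)) := by intros; ring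
    rw [this, ← Real.exp_add]
    congr 4
    ring
  have h1 : ∫⁻ e : (Fin m → ℝ) × (Fin n → ℝ),
      ENNReal.ofReal (modelDensity A 0 e.1 * modelDensity B 0 e.2) = 1 := by
    have : ∀ e : (Fin m → ℝ) × (Fin n → ℝ),
        ENNReal.ofReal (modelDensity A 0 e.1 * modelDensity B 0 e.2) =
        ENNReal.ofReal (modelDensity A 0 e.1) * ENNReal.ofReal (modelDensity B 0 e.2) :=
      fun e => ENNReal.ofReal_mul (modelDensity_pos A 0 _).le
    simp_rw [this]
    rw [Measure.volume_eq_prod, lintegral_prod_mul mA.ennreal_ofReal.aemeasurable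
      mB.ennreal_ofReal.aemeasurable, lintegral_modelDensity, lintegral_modelDensity, one_mul]
  exact LocationModel.of_real (E := (Fin m → ℝ) × (Fin n → ℝ)) (P := fun β (e : (Fin m → ℝ) × (Fin n → ℝ)) =>
        modelDensity A β e.1 * modelDensity B β e.2) (k := gk V d)
    (ι := fun η => (A *ᵥ η, B *ᵥ η))
    continuous_statC.measurable h.statC_add continuous_gk.measurable (gk_pos h.pos)
    ((mA.comp measurable_fst).mul (mB.comp measurable_snd))
    (fun e => mul_pos (modelDensity_pos A 0 _) (modelDensity_pos B 0 _)) hadd hdec h1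

end Whitening

/-! ### Smoothed priors -/

/-- The marginal density of the (unnormalized) normal kernel with variances `a` in the
coordinates `V u`. -/
def smooth {p : ℕ} (V : Matrix (Fin p) (Fin p) ℝ) (a : Fin p → ℝ) (π : (Fin p → ℝ) → ℝ≥0∞)
    (z : Fin p → ℝ) : ℝ≥0∞ :=
  ∫⁻ b, ENNReal.ofReal (gk V a (z - b)) * π b

section smooth
variable {p : ℕ} {V : Matrix (Fin p) (Fin p) ℝ} {a : Fin p → ℝ} {π : (Fin p → ℝ) → ℝ≥0∞}

lemma measurable_smooth (hπ : Measurable π) : Measurable (smooth V a π) := by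
  apply Measurable.lintegral_prod_right'
    (f := fun q : (Fin p → ℝ) × (Fin p → ℝ) => ENNReal.ofReal (gk V a (q.1 - q.2)) * π q.2)
  exact (continuous_gk.measurable.comp (measurable_fst.sub measurable_snd)).ennreal_ofReal.mul
    (hπ.comp measurable_snd)

lemma smooth_ne_zero (ha : ∀ i, 0 < a i) (hπ : Measurable π) (h0 : ¬ ∀ᵐ b, π b = 0)
    (z : Fin p → ℝ) : smooth V a π z ≠ 0 := by
  intro h
  rw [smooth, lintegral_eq_zero_iff] at h
  · apply h0
    filter_upwards [h] with b hb
    rcases mul_eq_zero.1 hb with h1 | h1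
    · exact absurd (ENNReal.ofReal_eq_zero.1 h1) (not_le.2 (gk_pos ha _))
    · exact h1
  · exact (continuous_gk.measurable.comp (measurable_const.sub measurable_id)).ennreal_ofReal.mul hπ

lemma smooth_one (hV : V.det ≠ 0) (ha : ∀ i, 0 < a i) (z : Fin p → ℝ) :
    smooth V a (fun _ => 1) z = ENNReal.ofReal |V.det⁻¹| := by
  simp_rw [smooth, mul_one]
  rw [lintegral_sub_left_eq_self (fun u => ENNReal.ofReal (gk V a u)), lintegral_gk hV ha]

lemma normal1_le {a : ℝ} (ha : 0 < a) (ha1 : a ≤ 1) (v : ℝ) :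
    normal1 a v ≤ (Real.sqrt a)⁻¹ * normal1 1 v := by
  unfold normal1
  rw [Real.sqrt_mul (by positivity), mul_inv, mul_one, mul_one]
  have : Real.exp (-v ^ 2 / (2 * a)) ≤ Real.exp (-v ^ 2 / 2) := by
    apply Real.exp_le_exp.2
    rw [neg_div, neg_div, neg_le_neg_iff]
    apply div_le_div_of_nonneg_left (sq_nonneg v) (by positivity) (by linarith)
  calc _ = ((Real.sqrt a)⁻¹ * (√(2 * Real.pi))⁻¹) * Real.exp (-v ^ 2 / (2 * a)) := by ring
    _ ≤ ((Real.sqrt a)⁻¹ * (√(2 * Real.pi))⁻¹) * Real.exp (-v ^ 2 / 2) :=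
        mul_le_mul_of_nonneg_left this (by positivity)
    _ = _ := by ring

lemma gk_le (ha : ∀ i, 0 < a i) (ha1 : ∀ i, a i ≤ 1) (u : Fin p → ℝ) :
    gk V a u ≤ (∏ i, (Real.sqrt (a i))⁻¹) * gk V (fun _ => 1) u := by
  rw [gk, gk, ← Finset.prod_mul_distrib]
  exact Finset.prod_le_prod (fun i _ => (normal1_pos (ha i) _).le)
    fun i _ => normal1_le (ha i) (ha1 i) _

/-- Kernels with smaller variances are bounded by a multiple of the unit one, so finiteness of the
marginal at Σ_A already gives finiteness at Σ_C. -/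
lemma smooth_ne_top (ha : ∀ i, 0 < a i) (ha1 : ∀ i, a i ≤ 1) {z : Fin p → ℝ}
    (h : smooth V (fun _ => 1) π z ≠ ⊤) : smooth V a π z ≠ ⊤ := by
  have h0 : (0 : ℝ) ≤ ∏ i, (Real.sqrt (a i))⁻¹ := Finset.prod_nonneg fun i _ => by positivity
  refine ne_top_of_le_ne_top (ENNReal.mul_ne_top
    (ENNReal.ofReal_ne_top (r := ∏ i, (Real.sqrt (a i))⁻¹)) h) ?_
  rw [smooth, smooth, ← lintegral_const_mul' _ _ ENNReal.ofReal_ne_top]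
  refine lintegral_mono fun b => ?_
  rw [← mul_assoc, ← ENNReal.ofReal_mul h0]
  gcongr
  exact gk_le ha ha1 _

end smooth

end PredReg

end

noncomputable section

namespace PredReg

attribute [local irreducible] modelDensity gk
open Filter Topology

/-! ### Comparison of risks -/

section KLRisk
variable {m n p : ℕ} {A : Matrix (Fin m) (Fin p) ℝ} {B : Matrix (Fin n) (Fin p) ℝ}

/-- The likelihood of `β` at `x`. -/
def lik {k p : ℕ} (M : Matrix (Fin k) (Fin p) ℝ) (β : Fin p → ℝ) (z : Fin k → ℝ) : ℝ≥0∞ :=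
  ENNReal.ofReal (modelDensity M β z)

lemma measurable_lik {k p : ℕ} (M : Matrix (Fin k) (Fin p) ℝ) :
    Measurable (Function.uncurry (lik M)) :=
  (continuous_modelDensity M).measurable.ennreal_ofReal

lemma measurable_lik_comp {k p : ℕ} (M : Matrix (Fin k) (Fin p) ℝ) {α : Type*} [MeasurableSpace α]
    {f : α → Fin p → ℝ} {g : α → Fin k → ℝ} (hf : Measurable f) (hg : Measurable g) :
    Measurable fun a => lik M (f a) (g a) :=
  (measurable_lik M).comp (hf.prodMk hg)

lemma lik_ne_zero {k p : ℕ} (M : Matrix (Fin k) (Fin p) ℝ) (β : Fin p → ℝ) (z : Fin k → ℝ) :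
    lik M β z ≠ 0 := (ENNReal.ofReal_pos.2 (modelDensity_pos M β z)).ne'

lemma lik_ne_top {k p : ℕ} (M : Matrix (Fin k) (Fin p) ℝ) (β : Fin p → ℝ) (z : Fin k → ℝ) :
    lik M β z ≠ ⊤ := ENNReal.ofReal_ne_top

lemma lintegral_lik {k p : ℕ} (M : Matrix (Fin k) (Fin p) ℝ) (β : Fin p → ℝ) :
    ∫⁻ z, lik M β z = 1 := lintegral_modelDensity M β

lemma klLoss_add_one_le (β : Fin p → ℝ) {q₁ q₂ : (Fin n → ℝ) → ℝ≥0∞} (h₁ : Measurable q₁)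
    (h₂ : Measurable q₂) (h₁1 : ∫⁻ y, q₁ y = 1) (h₂1 : ∫⁻ y, q₂ y = 1) (h₂0 : ∀ y, q₂ y ≠ 0) :
    klLoss B β q₂ + 1 ≤ klLoss B β q₁ + ∫⁻ y, lik B β y * (q₁ y / q₂ y) :=
  klDiv_add_one_le (measurable_lik_comp B measurable_const measurable_id) h₁ h₂ (lintegral_lik B β) h₁1
    h₂1 (lik_ne_zero B β) (lik_ne_top B β) h₂0

/-- Comparison of two Kullback–Leibler risks. -/
lemma klRisk_add_one_le (β : Fin p → ℝ) {q₁ q₂ : (Fin m → ℝ) → (Fin n → ℝ) → ℝ≥0∞}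
    (h₁ : IsPredDensity q₁) (h₂ : IsPredDensity q₂) (h₂0 : ∀ x y, q₂ x y ≠ 0) :
    klRisk A B β q₂ + 1 ≤ klRisk A B β q₁ +
      ∫⁻ e : (Fin m → ℝ) × (Fin n → ℝ), lik A β e.1 * lik B β e.2 * (q₁ e.1 e.2 / q₂ e.1 e.2) := by
  have m2 : Measurable fun e : (Fin m → ℝ) × (Fin n → ℝ) => q₁ e.1 e.2 / q₂ e.1 e.2 :=
    h₁.measurable.div h₂.measurable
  have m3 : Measurable fun e : (Fin m → ℝ) × (Fin n → ℝ) =>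
      lik B β e.2 * (q₁ e.1 e.2 / q₂ e.1 e.2) :=
    (measurable_lik_comp B measurable_const measurable_snd).mul m2
  have mA : Measurable (lik A β) := measurable_lik_comp A measurable_const measurable_id
  have mJ : Measurable fun x => lik A β x * ∫⁻ y, lik B β y * (q₁ x y / q₂ x y) :=
    mA.mul m3.lintegral_prod_right'
  have e1 : ∫⁻ e : (Fin m → ℝ) × (Fin n → ℝ), lik A β e.1 * lik B β e.2 *
      (q₁ e.1 e.2 / q₂ e.1 e.2) = ∫⁻ x, lik A β x * ∫⁻ y, lik B β y * (q₁ x y / q₂ x y) := by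
    simp_rw [mul_assoc]
    have m4 : Measurable fun e : (Fin m → ℝ) × (Fin n → ℝ) =>
        lik A β e.1 * (lik B β e.2 * (q₁ e.1 e.2 / q₂ e.1 e.2)) := (mA.comp measurable_fst).mul m3
    rw [Measure.volume_eq_prod, lintegral_prod _ m4.aemeasurable]
    refine lintegral_congr fun x => ?_
    have m5 : Measurable fun y => lik B β y * (q₁ x y / q₂ x y) := m3.comp measurable_prodMk_left
    rw [← lintegral_const_mul _ m5]
  calc klRisk A B β q₂ + 1 = klRisk A B β q₂ + ∫⁻ x, lik A β x := by rw [lintegral_lik]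
    _ = ∫⁻ x, (lik A β x * klLoss B β (q₂ x) + lik A β x) := (lintegral_add_right _ mA).symm
    _ ≤ ∫⁻ x, (lik A β x * klLoss B β (q₁ x) +
          lik A β x * ∫⁻ y, lik B β y * (q₁ x y / q₂ x y)) := by
        refine lintegral_mono fun x => ?_
        have := klLoss_add_one_le (B := B) β (h₁.measurable.comp measurable_prodMk_left)
          (h₂.measurable.comp measurable_prodMk_left) (h₁.lintegral_eq_one x)
          (h₂.lintegral_eq_one x) (h₂0 x)
        calc _ = lik A β x * (klLoss B β (q₂ x) + 1) := by rw [mul_add, mul_one]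
          _ ≤ lik A β x * (klLoss B β (q₁ x) + ∫⁻ y, lik B β y * (q₁ x y / q₂ x y)) := by
              exact mul_le_mul_right this _
          _ = _ := mul_add _ _ _
    _ = _ := by rw [lintegral_add_right _ mJ, e1]; rfl

end KLRisk

/-! ### Bayes predictive densities and domination of the uniform prior -/

/-- The Bayes predictive density of a prior with values in `[0, ∞]`. -/
def priorPred {m n p : ℕ} (A : Matrix (Fin m) (Fin p) ℝ) (B : Matrix (Fin n) (Fin p) ℝ)
    (π : (Fin p → ℝ) → ℝ≥0∞) (x : Fin m → ℝ) (y : Fin n → ℝ) : ℝ≥0∞ :=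
  (∫⁻ b, lik B b y * (lik A b x * π b)) / ∫⁻ b, lik A b x * π b

lemma bayesPred_eq_priorPred {m n p : ℕ} (A : Matrix (Fin m) (Fin p) ℝ)
    (B : Matrix (Fin n) (Fin p) ℝ) (π : (Fin p → ℝ) → ℝ) :
    bayesPred A B π = priorPred A B (fun b => ENNReal.ofReal (π b)) := by
  funext x y
  simp only [bayesPred, priorPred, lik, ENNReal.ofReal_mul (modelDensity_pos B _ y).le,
    ENNReal.ofReal_mul (modelDensity_pos A _ x).le]

/-- Priors for which the posterior given `x` is always proper. -/
structure ProperPosterior {p : ℕ} (V : Matrix (Fin p) (Fin p) ℝ) (π : (Fin p → ℝ) → ℝ≥0∞) :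
    Prop where
  measurable : Measurable π
  not_ae_zero : ¬ ∀ᵐ b, π b = 0
  smooth_ne_top : ∀ z, smooth V (fun _ => 1) π z ≠ ⊤

section priorPred
variable {m n p : ℕ} {A : Matrix (Fin m) (Fin p) ℝ} {B : Matrix (Fin n) (Fin p) ℝ}
  {V : Matrix (Fin p) (Fin p) ℝ} {d : Fin p → ℝ} {π : (Fin p → ℝ) → ℝ≥0∞}

lemma LocationModel.lintegral_mul_prior {p : ℕ} {E : Type*} [AddGroup E] [MeasurableSpace E]
    {μ : Measure E} {P : (Fin p → ℝ) → E → ℝ≥0∞} {ι : (Fin p → ℝ) → E} {ζ : E → Fin p → ℝ}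
    {κ : (Fin p → ℝ) → ℝ≥0∞} {Φ : E → ℝ≥0∞} (M : LocationModel μ P ι ζ κ Φ)
    {π : (Fin p → ℝ) → ℝ≥0∞} (hπ : Measurable π) (e : E) :
    ∫⁻ b, P b e * π b = Φ e * ∫⁻ b, κ (ζ e - b) * π b := by
  simp_rw [M.eq_mul, mul_assoc]
  rw [lintegral_const_mul]
  exact (M.measurable_kernel.comp (measurable_const.sub measurable_id)).mul hπ

/-- The factor of the likelihood of `x` that does not depend on the parameter. -/
def factorA (A : Matrix (Fin m) (Fin p) ℝ) (V : Matrix (Fin p) (Fin p) ℝ) (x : Fin m → ℝ) :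
    ℝ≥0∞ :=
  ENNReal.ofReal (modelDensity A 0 x / gk V (fun _ => 1) (statA A V x))

/-- The factor of the likelihood of `(x, y)` that does not depend on the parameter. -/
def factorC (A : Matrix (Fin m) (Fin p) ℝ) (B : Matrix (Fin n) (Fin p) ℝ)
    (V : Matrix (Fin p) (Fin p) ℝ) (d : Fin p → ℝ) (e : (Fin m → ℝ) × (Fin n → ℝ)) : ℝ≥0∞ :=
  ENNReal.ofReal (modelDensity A 0 e.1 * modelDensity B 0 e.2 / gk V d (statC A B V d e))

lemma factorA_ne_zero (x : Fin m → ℝ) : factorA A V x ≠ 0 :=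
  (ENNReal.ofReal_pos.2 (div_pos (modelDensity_pos A 0 x) (gk_pos (fun _ => one_pos) _))).ne'

lemma factorC_ne_zero (hd : ∀ i, 0 < d i) (e : (Fin m → ℝ) × (Fin n → ℝ)) :
    factorC A B V d e ≠ 0 :=
  (ENNReal.ofReal_pos.2 (div_pos (mul_pos (modelDensity_pos A 0 _) (modelDensity_pos B 0 _))
    (gk_pos hd _))).ne'

lemma Whitening.lintegral_lik_mul (h : Whitening A B V d) (hπ : Measurable π) (x : Fin m → ℝ) :
    ∫⁻ b, lik A b x * π b = factorA A V x * smooth V (fun _ => 1) π (statA A V x) :=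
  h.locationModelA.lintegral_mul_prior hπ x

lemma Whitening.lintegral_lik_mul_lik_mul (h : Whitening A B V d) (hπ : Measurable π)
    (x : Fin m → ℝ) (y : Fin n → ℝ) :
    ∫⁻ b, lik B b y * (lik A b x * π b) =
      factorC A B V d (x, y) * smooth V d π (statC A B V d (x, y)) := by
  have := h.locationModelC.lintegral_mul_prior hπ (x, y)
  rw [factorC, smooth, ← this]
  refine lintegral_congr fun b => ?_
  rw [ENNReal.ofReal_mul (modelDensity_pos A b x).le, lik, lik]
  ring

/-- The factors of the two likelihoods that are free of the parameter come out of the integrals; the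
prior enters only through its smoothings at the sufficient statistics. -/
lemma Whitening.priorPred_eq (h : Whitening A B V d) (hπ : Measurable π)
    (x : Fin m → ℝ) (y : Fin n → ℝ) :
    priorPred A B π x y = factorC A B V d (x, y) / factorA A V x *
      (smooth V d π (statC A B V d (x, y)) / smooth V (fun _ => 1) π (statA A V x)) := by
  rw [priorPred, h.lintegral_lik_mul hπ, h.lintegral_lik_mul_lik_mul hπ,
    ENNReal.mul_div_mul_comm (Or.inl (factorA_ne_zero x)) (Or.inl ENNReal.ofReal_ne_top)]

lemma Whitening.priorPred_ne_zero (h : Whitening A B V d) (hπ : ProperPosterior V π)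
    (x : Fin m → ℝ) (y : Fin n → ℝ) : priorPred A B π x y ≠ 0 := by
  rw [h.priorPred_eq hπ.measurable]
  refine mul_ne_zero (ENNReal.div_ne_zero.2 ⟨factorC_ne_zero h.pos _, ENNReal.ofReal_ne_top⟩)
    (ENNReal.div_ne_zero.2 ⟨smooth_ne_zero h.pos hπ.measurable hπ.not_ae_zero _,
      hπ.smooth_ne_top _⟩)

lemma measurable_lintegral_lik_mul (hπ : Measurable π) :
    Measurable fun x => ∫⁻ b, lik A b x * π b := by
  apply Measurable.lintegral_prod_right'
    (f := fun q : (Fin m → ℝ) × (Fin p → ℝ) => lik A q.2 q.1 * π q.2)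
  exact (measurable_lik_comp A measurable_snd measurable_fst).mul (hπ.comp measurable_snd)

lemma Whitening.isPredDensity_priorPred (h : Whitening A B V d) (hπ : ProperPosterior V π) :
    IsPredDensity (priorPred A B π) where
  measurable := by
    have m1 : Measurable fun e : (Fin m → ℝ) × (Fin n → ℝ) =>
        ∫⁻ b, lik B b e.2 * (lik A b e.1 * π b) := by
      apply Measurable.lintegral_prod_right'
        (f := fun q : ((Fin m → ℝ) × (Fin n → ℝ)) × (Fin p → ℝ) =>
          lik B q.2 q.1.2 * (lik A q.2 q.1.1 * π q.2))
      exact (measurable_lik_comp B measurable_snd (measurable_snd.comp measurable_fst)).mul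
        ((measurable_lik_comp A measurable_snd (measurable_fst.comp measurable_fst)).mul
          (hπ.measurable.comp measurable_snd))
    exact m1.div ((measurable_lintegral_lik_mul hπ.measurable).comp measurable_fst)
  lintegral_eq_one x := by
    have hπm := hπ.measurable
    have mA : Measurable fun b => lik A b x * π b :=
      (measurable_lik_comp A measurable_id measurable_const).mul hπm
    have mm : Measurable (Function.uncurry fun (y : Fin n → ℝ) (b : Fin p → ℝ) =>
        lik B b y * (lik A b x * π b)) :=
      (measurable_lik_comp B measurable_snd measurable_fst).mul (mA.comp measurable_snd)
    have mN : Measurable fun y => ∫⁻ b, lik B b y * (lik A b x * π b) := mm.lintegral_prod_right'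
    simp_rw [priorPred, div_eq_mul_inv]
    rw [lintegral_mul_const _ mN, lintegral_lintegral_swap mm.aemeasurable]
    have e1 : ∀ b, ∫⁻ y, lik B b y * (lik A b x * π b) = lik A b x * π b := by
      intro b
      have mB : Measurable (lik B b) := measurable_lik_comp B measurable_const measurable_id
      rw [lintegral_mul_const _ mB, lintegral_lik, one_mul]
    simp_rw [e1]
    rw [h.lintegral_lik_mul hπm]
    exact ENNReal.mul_inv_cancel
      (mul_ne_zero (factorA_ne_zero x)
        (smooth_ne_zero (fun _ => one_pos) hπm hπ.not_ae_zero _))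
      (ENNReal.mul_ne_top ENNReal.ofReal_ne_top (hπ.smooth_ne_top _))

/-- The Bayes predictive density of the uniform prior. -/
def flatPred (A : Matrix (Fin m) (Fin p) ℝ) (B : Matrix (Fin n) (Fin p) ℝ) :
    (Fin m → ℝ) → (Fin n → ℝ) → ℝ≥0∞ :=
  priorPred A B fun _ => 1

lemma properPosterior_one (hV : V.det ≠ 0) : ProperPosterior V (fun _ => 1) where
  measurable := measurable_const
  not_ae_zero := by
    simp only [one_ne_zero, Filter.eventually_false_iff_eq_bot, ae_eq_bot]
    exact NeZero.ne _
  smooth_ne_top z := by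
    rw [smooth_one hV fun _ => one_pos]; exact ENNReal.ofReal_ne_top

lemma ofReal_abs_det_inv_ne_zero (hV : V.det ≠ 0) : ENNReal.ofReal |V.det⁻¹| ≠ 0 :=
  (ENNReal.ofReal_pos.2 (abs_pos.2 (inv_ne_zero hV))).ne'

/-- Smoothing the constant 1 gives the mass of the kernel, which is the same for the variances d and
1, so the quotient of smoothings is 1. -/
lemma Whitening.flatPred_eq (h : Whitening A B V d) (x : Fin m → ℝ) (y : Fin n → ℝ) :
    flatPred A B x y = factorC A B V d (x, y) / factorA A V x := by
  rw [flatPred, h.priorPred_eq measurable_const, smooth_one h.det_ne_zero h.pos,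
    smooth_one h.det_ne_zero fun _ => one_pos,
    ENNReal.div_self (ofReal_abs_det_inv_ne_zero h.det_ne_zero) ENNReal.ofReal_ne_top, mul_one]

lemma Whitening.flatPred_ne_zero (h : Whitening A B V d) (x : Fin m → ℝ) (y : Fin n → ℝ) :
    flatPred A B x y ≠ 0 := h.priorPred_ne_zero (properPosterior_one h.det_ne_zero) x y

lemma Whitening.flatPred_ne_top (h : Whitening A B V d) (x : Fin m → ℝ) (y : Fin n → ℝ) :
    flatPred A B x y ≠ ⊤ := by
  rw [h.flatPred_eq]
  exact ENNReal.div_ne_top ENNReal.ofReal_ne_top (factorA_ne_zero x)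

lemma Whitening.isPredDensity_flatPred (h : Whitening A B V d) : IsPredDensity (flatPred A B) :=
  h.isPredDensity_priorPred (properPosterior_one h.det_ne_zero)

lemma Whitening.priorPred_eq_flatPred_mul (h : Whitening A B V d) (hπ : Measurable π)
    (x : Fin m → ℝ) (y : Fin n → ℝ) :
    priorPred A B π x y = flatPred A B x y *
      (smooth V d π (statC A B V d (x, y)) / smooth V (fun _ => 1) π (statA A V x)) := by
  rw [h.priorPred_eq hπ, h.flatPred_eq]

lemma Whitening.lik_mul_lik (β : Fin p → ℝ) (e : (Fin m → ℝ) × (Fin n → ℝ)) :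
    lik A β e.1 * lik B β e.2 = ENNReal.ofReal (modelDensity A β e.1 * modelDensity B β e.2) :=
  (ENNReal.ofReal_mul (modelDensity_pos A β _).le).symm

instance volume_prod_isAddRightInvariant :
    (volume : Measure ((Fin m → ℝ) × (Fin n → ℝ))).IsAddRightInvariant := by
  rw [Measure.volume_eq_prod]; infer_instance

/-- The law of the least squares estimator from `x`. -/
lemma Whitening.lintegral_statA (h : Whitening A B V d) (β : Fin p → ℝ)
    {f : (Fin p → ℝ) → ℝ≥0∞} (hf : Measurable f) :
    (∫⁻ e : (Fin m → ℝ) × (Fin n → ℝ), lik A β e.1 * lik B β e.2 * f (statA A V e.1)) *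
      ENNReal.ofReal |V.det⁻¹| =
      ∫⁻ z, ENNReal.ofReal (gk V (fun _ => 1) (z - β)) * f z := by
  have mA : Measurable fun x => lik A β x * f (statA A V x) :=
    (measurable_lik_comp A measurable_const measurable_id).mul (hf.comp continuous_statA.measurable)
  have mB : Measurable (lik B β) := measurable_lik_comp B measurable_const measurable_id
  have e1 : ∀ e : (Fin m → ℝ) × (Fin n → ℝ), lik A β e.1 * lik B β e.2 * f (statA A V e.1) =
      lik A β e.1 * f (statA A V e.1) * lik B β e.2 := fun e => by ring
  simp_rw [e1]
  rw [Measure.volume_eq_prod, lintegral_prod_mul mA.aemeasurable mB.aemeasurable, lintegral_lik,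
    mul_one, ← lintegral_gk h.det_ne_zero (a := fun _ => 1) fun _ => one_pos]
  exact h.locationModelA.lintegral_stat_mul β hf

/-- The law of the least squares estimator from `(x, y)`. -/
lemma Whitening.lintegral_statC (h : Whitening A B V d) (β : Fin p → ℝ)
    {f : (Fin p → ℝ) → ℝ≥0∞} (hf : Measurable f) :
    (∫⁻ e : (Fin m → ℝ) × (Fin n → ℝ), lik A β e.1 * lik B β e.2 * f (statC A B V d e)) *
      ENNReal.ofReal |V.det⁻¹| =
      ∫⁻ z, ENNReal.ofReal (gk V d (z - β)) * f z := by
  simp_rw [Whitening.lik_mul_lik]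
  rw [← lintegral_gk h.det_ne_zero h.pos]
  exact h.locationModelC.lintegral_stat_mul β hf

/-- If smoothing more decreases the prior, then its Bayes predictive density dominates the one of
the uniform prior. -/
lemma Whitening.klRisk_priorPred_le (h : Whitening A B V d) (hπ : ProperPosterior V π)
    (hsuper : ∀ z, smooth V (fun _ => 1) π z ≤ smooth V d π z) (β : Fin p → ℝ) :
    klRisk A B β (priorPred A B π) ≤ klRisk A B β (flatPred A B) := by
  have hπm := hπ.measurable
  have hV := h.det_ne_zero
  have s0 : ∀ z, smooth V d π z ≠ 0 := smooth_ne_zero h.pos hπm hπ.not_ae_zero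
  have st : ∀ z, smooth V d π z ≠ ⊤ := fun z =>
    PredReg.smooth_ne_top h.pos h.le_one (hπ.smooth_ne_top z)
  have s0' : ∀ z, smooth V (fun _ => 1) π z ≠ 0 :=
    smooth_ne_zero (fun _ => one_pos) hπm hπ.not_ae_zero
  have key := klRisk_add_one_le (A := A) (B := B) β h.isPredDensity_flatPred
    (h.isPredDensity_priorPred hπ) (h.priorPred_ne_zero hπ)
  -- First use of the smoothing inequality: the numerator becomes the smoothing with variances d at
  -- `statA`, the form to which `lintegral_smoothing` applies.
  have hratio : ∀ x y, flatPred A B x y / priorPred A B π x y ≤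
      smooth V d π (statA A V x) * (smooth V d π (statC A B V d (x, y)))⁻¹ := by
    intro x y
    rw [h.priorPred_eq_flatPred_mul hπm, ← one_mul (flatPred A B x y / _),
      ← mul_div_assoc, one_mul, ENNReal.div_eq_inv_mul,
      ENNReal.mul_inv (Or.inl (h.flatPred_ne_zero x y)) (Or.inl (h.flatPred_ne_top x y)),
      mul_comm, ← mul_assoc, ENNReal.mul_inv_cancel (h.flatPred_ne_zero x y)
      (h.flatPred_ne_top x y), one_mul, ENNReal.inv_div (Or.inr (st _)) (Or.inr (s0 _)),
      div_eq_mul_inv]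
    gcongr
    exact hsuper _
  have hN0 := ofReal_abs_det_inv_ne_zero hV
  -- Here κ has variances d and κ' has variances 1. The law of `statA` is required with the mass of
  -- κ as normalization, which is available because both kernels have the same mass.
  have hsm := h.locationModelC.lintegral_smoothing (ζ' := fun e => statA A V e.1)
    (fun z => by rw [gk_neg]) (continuous_statA.measurable.comp measurable_fst)
    (fun e η => h.statA_add e.1 η) (κ' := fun u => ENNReal.ofReal (gk V (fun _ => 1) u))
    (fun z => by simp only [gk_neg])
    (fun f hf => by
      have := h.lintegral_statA 0 hf
      simp_rw [Whitening.lik_mul_lik, sub_zero] at this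
      rw [lintegral_gk hV h.pos]
      exact this) β hπm (measurable_smooth (V := V) (a := d) hπm).inv
  have hle : ∫⁻ e : (Fin m → ℝ) × (Fin n → ℝ), lik A β e.1 * lik B β e.2 *
      (flatPred A B e.1 e.2 / priorPred A B π e.1 e.2) ≤ 1 := by
    have step : ∀ e : (Fin m → ℝ) × (Fin n → ℝ), lik A β e.1 * lik B β e.2 *
        (flatPred A B e.1 e.2 / priorPred A B π e.1 e.2) ≤
        ENNReal.ofReal (modelDensity A β e.1 * modelDensity B β e.2) *
          (smooth V d π (statA A V e.1) * (smooth V d π (statC A B V d e))⁻¹) := by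
      intro e
      rw [Whitening.lik_mul_lik]
      exact mul_le_mul_right (hratio e.1 e.2) _
    refine (lintegral_mono step).trans ?_
    rw [lintegral_gk hV h.pos] at hsm
    rw [← ENNReal.mul_le_mul_iff_left hN0 ENNReal.ofReal_ne_top, one_mul]
    refine hsm.le.trans ?_
    have e2 : ∫⁻ z, ENNReal.ofReal (gk V d (z - β)) = ENNReal.ofReal |V.det⁻¹| := by
      rw [lintegral_sub_right_eq_self (fun z => ENNReal.ofReal (gk V d z)), lintegral_gk hV h.pos]
    refine le_trans (lintegral_mono fun z => ?_) e2.le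
    -- Second use of the smoothing inequality, now at a common point z.
    have e3 : smooth V (fun _ => 1) π z * (smooth V d π z)⁻¹ ≤ 1 := by
      rw [← div_eq_mul_inv]
      exact ENNReal.div_le_of_le_mul (by rw [one_mul]; exact hsuper z)
    exact (mul_le_mul_right e3 _).trans (mul_one _).le
  exact (ENNReal.add_le_add_iff_right ENNReal.one_ne_top).1
    (key.trans (add_le_add_right hle _))

end priorPred

/-! ### Constant risk of the uniform prior -/

lemma klLoss_eq_lintegral {n p : ℕ} {B : Matrix (Fin n) (Fin p) ℝ} (β : Fin p → ℝ)
    {q : (Fin n → ℝ) → ℝ≥0∞} (hq : Measurable q) (h1 : ∫⁻ y, q y = 1) (h0 : ∀ y, q y ≠ 0) :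
    klLoss B β q = ∫⁻ y, q y * ENNReal.ofReal (InformationTheory.klFun (lik B β y / q y).toReal) := by
  have fin : ∀ q : (Fin n → ℝ) → ℝ≥0∞, ∫⁻ x, q x = 1 → IsFiniteMeasure (volume.withDensity q) := by
    intro q h
    refine ⟨?_⟩
    rw [withDensity_apply _ MeasurableSet.univ, setLIntegral_univ, h]
    exact ENNReal.one_lt_top
  have mB : Measurable (lik B β) := measurable_lik_comp B measurable_const measurable_id
  have := fin q h1
  have : IsFiniteMeasure (volume.withDensity fun y => ENNReal.ofReal (modelDensity B β y)) :=
    fin (lik B β) (lintegral_lik B β)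
  exact klDiv_withDensity mB hq (Eventually.of_forall h0)

section
variable {m n p : ℕ} {A : Matrix (Fin m) (Fin p) ℝ} {B : Matrix (Fin n) (Fin p) ℝ}
  {V : Matrix (Fin p) (Fin p) ℝ} {d : Fin p → ℝ} {π : (Fin p → ℝ) → ℝ≥0∞}

lemma lik_add_mulVec {k : ℕ} (M : Matrix (Fin k) (Fin p) ℝ) (β : Fin p → ℝ) (z : Fin k → ℝ) :
    lik M β (z + M *ᵥ β) = lik M 0 z := by
  have := modelDensity_add M 0 β z
  rw [zero_add] at this
  rw [lik, lik, this]

lemma Whitening.flatPred_add (h : Whitening A B V d) (x : Fin m → ℝ) (y : Fin n → ℝ)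
    (η : Fin p → ℝ) : flatPred A B (x + A *ᵥ η) (y + B *ᵥ η) = flatPred A B x y := by
  rw [h.flatPred_eq, h.flatPred_eq]
  have h1 : factorA A V (x + A *ᵥ η) = factorA A V x := h.locationModelA.factor_add x η
  have h2 : factorC A B V d (x + A *ᵥ η, y + B *ᵥ η) = factorC A B V d (x, y) :=
    h.locationModelC.factor_add (x, y) η
  rw [h1, h2]

/-- The Bayes predictive density of the uniform prior has constant risk. -/
lemma Whitening.klRisk_flatPred (h : Whitening A B V d) (β : Fin p → ℝ) :
    klRisk A B β (flatPred A B) = klRisk A B 0 (flatPred A B) := by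
  have hq := h.isPredDensity_flatPred
  have e : ∀ β x, klLoss B β (flatPred A B x) = ∫⁻ y, flatPred A B x y *
      ENNReal.ofReal (InformationTheory.klFun (lik B β y / flatPred A B x y).toReal) := fun β x =>
    klLoss_eq_lintegral β (hq.measurable.comp measurable_prodMk_left) (hq.lintegral_eq_one x)
      (h.flatPred_ne_zero x)
  have e2 : ∀ x, klLoss B β (flatPred A B (x + A *ᵥ β)) = klLoss B 0 (flatPred A B x) := by
    intro x
    rw [e, e, ← lintegral_add_right_eq_self _ (B *ᵥ β)]
    refine lintegral_congr fun y => ?_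
    rw [h.flatPred_add, lik_add_mulVec]
  change ∫⁻ x, lik A β x * klLoss B β (flatPred A B x) =
    ∫⁻ x, lik A 0 x * klLoss B 0 (flatPred A B x)
  rw [← lintegral_add_right_eq_self _ (A *ᵥ β)]
  refine lintegral_congr fun x => ?_
  rw [e2, lik_add_mulVec]

/-! ### Exponential priors -/

/-- The exponential of a multiple of the `ℓ¹` norm of the coordinates `V u`. -/
def expNorm (V : Matrix (Fin p) (Fin p) ℝ) (t : ℝ) (u : Fin p → ℝ) : ℝ≥0∞ :=
  ENNReal.ofReal (Real.exp (t * ∑ i, |(V *ᵥ u) i|))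

lemma continuous_sum_abs_mulVec : Continuous fun u : Fin p → ℝ => ∑ i, |(V *ᵥ u) i| :=
  continuous_finsetSum _ fun i _ => (continuous_mulVec_apply V i).abs

lemma measurable_expNorm (t : ℝ) : Measurable (expNorm V t) :=
  (Real.continuous_exp.comp
    (continuous_const.mul continuous_sum_abs_mulVec)).measurable.ennreal_ofReal

lemma expNorm_ne_zero (t : ℝ) (u : Fin p → ℝ) : expNorm V t u ≠ 0 :=
  (ENNReal.ofReal_pos.2 (Real.exp_pos _)).ne'

lemma expNorm_ne_top (t : ℝ) (u : Fin p → ℝ) : expNorm V t u ≠ ⊤ := ENNReal.ofReal_ne_top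

/-- The reason for the ℓ¹ norm in the coordinates V u: the prior factorizes like the kernel, so all
its integrals reduce to one-dimensional ones. -/
lemma expNorm_eq_prod (t : ℝ) (u : Fin p → ℝ) :
    expNorm V t u = ∏ i, ENNReal.ofReal (Real.exp (t * |(V *ᵥ u) i|)) := by
  rw [expNorm, Finset.mul_sum, Real.exp_sum,
    ENNReal.ofReal_prod_of_nonneg fun i _ => (Real.exp_pos _).le]

lemma sum_abs_mulVec_add_le (u w : Fin p → ℝ) :
    ∑ i, |(V *ᵥ (u + w)) i| ≤ ∑ i, |(V *ᵥ u) i| + ∑ i, |(V *ᵥ w) i| := by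
  rw [← Finset.sum_add_distrib]
  refine Finset.sum_le_sum fun i _ => ?_
  rw [Matrix.mulVec_add]
  exact abs_add_le _ _

lemma sum_abs_mulVec_sub_comm (u w : Fin p → ℝ) :
    ∑ i, |(V *ᵥ (u - w)) i| = ∑ i, |(V *ᵥ (w - u)) i| := by
  refine Finset.sum_congr rfl fun i _ => ?_
  rw [Matrix.mulVec_sub, Matrix.mulVec_sub, Pi.sub_apply, Pi.sub_apply, abs_sub_comm]

/-- Bound e^{|s|} by e^s + e^{-s}; by completing the square, each term times the density is a
constant multiple of a shifted density. -/
lemma lintegral_normal1_mul_exp_abs_ne_top {a : ℝ} (ha : 0 < a) :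
    ∫⁻ s, ENNReal.ofReal (normal1 a s) * ENNReal.ofReal (Real.exp |s|) ≠ ⊤ := by
  have e : ∀ c : ℝ, c ^ 2 = 1 → ∀ s, normal1 a s * Real.exp (c * s) =
      Real.exp (a / 2) * normal1 a (s - c * a) := by
    intro c hc s
    unfold normal1
    rw [mul_assoc, ← Real.exp_add, mul_left_comm, ← Real.exp_add]
    congr 2
    field_simp
    linear_combination (a ^ 2) * hc
  have bound : ∀ s, ENNReal.ofReal (normal1 a s) * ENNReal.ofReal (Real.exp |s|) ≤
      ENNReal.ofReal (Real.exp (a / 2)) * ENNReal.ofReal (normal1 a (s - 1 * a)) +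
      ENNReal.ofReal (Real.exp (a / 2)) * ENNReal.ofReal (normal1 a (s - (-1) * a)) := by
    intro s
    rw [← ENNReal.ofReal_mul (normal1_pos ha s).le, ← ENNReal.ofReal_mul (Real.exp_pos _).le,
      ← ENNReal.ofReal_mul (Real.exp_pos _).le, ← e 1 (by norm_num), ← e (-1) (by norm_num),
      ← ENNReal.ofReal_add (mul_pos (normal1_pos ha s) (Real.exp_pos _)).le
        (mul_pos (normal1_pos ha s) (Real.exp_pos _)).le, ← mul_add]
    refine ENNReal.ofReal_le_ofReal (mul_le_mul_of_nonneg_left ?_ (normal1_pos ha s).le)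
    rcases abs_cases s with ⟨h, _⟩ | ⟨h, _⟩
    · rw [h, one_mul]; linarith [Real.exp_pos (-1 * s)]
    · rw [h, neg_one_mul]; linarith [Real.exp_pos (1 * s)]
  have m : ∀ c : ℝ, Measurable fun s => ENNReal.ofReal (normal1 a (s - c)) := fun c =>
    ((continuous_normal1 a).comp (continuous_id.sub continuous_const)).measurable.ennreal_ofReal
  refine ne_top_of_le_ne_top ?_ (lintegral_mono bound)
  rw [lintegral_add_left ((m _).const_mul _), lintegral_const_mul _ (m _),
    lintegral_const_mul _ (m _), lintegral_sub_right_eq_self fun s => ENNReal.ofReal (normal1 a s),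
    lintegral_sub_right_eq_self fun s => ENNReal.ofReal (normal1 a s), lintegral_normal1 ha]
  simp

/-- The exponential moments of the `ℓ¹` norm of a vector of independent normal variables. -/
def expMoment (a : Fin p → ℝ) (t : ℝ) : ℝ≥0∞ :=
  ∏ i, ∫⁻ s, ENNReal.ofReal (normal1 (a i) s) * ENNReal.ofReal (Real.exp (t * |s|))

lemma lintegral_gk_mul_expNorm {a : Fin p → ℝ} (hV : V.det ≠ 0) (ha : ∀ i, 0 < a i) (t : ℝ) :
    ∫⁻ u, ENNReal.ofReal (gk V a u) * expNorm V t u =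
      ENNReal.ofReal |V.det⁻¹| * expMoment a t := by
  simp_rw [expNorm_eq_prod]
  exact lintegral_gk_mul hV ha (fun _ s => ENNReal.ofReal (Real.exp (t * |s|)))
    fun _ => (by fun_prop : Continuous fun s : ℝ => Real.exp (t * |s|)).measurable.ennreal_ofReal

/-- Dominated convergence in each coordinate. The majorant with e^{|s|} serves all t < 1, hence both
signs of t near 0; negative t is needed for the lower bound of a smoothed prior. -/
lemma tendsto_expMoment {a : Fin p → ℝ} (ha : ∀ i, 0 < a i) :
    Tendsto (expMoment a) (𝓝 0) (𝓝 1) := by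
  have one : ∀ i, Tendsto (fun t => ∫⁻ s, ENNReal.ofReal (normal1 (a i) s) *
      ENNReal.ofReal (Real.exp (t * |s|))) (𝓝 0) (𝓝 1) := by
    intro i
    have e : (1 : ℝ≥0∞) = ∫⁻ s, ENNReal.ofReal (normal1 (a i) s) *
        ENNReal.ofReal (Real.exp (0 * |s|)) := by
      simp [lintegral_normal1 (ha i)]
    rw [e]
    refine tendsto_lintegral_filter_of_dominated_convergence _ ?_ ?_
      (lintegral_normal1_mul_exp_abs_ne_top (ha i)) ?_
    · refine Eventually.of_forall fun t => ?_
      exact (continuous_normal1 _).measurable.ennreal_ofReal.mul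
        (by fun_prop : Continuous fun s : ℝ => Real.exp (t * |s|)).measurable.ennreal_ofReal
    · filter_upwards [Iio_mem_nhds (zero_lt_one' ℝ)] with t ht
      refine Eventually.of_forall fun s => ?_
      gcongr
      have : t < 1 := ht
      nlinarith [abs_nonneg s]
    · refine Eventually.of_forall fun s => ?_
      apply ENNReal.Tendsto.const_mul _ (Or.inr ENNReal.ofReal_ne_top)
      have : Continuous fun t : ℝ => ENNReal.ofReal (Real.exp (t * |s|)) :=
        ENNReal.continuous_ofReal.comp (by fun_prop)
      exact this.tendsto 0
  have all : ∀ S : Finset (Fin p), Tendsto (fun t => ∏ i ∈ S, ∫⁻ s,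
      ENNReal.ofReal (normal1 (a i) s) * ENNReal.ofReal (Real.exp (t * |s|))) (𝓝 0) (𝓝 1) := by
    intro S
    induction S using Finset.induction_on with
    | empty => simp
    | insert i S hi ih =>
      simp_rw [Finset.prod_insert hi]
      have := ENNReal.Tendsto.mul (one i) (Or.inl one_ne_zero) ih (Or.inl one_ne_zero)
      rwa [one_mul] at this
  exact all Finset.univ

/-- The smoothed exponential of the norm, compared with its value at the centre. -/
lemma smooth_expNorm_le {a : Fin p → ℝ} (hV : V.det ≠ 0) (ha : ∀ i, 0 < a i) {t : ℝ} (ht : 0 ≤ t)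
    (z : Fin p → ℝ) : smooth V a (expNorm V (-t)) z ≤
      ENNReal.ofReal |V.det⁻¹| * expMoment a t * expNorm V (-t) z := by
  have hm : Measurable fun u => ENNReal.ofReal (gk V a u) * expNorm V t u :=
    continuous_gk.measurable.ennreal_ofReal.mul (measurable_expNorm t)
  rw [← lintegral_gk_mul_expNorm hV ha, ← lintegral_mul_const _ hm,
    ← lintegral_sub_left_eq_self _ z]
  refine lintegral_mono fun b => ?_
  rw [mul_assoc]
  refine mul_le_mul_right ?_ _
  rw [expNorm, expNorm, expNorm, ← ENNReal.ofReal_mul (Real.exp_pos _).le, ← Real.exp_add]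
  apply ENNReal.ofReal_le_ofReal
  apply Real.exp_le_exp.2
  have := sum_abs_mulVec_add_le (V := V) (z - b) b
  rw [sub_add_cancel] at this
  nlinarith

/-- The triangle inequality in the opposite direction to `smooth_expNorm_le`. Together they show
that smoothing changes the prior by a factor between two multiples of the kernel mass, and both
multipliers tend to 1 as t → 0. -/
lemma le_smooth_expNorm {a : Fin p → ℝ} (hV : V.det ≠ 0) (ha : ∀ i, 0 < a i) {t : ℝ} (ht : 0 ≤ t)
    (z : Fin p → ℝ) : ENNReal.ofReal |V.det⁻¹| * expMoment a (-t) * expNorm V (-t) z ≤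
      smooth V a (expNorm V (-t)) z := by
  have hm : Measurable fun u => ENNReal.ofReal (gk V a u) * expNorm V (-t) u :=
    continuous_gk.measurable.ennreal_ofReal.mul (measurable_expNorm _)
  rw [← lintegral_gk_mul_expNorm hV ha, ← lintegral_mul_const _ hm,
    ← lintegral_sub_left_eq_self _ z]
  refine lintegral_mono fun b => ?_
  rw [mul_assoc]
  refine mul_le_mul_right ?_ _
  rw [expNorm, expNorm, expNorm, ← ENNReal.ofReal_mul (Real.exp_pos _).le, ← Real.exp_add]
  apply ENNReal.ofReal_le_ofReal
  apply Real.exp_le_exp.2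
  have := sum_abs_mulVec_add_le (V := V) (b - z) z
  rw [sub_add_cancel, sum_abs_mulVec_sub_comm] at this
  nlinarith

lemma lintegral_exp_neg_mul_abs_ne_top {t : ℝ} (ht : 0 < t) :
    ∫⁻ s : ℝ, ENNReal.ofReal (Real.exp (-t * |s|)) ≠ ⊤ := by
  have h : Integrable fun s : ℝ => Real.exp (-t * |s|) := by
    refine (integrable_inv_one_add_sq.const_mul (1 + 2 / t ^ 2)).mono'
      (by fun_prop : Continuous fun s : ℝ => Real.exp (-t * |s|)).aestronglyMeasurable
      (Eventually.of_forall fun s => ?_)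
    rw [Real.norm_eq_abs, abs_of_pos (Real.exp_pos _), neg_mul, Real.exp_neg, ← div_eq_mul_inv,
      inv_eq_one_div, div_le_div_iff₀ (Real.exp_pos _) (by positivity), one_mul]
    have h1 := Real.quadratic_le_exp_of_nonneg (mul_nonneg ht.le (abs_nonneg s))
    -- With e^u ≥ 1 + u + u² / 2 at u = t|s|, the constant 1 + 2 / t² is what is needed to bound
    -- e^{-t|s|} by a multiple of 1 / (1 + s²).
    have h2 : 1 + s ^ 2 ≤ (1 + 2 / t ^ 2) * (1 + t * |s| + (t * |s|) ^ 2 / 2) := by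
      have e : (2 / t ^ 2) * ((t * |s|) ^ 2 / 2) = s ^ 2 := by
        rw [mul_pow, sq_abs]; field_simp
      have : 0 ≤ t * |s| := mul_nonneg ht.le (abs_nonneg s)
      have : 0 ≤ 2 / t ^ 2 := by positivity
      nlinarith [mul_nonneg ‹0 ≤ 2 / t ^ 2› ‹0 ≤ t * |s|›, sq_nonneg (t * |s|)]
    exact h2.trans (mul_le_mul_of_nonneg_left h1 (by positivity))
  exact h.lintegral_lt_top.ne

lemma lintegral_expNorm_ne_top (hV : V.det ≠ 0) {t : ℝ} (ht : 0 < t) :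
    ∫⁻ u, expNorm V (-t) u ≠ ⊤ := by
  have hm : Measurable fun s : ℝ => ENNReal.ofReal (Real.exp (-t * |s|)) :=
    (by fun_prop : Continuous fun s : ℝ => Real.exp (-t * |s|)).measurable.ennreal_ofReal
  simp_rw [expNorm_eq_prod]
  rw [lintegral_comp_mulVec hV (f := fun v => ∏ i, ENNReal.ofReal (Real.exp (-t * |v i|)))
    (Finset.measurable_prod _ fun i _ => hm.comp (measurable_pi_apply i)),
    lintegral_prod_coord _ fun _ => hm]
  exact ENNReal.mul_ne_top ENNReal.ofReal_ne_top
    (ENNReal.prod_ne_top fun i _ => lintegral_exp_neg_mul_abs_ne_top ht)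

lemma properPosterior_expNorm (hV : V.det ≠ 0) {t : ℝ} (ht : 0 ≤ t) :
    ProperPosterior V (expNorm V (-t)) where
  measurable := measurable_expNorm _
  not_ae_zero := by
    simp only [expNorm_ne_zero, Filter.eventually_false_iff_eq_bot, ae_eq_bot]
    exact NeZero.ne _
  smooth_ne_top z := by
    refine ne_top_of_le_ne_top ((properPosterior_one hV).smooth_ne_top z) ?_
    refine lintegral_mono fun b => mul_le_mul_right ?_ _
    rw [expNorm, ← ENNReal.ofReal_one]
    apply ENNReal.ofReal_le_ofReal
    rw [Real.exp_le_one_iff]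
    have : 0 ≤ ∑ i, |(V *ᵥ b) i| := Finset.sum_nonneg fun i _ => abs_nonneg _
    nlinarith

end

/-! ### The minimax lower bound -/

section
variable {m n p : ℕ} {A : Matrix (Fin m) (Fin p) ℝ} {B : Matrix (Fin n) (Fin p) ℝ}
  {V : Matrix (Fin p) (Fin p) ℝ} {d : Fin p → ℝ}

/-- Comparison of two integrated Kullback–Leibler risks. -/
lemma lintegral_klRisk_add_le {ρ : (Fin p → ℝ) → ℝ≥0∞} (hρ : Measurable ρ)
    {q₁ q₂ : (Fin m → ℝ) → (Fin n → ℝ) → ℝ≥0∞}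
    (h₁ : IsPredDensity q₁) (h₂ : IsPredDensity q₂) (h₂0 : ∀ x y, q₂ x y ≠ 0) :
    (∫⁻ β, ρ β * klRisk A B β q₂) + ∫⁻ β, ρ β ≤ (∫⁻ β, ρ β * klRisk A B β q₁) +
      ∫⁻ β, ρ β * ∫⁻ e : (Fin m → ℝ) × (Fin n → ℝ),
        lik A β e.1 * lik B β e.2 * (q₁ e.1 e.2 / q₂ e.1 e.2) := by
  have m2 : Measurable fun e : (Fin m → ℝ) × (Fin n → ℝ) => q₁ e.1 e.2 / q₂ e.1 e.2 :=
    h₁.measurable.div h₂.measurable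
  have mJ : Measurable fun β => ρ β * ∫⁻ e : (Fin m → ℝ) × (Fin n → ℝ),
      lik A β e.1 * lik B β e.2 * (q₁ e.1 e.2 / q₂ e.1 e.2) := by
    refine hρ.mul ?_
    apply Measurable.lintegral_prod_right'
      (f := fun z : (Fin p → ℝ) × ((Fin m → ℝ) × (Fin n → ℝ)) =>
        lik A z.1 z.2.1 * lik B z.1 z.2.2 * (q₁ z.2.1 z.2.2 / q₂ z.2.1 z.2.2))
    exact ((measurable_lik_comp A measurable_fst (measurable_fst.comp measurable_snd)).mul
      (measurable_lik_comp B measurable_fst (measurable_snd.comp measurable_snd))).mul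
      (m2.comp measurable_snd)
  rw [← lintegral_add_right _ hρ, ← lintegral_add_right _ mJ]
  refine lintegral_mono fun β => ?_
  calc _ = ρ β * (klRisk A B β q₂ + 1) := by rw [mul_add, mul_one]
    _ ≤ ρ β * (klRisk A B β q₁ + ∫⁻ e : (Fin m → ℝ) × (Fin n → ℝ),
        lik A β e.1 * lik B β e.2 * (q₁ e.1 e.2 / q₂ e.1 e.2)) :=
        mul_le_mul_right (klRisk_add_one_le β h₁ h₂ h₂0) _
    _ = _ := mul_add _ _ _

/-- A proper prior's Bayes predictive density minimizes the integrated risk. -/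
lemma Whitening.lintegral_klRisk_priorPred_le (h : Whitening A B V d)
    {ρ : (Fin p → ℝ) → ℝ≥0∞} (hρ : ProperPosterior V ρ) (hfin : ∫⁻ β, ρ β ≠ ⊤)
    {q : (Fin m → ℝ) → (Fin n → ℝ) → ℝ≥0∞} (hq : IsPredDensity q) :
    ∫⁻ β, ρ β * klRisk A B β (priorPred A B ρ) ≤ ∫⁻ β, ρ β * klRisk A B β q := by
  have hρm := hρ.measurable
  have hpp := h.isPredDensity_priorPred hρ
  have key := lintegral_klRisk_add_le (A := A) (B := B) hρm hq hpp (h.priorPred_ne_zero hρ)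
  have m2 : Measurable fun e : (Fin m → ℝ) × (Fin n → ℝ) =>
      q e.1 e.2 / priorPred A B ρ e.1 e.2 := hq.measurable.div hpp.measurable
  have mD : Measurable fun x => ∫⁻ b, lik A b x * ρ b := measurable_lintegral_lik_mul hρm
  have mA : ∀ β, Measurable (lik A β) := fun β =>
    measurable_lik_comp A measurable_const measurable_id
  have mll : Measurable (Function.uncurry fun (β : Fin p → ℝ) (e : (Fin m → ℝ) × (Fin n → ℝ)) =>
      ρ β * (lik A β e.1 * lik B β e.2 * (q e.1 e.2 / priorPred A B ρ e.1 e.2))) :=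
    (hρm.comp measurable_fst).mul
      (((measurable_lik_comp A measurable_fst (measurable_fst.comp measurable_snd)).mul
      (measurable_lik_comp B measurable_fst (measurable_snd.comp measurable_snd))).mul
      (m2.comp measurable_snd))
  -- Write the Bayes density as N / D, with N the joint marginal of (x, y) and D that of x.
  -- Averaging q D / N over β produces the factor N, which cancels; then q integrates to 1 in y and
  -- D integrates to the mass of ρ. Hence the correction terms of the comparison cancel exactly.
  have e1 : ∫⁻ β, ρ β * ∫⁻ e : (Fin m → ℝ) × (Fin n → ℝ),
      lik A β e.1 * lik B β e.2 * (q e.1 e.2 / priorPred A B ρ e.1 e.2) = ∫⁻ β, ρ β := by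
    calc _ = ∫⁻ β, ∫⁻ e : (Fin m → ℝ) × (Fin n → ℝ),
          ρ β * (lik A β e.1 * lik B β e.2 * (q e.1 e.2 / priorPred A B ρ e.1 e.2)) := by
          refine lintegral_congr fun β => ?_
          have m3 : Measurable fun e : (Fin m → ℝ) × (Fin n → ℝ) =>
              lik A β e.1 * lik B β e.2 * (q e.1 e.2 / priorPred A B ρ e.1 e.2) :=
            ((measurable_lik_comp A measurable_const measurable_fst).mul
              (measurable_lik_comp B measurable_const measurable_snd)).mul m2
          rw [lintegral_const_mul _ m3]
      _ = ∫⁻ e : (Fin m → ℝ) × (Fin n → ℝ), ∫⁻ β,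
          ρ β * (lik A β e.1 * lik B β e.2 * (q e.1 e.2 / priorPred A B ρ e.1 e.2)) :=
          lintegral_lintegral_swap mll.aemeasurable
      _ = ∫⁻ e : (Fin m → ℝ) × (Fin n → ℝ), (∫⁻ b, lik A b e.1 * ρ b) * q e.1 e.2 := by
          refine lintegral_congr fun e => ?_
          have m3 : Measurable fun β => lik B β e.2 * (lik A β e.1 * ρ β) :=
            (measurable_lik_comp B measurable_id measurable_const).mul
              ((measurable_lik_comp A measurable_id measurable_const).mul hρm)
          have e2 : ∀ β, ρ β * (lik A β e.1 * lik B β e.2 *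
              (q e.1 e.2 / priorPred A B ρ e.1 e.2)) =
              lik B β e.2 * (lik A β e.1 * ρ β) * (q e.1 e.2 / priorPred A B ρ e.1 e.2) :=
            fun β => by ring
          simp_rw [e2]
          rw [lintegral_mul_const _ m3]
          have hN0 : ∫⁻ b, lik B b e.2 * (lik A b e.1 * ρ b) ≠ 0 := by
            rw [h.lintegral_lik_mul_lik_mul hρm]
            exact mul_ne_zero (factorC_ne_zero h.pos _)
              (smooth_ne_zero h.pos hρm hρ.not_ae_zero _)
          have hNt : ∫⁻ b, lik B b e.2 * (lik A b e.1 * ρ b) ≠ ⊤ := by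
            rw [h.lintegral_lik_mul_lik_mul hρm]
            exact ENNReal.mul_ne_top ENNReal.ofReal_ne_top
              (PredReg.smooth_ne_top h.pos h.le_one (hρ.smooth_ne_top _))
          rw [priorPred, div_eq_mul_inv (q e.1 e.2), ENNReal.inv_div (Or.inr hNt) (Or.inr hN0)]
          rw [mul_comm (q e.1 e.2), ← mul_assoc, ENNReal.mul_div_cancel hN0 hNt]
      _ = ∫⁻ x, (∫⁻ b, lik A b x * ρ b) * ∫⁻ y, q x y := by
          have m3 : Measurable fun e : (Fin m → ℝ) × (Fin n → ℝ) =>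
              (∫⁻ b, lik A b e.1 * ρ b) * q e.1 e.2 := (mD.comp measurable_fst).mul hq.measurable
          rw [Measure.volume_eq_prod, lintegral_prod _ m3.aemeasurable]
          refine lintegral_congr fun x => ?_
          have m4 : Measurable fun y => q x y := hq.measurable.comp measurable_prodMk_left
          rw [← lintegral_const_mul _ m4]
      _ = ∫⁻ x, ∫⁻ b, lik A b x * ρ b := by simp_rw [hq.lintegral_eq_one, mul_one]
      _ = ∫⁻ b, ∫⁻ x, lik A b x * ρ b := by
          have m3 : Measurable (Function.uncurry fun (x : Fin m → ℝ) (b : Fin p → ℝ) =>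
              lik A b x * ρ b) :=
            (measurable_lik_comp A measurable_snd measurable_fst).mul (hρm.comp measurable_snd)
          exact lintegral_lintegral_swap m3.aemeasurable
      _ = ∫⁻ b, ρ b := by
          refine lintegral_congr fun b => ?_
          rw [lintegral_mul_const _ (mA b), lintegral_lik, one_mul]
  rw [e1] at key
  exact (ENNReal.add_le_add_iff_right hfin).1 key

/-- The exponents are bounded by the triangle inequality through β, and the product of exponentials
is split by the arithmetic-geometric mean inequality. The two estimators are dependent, but after
this split only their marginal laws enter; the differences from β make the integrated bound
independent of β. -/
lemma expNorm_div_expNorm_le (t : ℝ) (ht : 0 ≤ t) (u w β : Fin p → ℝ) :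
    expNorm V (-t) u / expNorm V (-t) w ≤
      2⁻¹ * (expNorm V (2 * t) (w - β) + expNorm V (2 * t) (u - β)) := by
  have h2 : (2 : ℝ≥0∞)⁻¹ = ENNReal.ofReal 2⁻¹ := by
    rw [ENNReal.ofReal_inv_of_pos two_pos]; simp
  rw [h2, expNorm, expNorm, expNorm, expNorm, ← ENNReal.ofReal_div_of_pos (Real.exp_pos _),
    ← Real.exp_sub, ← ENNReal.ofReal_add (Real.exp_pos _).le (Real.exp_pos _).le,
    ← ENNReal.ofReal_mul (by norm_num)]
  apply ENNReal.ofReal_le_ofReal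
  have h3 : ∑ i, |(V *ᵥ w) i| - ∑ i, |(V *ᵥ u) i| ≤
      ∑ i, |(V *ᵥ (w - β)) i| + ∑ i, |(V *ᵥ (u - β)) i| := by
    have a1 := sum_abs_mulVec_add_le (V := V) (w - u) u
    have a2 := sum_abs_mulVec_add_le (V := V) (w - β) (β - u)
    rw [sub_add_cancel] at a1
    rw [sub_add_sub_cancel, sum_abs_mulVec_sub_comm β u] at a2
    linarith
  set a := ∑ i, |(V *ᵥ (w - β)) i|
  set b := ∑ i, |(V *ᵥ (u - β)) i|
  calc _ ≤ Real.exp (t * a + t * b) := by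
        apply Real.exp_le_exp.2
        nlinarith
    _ ≤ _ := by
        have e1 : Real.exp (2 * t * a) = Real.exp (t * a) ^ 2 := by
          rw [← Real.exp_nat_mul]; congr 1; push_cast; ring
        have e2 : Real.exp (2 * t * b) = Real.exp (t * b) ^ 2 := by
          rw [← Real.exp_nat_mul]; congr 1; push_cast; ring
        rw [e1, e2, Real.exp_add]
        nlinarith [sq_nonneg (Real.exp (t * a) - Real.exp (t * b))]

/-- For the prior `exp (-t ‖V β‖₁)`, the expected ratio of its Bayes predictive density and the one
of the uniform prior is at most a quantity that tends to `1` with `t → 0`. -/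
lemma Whitening.lintegral_lik_mul_ratio_le (h : Whitening A B V d) {t : ℝ} (ht : 0 ≤ t)
    (β : Fin p → ℝ) :
    ∫⁻ e : (Fin m → ℝ) × (Fin n → ℝ), lik A β e.1 * lik B β e.2 *
      (priorPred A B (expNorm V (-t)) e.1 e.2 / flatPred A B e.1 e.2) ≤
      expMoment d t / expMoment (fun _ : Fin p => 1) (-t) *
        (2⁻¹ * (expMoment (fun _ : Fin p => 1) (2 * t) + expMoment d (2 * t))) := by
  have hV := h.det_ne_zero
  have hN0 := ofReal_abs_det_inv_ne_zero hV
  have one : ∀ i : Fin p, (0 : ℝ) < (fun _ => 1 : Fin p → ℝ) i := fun _ => one_pos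
  have step : ∀ e : (Fin m → ℝ) × (Fin n → ℝ),
      priorPred A B (expNorm V (-t)) e.1 e.2 / flatPred A B e.1 e.2 ≤
      expMoment d t / expMoment (fun _ : Fin p => 1) (-t) *
        (2⁻¹ * (expNorm V (2 * t) (statA A V e.1 - β) +
          expNorm V (2 * t) (statC A B V d e - β))) := by
    intro e
    rw [h.priorPred_eq_flatPred_mul (measurable_expNorm _), mul_comm,
      ENNReal.mul_div_cancel_right (h.flatPred_ne_zero _ _) (h.flatPred_ne_top _ _)]
    refine (ENNReal.div_le_div (smooth_expNorm_le hV h.pos ht _)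
      (le_smooth_expNorm hV one ht _)).trans ?_
    rw [ENNReal.mul_div_mul_comm (Or.inr (expNorm_ne_top _ _)) (Or.inr (expNorm_ne_zero _ _)),
      ENNReal.mul_div_mul_left _ _ hN0 ENNReal.ofReal_ne_top]
    exact mul_le_mul_right (expNorm_div_expNorm_le t ht _ _ β) _
  have mE : Measurable fun z => expNorm V (2 * t) (z - β) :=
    (measurable_expNorm _).comp (measurable_id.sub measurable_const)
  have shift : ∀ a : Fin p → ℝ, (∀ i, 0 < a i) →
      ∫⁻ z, ENNReal.ofReal (gk V a (z - β)) * expNorm V (2 * t) (z - β) =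
      ENNReal.ofReal |V.det⁻¹| * expMoment a (2 * t) := by
    intro a ha
    rw [lintegral_sub_right_eq_self (fun z => ENNReal.ofReal (gk V a z) * expNorm V (2 * t) z),
      lintegral_gk_mul_expNorm hV ha]
  have eA : ∫⁻ e : (Fin m → ℝ) × (Fin n → ℝ), lik A β e.1 * lik B β e.2 *
      expNorm V (2 * t) (statA A V e.1 - β) = expMoment (fun _ : Fin p => 1) (2 * t) := by
    have e1 := h.lintegral_statA β mE
    rw [shift _ one, mul_comm] at e1
    exact (ENNReal.mul_right_inj hN0 ENNReal.ofReal_ne_top).1 e1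
  have eC : ∫⁻ e : (Fin m → ℝ) × (Fin n → ℝ), lik A β e.1 * lik B β e.2 *
      expNorm V (2 * t) (statC A B V d e - β) = expMoment d (2 * t) := by
    have e1 := h.lintegral_statC β mE
    rw [shift _ h.pos, mul_comm] at e1
    exact (ENNReal.mul_right_inj hN0 ENNReal.ofReal_ne_top).1 e1
  have mll : Measurable fun e : (Fin m → ℝ) × (Fin n → ℝ) => lik A β e.1 * lik B β e.2 :=
    (measurable_lik_comp A measurable_const measurable_fst).mul
      (measurable_lik_comp B measurable_const measurable_snd)
  have mA : Measurable fun e : (Fin m → ℝ) × (Fin n → ℝ) => lik A β e.1 * lik B β e.2 *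
      expNorm V (2 * t) (statA A V e.1 - β) :=
    mll.mul (mE.comp (continuous_statA.measurable.comp measurable_fst))
  have mC : Measurable fun e : (Fin m → ℝ) × (Fin n → ℝ) => lik A β e.1 * lik B β e.2 *
      expNorm V (2 * t) (statC A B V d e - β) :=
    mll.mul (mE.comp continuous_statC.measurable)
  set c := expMoment d t / expMoment (fun _ : Fin p => 1) (-t)
  calc _ ≤ ∫⁻ e : (Fin m → ℝ) × (Fin n → ℝ), c * (2⁻¹ * (lik A β e.1 * lik B β e.2 *
        expNorm V (2 * t) (statA A V e.1 - β) + lik A β e.1 * lik B β e.2 *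
        expNorm V (2 * t) (statC A B V d e - β))) := by
        refine lintegral_mono fun e => (mul_le_mul_right (step e) _).trans (le_of_eq ?_)
        ring
    _ = _ := by
        have mAC : Measurable fun e : (Fin m → ℝ) × (Fin n → ℝ) => lik A β e.1 * lik B β e.2 *
            expNorm V (2 * t) (statA A V e.1 - β) + lik A β e.1 * lik B β e.2 *
            expNorm V (2 * t) (statC A B V d e - β) := mA.add mC
        rw [lintegral_const_mul _ (mAC.const_mul _), lintegral_const_mul _ mAC,
          lintegral_add_left mA, eA, eC]

/-- The constant risk of the uniform prior's Bayes predictive density is a lower bound for the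
maximal risk of every predictive density estimator. -/
lemma Whitening.klRisk_flatPred_le_iSup (h : Whitening A B V d)
    {q : (Fin m → ℝ) → (Fin n → ℝ) → ℝ≥0∞} (hq : IsPredDensity q) :
    klRisk A B 0 (flatPred A B) ≤ ⨆ β, klRisk A B β q := by
  have hV := h.det_ne_zero
  have one : ∀ i : Fin p, (0 : ℝ) < (fun _ => 1 : Fin p → ℝ) i := fun _ => one_pos
  set R := klRisk A B 0 (flatPred A B)
  set S := ⨆ β, klRisk A B β q
  let θ : ℝ → ℝ≥0∞ := fun t => expMoment d t / expMoment (fun _ : Fin p => 1) (-t) *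
        (2⁻¹ * (expMoment (fun _ : Fin p => 1) (2 * t) + expMoment d (2 * t)))
  -- Integrate the comparison of the uniform prior with the exponential prior against the latter.
  -- Its Bayes density has integrated risk at most that of q, hence at most the mass times S;
  -- dividing by the finite nonzero mass leaves numbers.
  have bound : ∀ t : ℝ, 0 < t → R + 1 ≤ S + θ t := by
    intro t ht
    have hρ := properPosterior_expNorm hV ht.le
    have hfin := lintegral_expNorm_ne_top hV ht
    have h0 : ∫⁻ u, expNorm V (-t) u ≠ 0 := by
      intro h0
      rw [lintegral_eq_zero_iff (measurable_expNorm _)] at h0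
      exact hρ.not_ae_zero h0
    have k1 := h.lintegral_klRisk_priorPred_le hρ hfin hq
    have k2 := lintegral_klRisk_add_le (A := A) (B := B) hρ.measurable
      (h.isPredDensity_priorPred hρ) h.isPredDensity_flatPred h.flatPred_ne_zero
    simp_rw [h.klRisk_flatPred] at k2
    rw [lintegral_mul_const _ hρ.measurable] at k2
    have k3 : ∫⁻ β, expNorm V (-t) β * klRisk A B β q ≤ (∫⁻ β, expNorm V (-t) β) * S := by
      rw [← lintegral_mul_const _ hρ.measurable]
      exact lintegral_mono fun β => mul_le_mul_right (le_iSup (fun β => klRisk A B β q) β) _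
    have k4 : ∫⁻ β, expNorm V (-t) β * (∫⁻ e : (Fin m → ℝ) × (Fin n → ℝ),
        lik A β e.1 * lik B β e.2 *
          (priorPred A B (expNorm V (-t)) e.1 e.2 / flatPred A B e.1 e.2)) ≤
        (∫⁻ β, expNorm V (-t) β) * θ t := by
      rw [← lintegral_mul_const _ hρ.measurable]
      exact lintegral_mono fun β =>
        mul_le_mul_right (h.lintegral_lik_mul_ratio_le ht.le β) _
    have k5 : (∫⁻ β, expNorm V (-t) β) * (R + 1) ≤ (∫⁻ β, expNorm V (-t) β) * (S + θ t) := by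
      rw [mul_add, mul_one, mul_add]
      exact k2.trans (add_le_add (k1.trans k3) k4)
    exact (ENNReal.mul_le_mul_iff_right h0 hfin).1 k5
  have l2 : Tendsto (fun t : ℝ => 2 * t) (𝓝 0) (𝓝 0) := by
    have : Continuous fun t : ℝ => 2 * t := by fun_prop
    simpa using this.tendsto 0
  have lneg : Tendsto (fun t : ℝ => -t) (𝓝 0) (𝓝 0) := by
    have : Continuous fun t : ℝ => -t := by fun_prop
    simpa using this.tendsto 0
  have lim : Tendsto θ (𝓝 0) (𝓝 1) := by
    have a1 := ENNReal.Tendsto.div (tendsto_expMoment h.pos) (Or.inl one_ne_zero)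
      ((tendsto_expMoment one).comp lneg) (Or.inl ENNReal.one_ne_top)
    have a2 := (((tendsto_expMoment one).comp l2).add ((tendsto_expMoment h.pos).comp l2))
    have a3 := ENNReal.Tendsto.const_mul (a := 2⁻¹) a2 (Or.inr (by simp))
    have a4 := ENNReal.Tendsto.mul a1 (Or.inl (by simp)) a3 (Or.inr (by simp))
    have e : (1 / 1 : ℝ≥0∞) * (2⁻¹ * (1 + 1)) = 1 := by
      rw [div_one, one_mul, one_add_one_eq_two, ENNReal.inv_mul_cancel two_ne_zero
        ENNReal.ofNat_ne_top]
    rw [e] at a4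
    exact a4
  have lim2 : Tendsto (fun t => S + θ t) (𝓝[>] 0) (𝓝 (S + 1)) :=
    (tendsto_const_nhds.add lim).mono_left nhdsWithin_le_nhds
  have := ge_of_tendsto lim2 (eventually_mem_nhdsWithin.mono fun t ht => bound t ht)
  exact (ENNReal.add_le_add_iff_right ENNReal.one_ne_top).1 this

/-- The three ingredients meet here: domination of the uniform prior at every β, constancy of its
risk, and the lower bound by that constant for every competitor. -/
lemma Whitening.isMinimax_priorPred (h : Whitening A B V d) {π : (Fin p → ℝ) → ℝ≥0∞}
    (hπ : ProperPosterior V π)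
    (hsuper : ∀ z, smooth V (fun _ => 1) π z ≤ smooth V d π z) :
    IsMinimax A B (priorPred A B π) := by
  refine ⟨h.isPredDensity_priorPred hπ, fun q hq => iSup_le fun β => ?_⟩
  exact (h.klRisk_priorPred_le hπ hsuper β).trans
    ((h.klRisk_flatPred β).le.trans (h.klRisk_flatPred_le_iSup hq))

end

end PredReg

end

noncomputable section

namespace PredReg

open Filter Topology

/-! ### Simultaneous diagonalization of Σ_A and Σ_C -/

section
variable {m n p : ℕ} {A : Matrix (Fin m) (Fin p) ℝ} {B : Matrix (Fin n) (Fin p) ℝ}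
  {W : Matrix (Fin p) (Fin p) ℝ} {d : Fin p → ℝ}

lemma posDef_gram (hA : A.rank = p) : (Aᵀ * A).PosDef := by
  have hinj : Function.Injective A.mulVec := by
    rw [Matrix.mulVec_injective_iff, linearIndependent_iff_card_eq_finrank_span]
    rw [Matrix.rank_eq_finrank_span_cols] at hA
    simpa [Set.finrank] using hA.symm
  have := Matrix.PosDef.conjTranspose_mul_self A hinj
  rwa [Matrix.conjTranspose_eq_transpose_of_trivial] at this

lemma posSemidef_gram (B : Matrix (Fin n) (Fin p) ℝ) : (Bᵀ * B).PosSemidef := by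
  have := Matrix.posSemidef_conjTranspose_mul_self B
  rwa [Matrix.conjTranspose_eq_transpose_of_trivial] at this

lemma posDef_info (hA : A.rank = p) : (Aᵀ * A + Bᵀ * B).PosDef :=
  (posDef_gram hA).add_posSemidef (posSemidef_gram B)

lemma inv_gram_eq (hW : IsUnit W) {S : Matrix (Fin p) (Fin p) ℝ} (hS : IsUnit S)
    {a : Fin p → ℝ} (ha : ∀ i, a i ≠ 0) (h : S⁻¹ = W * diagonal a * Wᵀ) :
    S = W⁻¹ᵀ * diagonal (fun i => (a i)⁻¹) * W⁻¹ := by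
  have hd : IsUnit W.det := (Matrix.isUnit_iff_isUnit_det _).1 hW
  have hSd : IsUnit S.det := (Matrix.isUnit_iff_isUnit_det _).1 hS
  have h1 : Wᵀ * W⁻¹ᵀ = 1 := by
    rw [← Matrix.transpose_mul, Matrix.nonsing_inv_mul _ hd, Matrix.transpose_one]
  have h2 : diagonal a * diagonal (fun i => (a i)⁻¹) = (1 : Matrix (Fin p) (Fin p) ℝ) := by
    rw [Matrix.diagonal_mul_diagonal, ← Matrix.diagonal_one]
    congr 1
    funext i
    exact mul_inv_cancel₀ (ha i)
  have h3 : (W * diagonal a * Wᵀ) * (W⁻¹ᵀ * diagonal (fun i => (a i)⁻¹) * W⁻¹) = 1 := by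
    calc _ = W * diagonal a * (Wᵀ * W⁻¹ᵀ) * diagonal (fun i => (a i)⁻¹) * W⁻¹ := by
          simp only [Matrix.mul_assoc]
      _ = W * (diagonal a * diagonal (fun i => (a i)⁻¹)) * W⁻¹ := by
          rw [h1, Matrix.mul_one, Matrix.mul_assoc W]
      _ = 1 := by rw [h2, Matrix.mul_one, Matrix.mul_nonsing_inv _ hd]
  rw [← h] at h3
  calc S = S * (S⁻¹ * (W⁻¹ᵀ * diagonal (fun i => (a i)⁻¹) * W⁻¹)) := by rw [h3, Matrix.mul_one]
    _ = _ := by rw [← Matrix.mul_assoc, Matrix.mul_nonsing_inv _ hSd, Matrix.one_mul]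

lemma Diagonalizes.whitening (h : Diagonalizes A B W d) (hA : A.rank = p) :
    Whitening A B W⁻¹ d := by
  have hd : IsUnit W.det := (Matrix.isUnit_iff_isUnit_det _).1 h.isUnit
  have hpos : ∀ i, 0 < d i := by
    have h1 : (W * diagonal d * star W).PosDef := by
      have e : star W = Wᵀ := Matrix.conjTranspose_eq_transpose_of_trivial W
      rw [e, ← h.covC_eq]
      exact (posDef_info hA).inv
    rw [Matrix.IsUnit.posDef_star_right_conjugate_iff h.isUnit] at h1
    exact Matrix.posDef_diagonal_iff.1 h1
  have hgram : Aᵀ * A = W⁻¹ᵀ * diagonal (fun _ => (1 : ℝ)⁻¹) * W⁻¹ := by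
    refine inv_gram_eq (a := fun _ => 1) h.isUnit (posDef_gram hA).isUnit (fun _ => one_ne_zero) ?_
    rw [Matrix.diagonal_one, Matrix.mul_one]
    exact h.covA_eq
  have hinfo : Aᵀ * A + Bᵀ * B = W⁻¹ᵀ * diagonal (fun i => (d i)⁻¹) * W⁻¹ :=
    inv_gram_eq h.isUnit (posDef_info hA).isUnit (fun i => (hpos i).ne') h.covC_eq
  refine ⟨?_, hgram, hinfo, hpos, fun i => ?_⟩
  · exact (Matrix.isUnit_nonsing_inv_det _ hd).ne_zero
  -- This matrix equals Bᵀ B. Its positive semidefiniteness passes to the diagonal factor and gives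
  -- (d i)⁻¹ ≥ 1.
  · have hB : (star W⁻¹ * diagonal (fun i => (d i)⁻¹ - 1) * W⁻¹).PosSemidef := by
      have e : star W⁻¹ = W⁻¹ᵀ := Matrix.conjTranspose_eq_transpose_of_trivial _
      have e2 : diagonal (fun i => (d i)⁻¹ - 1) =
          diagonal (fun i => (d i)⁻¹) - diagonal (fun _ => (1 : ℝ)⁻¹) := by
        rw [Matrix.diagonal_sub]; simp
      rw [e, e2, Matrix.mul_sub, Matrix.sub_mul, ← hinfo, ← hgram, add_sub_cancel_left]
      exact posSemidef_gram B
    have hu : IsUnit W⁻¹ := (Matrix.isUnit_iff_isUnit_det _).2 (Matrix.isUnit_nonsing_inv_det _ hd)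
    rw [Matrix.IsUnit.posSemidef_star_left_conjugate_iff hu, Matrix.posSemidef_diagonal_iff] at hB
    have := hB i
    exact (one_le_inv₀ (hpos i)).1 (by linarith)

lemma Diagonalizes.covA_sub_covC (h : Diagonalizes A B W d) :
    covA A - covC A B = W * diagonal (fun i => 1 - d i) * Wᵀ := by
  have e2 : diagonal (fun i => 1 - d i) = 1 - diagonal d := by
    rw [← Matrix.diagonal_one, Matrix.diagonal_sub]
  rw [h.covA_eq, h.covC_eq, e2, Matrix.mul_sub, Matrix.sub_mul, Matrix.mul_one]

lemma exists_orthogonal_diagonal {M : Matrix (Fin p) (Fin p) ℝ} (hM : M.IsHermitian) :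
    ∃ (U : Matrix (Fin p) (Fin p) ℝ) (a : Fin p → ℝ), IsUnit U ∧ U * Uᵀ = 1 ∧
      M = U * diagonal a * Uᵀ := by
  have hU : (hM.eigenvectorUnitary : Matrix (Fin p) (Fin p) ℝ) *
      (hM.eigenvectorUnitary : Matrix (Fin p) (Fin p) ℝ)ᵀ = 1 := by
    have := Unitary.coe_mul_star_self hM.eigenvectorUnitary
    rwa [Unitary.coe_star, Matrix.star_eq_conjTranspose,
      Matrix.conjTranspose_eq_transpose_of_trivial] at this
  refine ⟨hM.eigenvectorUnitary, hM.eigenvalues, IsUnit.of_mul_eq_one _ hU, hU, ?_⟩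
  have := hM.spectral_theorem
  rw [Unitary.conjStarAlgAut_apply, Matrix.star_eq_conjTranspose,
    Matrix.conjTranspose_eq_transpose_of_trivial] at this
  exact this

/-- Factor Σ_A = S Sᵀ through its spectral decomposition, and let U diagonalize the symmetric matrix
S⁻¹ Σ_C S⁻ᵀ. Orthogonality of U keeps the first identity intact for W = S U. -/
lemma exists_diagonalizes (A : Matrix (Fin m) (Fin p) ℝ) (B : Matrix (Fin n) (Fin p) ℝ)
    (hA : A.rank = p) : ∃ (W : Matrix (Fin p) (Fin p) ℝ) (d : Fin p → ℝ), Diagonalizes A B W d := by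
  have hK : (covA A).PosDef := (posDef_gram hA).inv
  have hL : (covC A B).PosDef := (posDef_info hA).inv
  obtain ⟨S, hSu, hS⟩ : ∃ S : Matrix (Fin p) (Fin p) ℝ, IsUnit S ∧ covA A = S * Sᵀ := by
    obtain ⟨U, a, hUu, hU, hUa⟩ := exists_orthogonal_diagonal hK.isHermitian
    have ha : ∀ i, 0 < a i := by
      have h1 : (U * diagonal a * star U).PosDef := by
        have e : star U = Uᵀ := Matrix.conjTranspose_eq_transpose_of_trivial U
        rw [e, ← hUa]
        exact hK
      rw [Matrix.IsUnit.posDef_star_right_conjugate_iff hUu] at h1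
      exact Matrix.posDef_diagonal_iff.1 h1
    refine ⟨U * diagonal fun i => Real.sqrt (a i), hUu.mul ?_, ?_⟩
    · rw [Matrix.isUnit_iff_isUnit_det, Matrix.det_diagonal]
      exact (Finset.prod_pos fun i _ => Real.sqrt_pos.2 (ha i)).ne'.isUnit
    · have e : diagonal a = (diagonal fun i => Real.sqrt (a i)) *
          diagonal fun i => Real.sqrt (a i) := by
        rw [Matrix.diagonal_mul_diagonal]
        congr 1
        funext i
        exact (Real.mul_self_sqrt (ha i).le).symm
      rw [hUa, e, Matrix.transpose_mul, Matrix.diagonal_transpose]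
      simp only [Matrix.mul_assoc]
  have hSd : IsUnit S.det := (Matrix.isUnit_iff_isUnit_det _).1 hSu
  have hM : (S⁻¹ * covC A B * S⁻¹ᵀ).IsHermitian := by
    have := Matrix.isHermitian_mul_mul_conjTranspose S⁻¹ hL.isHermitian
    rwa [Matrix.conjTranspose_eq_transpose_of_trivial] at this
  obtain ⟨U, a, hUu, hU, hsp⟩ := exists_orthogonal_diagonal hM
  have h1 : S⁻¹ᵀ * Sᵀ = 1 := by
    rw [← Matrix.transpose_mul, Matrix.mul_nonsing_inv _ hSd, Matrix.transpose_one]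
  refine ⟨S * U, a, ?_, ?_, ?_⟩
  · exact hSu.mul hUu
  · rw [Matrix.transpose_mul, Matrix.mul_assoc, ← Matrix.mul_assoc U, hU, Matrix.one_mul, hS]
  · calc covC A B = (S * S⁻¹) * covC A B * (S⁻¹ᵀ * Sᵀ) := by
          rw [h1, Matrix.mul_nonsing_inv _ hSd, Matrix.one_mul, Matrix.mul_one]
      _ = S * (S⁻¹ * covC A B * S⁻¹ᵀ) * Sᵀ := by simp only [Matrix.mul_assoc]
      _ = _ := by rw [hsp, Matrix.transpose_mul]; simp only [Matrix.mul_assoc]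

/-- The normal density with covariance matrix `(A'A)⁻¹` is proportional to the kernel in the
whitening coordinates. -/
lemma Whitening.exists_normalDensity_eq {V : Matrix (Fin p) (Fin p) ℝ} (h : Whitening A B V d)
    (hA : A.rank = p) :
    ∃ c : ℝ, 0 < c ∧ ∀ β z, normalDensity (covA A) β z = c * gk V (fun _ => 1) (z - β) := by
  have hdet : 0 < (covA A).det := (posDef_gram hA).inv.det_pos
  have hinv : (covA A)⁻¹ = Aᵀ * A :=
    Matrix.nonsing_inv_nonsing_inv _ ((Matrix.isUnit_iff_isUnit_det _).1 (posDef_gram hA).isUnit)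
  have hg : 0 < gk V (fun _ => 1) 0 := gk_pos (fun _ => one_pos) 0
  refine ⟨(2 * Real.pi) ^ (-(p : ℝ) / 2) * (covA A).det ^ (-(1 : ℝ) / 2) / gk V (fun _ => 1) 0,
    by positivity, fun β z => ?_⟩
  rw [normalDensity, gk_eq_exp (fun _ => one_pos) (z - β), ← mul_assoc, div_mul_cancel₀ _ hg.ne',
    hinv]
  congr 3
  have e := sum_sq_div_sub (V := V) (a := fun _ => 1) 0 (-(z - β))
  rw [← h.gram_eq] at e
  simp only [zero_sub, neg_neg, Matrix.mulVec_zero, zero_dotProduct, Matrix.mulVec_neg,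
    dotProduct_neg, neg_dotProduct] at e
  simp only [e]
  simp

end

/-! ### Hessians and directional derivatives -/

section Hessian
variable {p : ℕ}

lemma fderiv_fderiv_eq_dotProduct (φ : (Fin p → ℝ) → ℝ) (β u w : Fin p → ℝ) :
    fderiv ℝ (fderiv ℝ φ) β u w = u ⬝ᵥ (hessian φ β *ᵥ w) := by
  set L := fderiv ℝ (fderiv ℝ φ) β with hL
  have hH : ∀ a b, hessian φ β a b = L (Pi.single a 1) (Pi.single b 1) := by
    intro a b
    simp [hessian, iteratedFDeriv_two_apply, hL]
  have hu : ∀ u : Fin p → ℝ, u = ∑ a, u a • (Pi.single a 1 : Fin p → ℝ) := fun u => by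
    ext k
    simp [Finset.sum_apply, Pi.single_apply]
  conv_lhs => rw [hu u, hu w]
  simp only [map_sum, map_smul, _root_.sum_apply, _root_.smul_apply,
    smul_eq_mul, dotProduct, Matrix.mulVec, hH, Finset.mul_sum]
  rw [Finset.sum_comm]
  refine Finset.sum_congr rfl fun a _ => Finset.sum_congr rfl fun b _ => ?_
  ring

/-- This replaces the Hessian by second derivatives along the columns of W. Along these directions
the kernel factorizes and all later computations are one-dimensional. -/
lemma trace_hessian_mul (φ : (Fin p → ℝ) → ℝ) (β : Fin p → ℝ) (W : Matrix (Fin p) (Fin p) ℝ)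
    (q : Fin p → ℝ) : (hessian φ β * (W * diagonal q * Wᵀ)).trace =
      ∑ i, q i * fderiv ℝ (fderiv ℝ φ) β (W.col i) (W.col i) := by
  rw [← Matrix.mul_assoc, Matrix.trace_mul_comm, ← Matrix.mul_assoc, ← Matrix.mul_assoc]
  simp only [Matrix.trace, Matrix.diag_apply, Matrix.mul_diagonal]
  refine Finset.sum_congr rfl fun i _ => ?_
  rw [mul_comm, fderiv_fderiv_eq_dotProduct, Matrix.mul_assoc]
  rfl

/-- Second derivatives in a direction from line derivatives. -/
lemma fderiv_fderiv_of_hasLineDerivAt {φ φ₁ φ₂ : (Fin p → ℝ) → ℝ} {w : Fin p → ℝ}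
    (hφ : ContDiff ℝ ∞ φ) (h₁ : ∀ β, HasLineDerivAt ℝ φ (φ₁ β) β w)
    (h₂ : ∀ β, HasLineDerivAt ℝ φ₁ (φ₂ β) β w) (β : Fin p → ℝ) :
    fderiv ℝ (fderiv ℝ φ) β w w = φ₂ β := by
  have hd : Differentiable ℝ φ := hφ.differentiable (by simp)
  have hd' : Differentiable ℝ (fderiv ℝ φ) :=
    (hφ.fderiv_right (m := 1) (by norm_cast)).differentiable (by simp)
  have e : φ₁ = fun β => fderiv ℝ φ β w := funext fun β =>
    (h₁ β).unique ((hd β).hasFDerivAt.hasLineDerivAt w)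
  have h3 : HasFDerivAt φ₁ ((fderiv ℝ (fderiv ℝ φ) β).flip w) β := by
    rw [e]
    have := (hd' β).hasFDerivAt.clm_apply (hasFDerivAt_const w β)
    simpa using this
  exact ((h₂ β).unique (h3.hasLineDerivAt w)).symm

lemma hasLineDerivAt_fderiv {φ : (Fin p → ℝ) → ℝ} (hφ : ContDiff ℝ ∞ φ) (β w : Fin p → ℝ) :
    HasLineDerivAt ℝ φ (fderiv ℝ φ β w) β w :=
  ((hφ.differentiable (by simp)) β).hasFDerivAt.hasLineDerivAt w

lemma contDiff_fderiv_apply {φ : (Fin p → ℝ) → ℝ} (hφ : ContDiff ℝ ∞ φ) (w : Fin p → ℝ) :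
    ContDiff ℝ ∞ fun β => fderiv ℝ φ β w :=
  (hφ.fderiv_right (m := ∞) (by norm_cast)).clm_apply contDiff_const

lemma hasLineDerivAt_fderiv_fderiv {φ : (Fin p → ℝ) → ℝ} (hφ : ContDiff ℝ ∞ φ)
    (β w : Fin p → ℝ) :
    HasLineDerivAt ℝ (fun β => fderiv ℝ φ β w) (fderiv ℝ (fderiv ℝ φ) β w w) β w := by
  have := hasLineDerivAt_fderiv (contDiff_fderiv_apply hφ w) β w
  rwa [← fderiv_fderiv_of_hasLineDerivAt hφ (fun β => hasLineDerivAt_fderiv hφ β w)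
    (fun β => hasLineDerivAt_fderiv (contDiff_fderiv_apply hφ w) β w) β] at this

lemma hasLineDerivAt_mul {f g : (Fin p → ℝ) → ℝ} {f' g' : ℝ} {β w : Fin p → ℝ}
    (hf : HasLineDerivAt ℝ f f' β w) (hg : HasLineDerivAt ℝ g g' β w) :
    HasLineDerivAt ℝ (fun b => f b * g b) (f' * g β + f β * g') β w := by
  have := HasDerivAt.mul hf hg
  simpa [HasLineDerivAt, Pi.mul_def] using this

lemma hasLineDerivAt_add {f g : (Fin p → ℝ) → ℝ} {f' g' : ℝ} {β w : Fin p → ℝ}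
    (hf : HasLineDerivAt ℝ f f' β w) (hg : HasLineDerivAt ℝ g g' β w) :
    HasLineDerivAt ℝ (fun b => f b + g b) (f' + g') β w :=
  HasDerivAt.add hf hg

lemma hasLineDerivAt_const_mul {f : (Fin p → ℝ) → ℝ} {f' : ℝ} {β w : Fin p → ℝ} (c : ℝ)
    (hf : HasLineDerivAt ℝ f f' β w) :
    HasLineDerivAt ℝ (fun b => c * f b) (c * f') β w :=
  HasDerivAt.const_mul c hf

lemma hasLineDerivAt_comp_smul {f : (Fin p → ℝ) → ℝ} {f' : ℝ} {β w : Fin p → ℝ} (c : ℝ)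
    (hf : HasLineDerivAt ℝ f f' (c • β) w) :
    HasLineDerivAt ℝ (fun b => f (c • b)) (c * f') β w := by
  have h1 : HasDerivAt (fun t : ℝ => c * t) c 0 := by
    simpa using (hasDerivAt_id (0 : ℝ)).const_mul c
  have h2 : HasDerivAt (fun t : ℝ => f (c • β + t • w)) f' (c * 0) := by
    rw [mul_zero]; exact hf
  have := HasDerivAt.comp (0 : ℝ) h2 h1
  rw [mul_comm] at this
  unfold HasLineDerivAt
  convert! this using 1
  funext t
  simp [smul_add, smul_smul]

end Hessian

/-! ### The heat equation for the kernels -/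

section Normal1

lemma hasDerivAt_normal1 (a v : ℝ) : HasDerivAt (normal1 a) (-(v / a) * normal1 a v) v := by
  unfold normal1
  have h : HasDerivAt (fun v : ℝ => -(v ^ 2) / (2 * a)) (-(2 * v) / (2 * a)) v := by
    have := ((hasDerivAt_pow 2 v).neg).div_const (2 * a)
    simpa using this
  have := (h.exp).const_mul (√(2 * Real.pi * a))⁻¹
  convert! this using 1
  have e : -(2 * v) / (2 * a) = -(v / a) := by
    rw [neg_div, mul_div_mul_left _ _ two_ne_zero]
  rw [e]; ring

/-- The one-dimensional heat equation: the coefficient is half of the one produced by two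
derivatives in v. -/
lemma hasDerivAt_normal1_variance {a : ℝ} (ha : 0 < a) (v : ℝ) :
    HasDerivAt (fun a => normal1 a v) (2⁻¹ * (v ^ 2 / a ^ 2 - 1 / a) * normal1 a v) a := by
  unfold normal1
  have hs : HasDerivAt (fun a : ℝ => √(2 * Real.pi * a)) (2 * Real.pi / (2 * √(2 * Real.pi * a)))
      a := by
    have h1 : HasDerivAt (fun a : ℝ => 2 * Real.pi * a) (2 * Real.pi) a := by
      simpa using (hasDerivAt_id a).const_mul (2 * Real.pi)
    exact h1.sqrt (by positivity)
  have hs' := hs.inv (by positivity)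
  have he : HasDerivAt (fun a : ℝ => Real.exp (-(v ^ 2) / (2 * a)))
      (Real.exp (-(v ^ 2) / (2 * a)) * (v ^ 2 / (2 * a ^ 2))) a := by
    have h1 : HasDerivAt (fun a : ℝ => -(v ^ 2) / (2 * a)) (v ^ 2 / (2 * a ^ 2)) a := by
      have h2 : HasDerivAt (fun a : ℝ => 2 * a) 2 a := by
        simpa using (hasDerivAt_id a).const_mul (2 : ℝ)
      have := (hasDerivAt_const a (-(v ^ 2))).div h2 (by positivity)
      convert! this using 1
      field_simp
      ring
    exact h1.exp
  have := hs'.mul he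
  convert! this using 1
  have hsq : √(2 * Real.pi * a) ^ 2 = 2 * Real.pi * a := Real.sq_sqrt (by positivity)
  have hpos : 0 < √(2 * Real.pi * a) := by positivity
  simp only [Pi.inv_apply]
  generalize √(2 * Real.pi * a) = S at *
  have hpi : Real.pi = S ^ 2 / (2 * a) := by rw [hsq]; field_simp
  rw [hpi]
  field_simp
  ring

end Normal1

section Kernel
variable {p : ℕ} {V W : Matrix (Fin p) (Fin p) ℝ} {a : Fin p → ℝ}

lemma mulVec_col_eq_single (hVW : V * W = 1) (i : Fin p) : V *ᵥ W.col i = Pi.single i 1 := by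
  have : W.col i = W *ᵥ Pi.single i 1 := by simp
  rw [this, Matrix.mulVec_mulVec, hVW, Matrix.one_mulVec]

lemma mulVec_add_smul_col (hVW : V * W = 1) (i j : Fin p) (u : Fin p → ℝ) (t : ℝ) :
    (V *ᵥ (u + t • W.col i)) j = (V *ᵥ u) j + if j = i then t else 0 := by
  rw [Matrix.mulVec_add, Matrix.mulVec_smul, mulVec_col_eq_single hVW]
  simp [Pi.single_apply]

/-- Since V maps the i-th column of W to the i-th unit vector, a move along that column changes only
the i-th factor of the product. -/
lemma gk_add_smul_col (hVW : V * W = 1) (i : Fin p) (u : Fin p → ℝ) (t : ℝ) :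
    gk V a (u + t • W.col i) =
      normal1 (a i) ((V *ᵥ u) i + t) * ∏ j ∈ Finset.univ.erase i, normal1 (a j) ((V *ᵥ u) j) := by
  rw [gk, ← Finset.mul_prod_erase _ _ (Finset.mem_univ i)]
  congr 1
  · rw [mulVec_add_smul_col hVW, if_pos rfl]
  · refine Finset.prod_congr rfl fun j hj => ?_
    rw [mulVec_add_smul_col hVW, if_neg (Finset.ne_of_mem_erase hj), add_zero]

lemma gk_eq_mul_erase (i : Fin p) (u : Fin p → ℝ) :
    gk V a u =
      normal1 (a i) ((V *ᵥ u) i) * ∏ j ∈ Finset.univ.erase i, normal1 (a j) ((V *ᵥ u) j) := by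
  rw [gk, ← Finset.mul_prod_erase _ _ (Finset.mem_univ i)]

lemma hasLineDerivAt_gk (hVW : V * W = 1) (i : Fin p) (z b : Fin p → ℝ) :
    HasLineDerivAt ℝ (fun b => gk V a (b - z))
      (-((V *ᵥ (b - z)) i / a i) * gk V a (b - z)) b (W.col i) := by
  have e : (fun t : ℝ => gk V a (b + t • W.col i - z)) = fun t =>
      normal1 (a i) ((V *ᵥ (b - z)) i + t) *
        ∏ j ∈ Finset.univ.erase i, normal1 (a j) ((V *ᵥ (b - z)) j) := by
    funext t
    rw [add_sub_right_comm, gk_add_smul_col hVW]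
  unfold HasLineDerivAt
  rw [e, gk_eq_mul_erase i]
  have h1 : HasDerivAt (fun t : ℝ => normal1 (a i) ((V *ᵥ (b - z)) i + t))
      (-((V *ᵥ (b - z)) i / a i) * normal1 (a i) ((V *ᵥ (b - z)) i)) 0 := by
    have := HasDerivAt.comp_const_add ((V *ᵥ (b - z)) i) 0
      (hasDerivAt_normal1 (a i) ((V *ᵥ (b - z)) i + 0))
    simpa using this
  have := h1.mul_const (∏ j ∈ Finset.univ.erase i, normal1 (a j) ((V *ᵥ (b - z)) j))
  convert! this using 1
  ring

lemma hasLineDerivAt_coord (hVW : V * W = 1) (i : Fin p) (z b : Fin p → ℝ) :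
    HasLineDerivAt ℝ (fun b => (V *ᵥ (b - z)) i) 1 b (W.col i) := by
  have e : (fun t : ℝ => (V *ᵥ (b + t • W.col i - z)) i) = fun t => (V *ᵥ (b - z)) i + t := by
    funext t
    rw [add_sub_right_comm, mulVec_add_smul_col hVW, if_pos rfl]
  unfold HasLineDerivAt
  rw [e]
  exact (hasDerivAt_id (0 : ℝ)).const_add _

lemma hasLineDerivAt_deriv_gk (hVW : V * W = 1) (i : Fin p) (z b : Fin p → ℝ) :
    HasLineDerivAt ℝ (fun b => -((V *ᵥ (b - z)) i / a i) * gk V a (b - z))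
      (((V *ᵥ (b - z)) i ^ 2 / a i ^ 2 - 1 / a i) * gk V a (b - z)) b (W.col i) := by
  have h1 := hasLineDerivAt_const_mul (-(1 / a i)) (hasLineDerivAt_coord hVW i z b)
  have h2 := hasLineDerivAt_mul h1 (hasLineDerivAt_gk (a := a) hVW i z b)
  convert! h2 using 1
  · funext b; ring
  · ring

lemma contDiff_gk (z : Fin p → ℝ) : ContDiff ℝ ∞ fun b => gk V a (b - z) := by
  have : ∀ i, ContDiff ℝ ∞ fun b => (V *ᵥ (b - z)) i := by
    intro i
    have h : ContDiff ℝ ∞ fun u : Fin p → ℝ => (V *ᵥ u) i := by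
      simp only [Matrix.mulVec, dotProduct]
      fun_prop
    exact h.comp (contDiff_id.sub contDiff_const)
  unfold gk normal1
  apply contDiff_prod
  intro i _
  refine contDiff_const.mul (Real.contDiff_exp.comp ?_)
  exact (((this i).pow 2).neg).div_const _

/-- The product rule and the one-dimensional heat equation. For the rates q i = 1 - d i the sum is
the operator trace{H(·)(Σ_A - Σ_C)} applied to the kernel, by `hasLineDerivAt_deriv_gk` and
`trace_hessian_mul`. -/
lemma hasDerivAt_gk_variance {q d : Fin p → ℝ} {s : ℝ} (hs : ∀ i, 0 < d i + s * q i)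
    (u : Fin p → ℝ) :
    HasDerivAt (fun s => gk V (fun i => d i + s * q i) u)
      (2⁻¹ * ∑ i, q i * (((V *ᵥ u) i ^ 2 / (d i + s * q i) ^ 2 - 1 / (d i + s * q i)) *
        gk V (fun i => d i + s * q i) u)) s := by
  unfold gk
  have h : ∀ i ∈ (Finset.univ : Finset (Fin p)),
      HasDerivAt (fun s => normal1 (d i + s * q i) ((V *ᵥ u) i))
      (2⁻¹ * ((V *ᵥ u) i ^ 2 / (d i + s * q i) ^ 2 - 1 / (d i + s * q i)) *
        normal1 (d i + s * q i) ((V *ᵥ u) i) * q i) s := by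
    intro i _
    have h1 : HasDerivAt (fun s => d i + s * q i) (q i) s := by
      simpa using ((hasDerivAt_id s).mul_const (q i)).const_add (d i)
    exact (hasDerivAt_normal1_variance (hs i) ((V *ᵥ u) i)).comp s h1
  have := HasDerivAt.fun_finsetProd h
  convert! this using 1
  rw [Finset.mul_sum]
  refine Finset.sum_congr rfl fun i _ => ?_
  rw [smul_eq_mul, ← Finset.mul_prod_erase _ _ (Finset.mem_univ i)]
  ring

end Kernel

/-! ### Monotonicity of smoothing -/

section Heat
variable {p : ℕ} {V W : Matrix (Fin p) (Fin p) ℝ} {d a : Fin p → ℝ} {π : (Fin p → ℝ) → ℝ}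

/-- The quadratic weight that dominates the derivatives of the kernel. -/
def quadWeight (V : Matrix (Fin p) (Fin p) ℝ) (u : Fin p → ℝ) : ℝ := 1 + ∑ i, (V *ᵥ u) i ^ 2

lemma one_le_quadWeight (u : Fin p → ℝ) : 1 ≤ quadWeight V u := by
  have : 0 ≤ ∑ i, (V *ᵥ u) i ^ 2 := Finset.sum_nonneg fun i _ => sq_nonneg _
  unfold quadWeight; linarith

lemma one_add_sq_le_quadWeight (u : Fin p → ℝ) (i : Fin p) :
    1 + (V *ᵥ u) i ^ 2 ≤ quadWeight V u := by
  have := Finset.single_le_sum (f := fun i => (V *ᵥ u) i ^ 2) (fun i _ => sq_nonneg _)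
    (Finset.mem_univ i)
  unfold quadWeight
  linarith

lemma continuous_quadWeight : Continuous (quadWeight V) :=
  continuous_const.add (continuous_finsetSum _ fun i _ => (continuous_mulVec_apply V i).pow 2)

/-- The shifted densities are the density times e^{-1/2} e^{∓v}. With e^{-1/2} ≥ 1/2 and e^v +
e^{-v} ≥ v² / 2, the constant 4 results. -/
lemma sq_mul_normal1_le (v : ℝ) :
    v ^ 2 * normal1 1 v ≤ 4 * (normal1 1 (v + 1) + normal1 1 (v + -1)) := by
  have e : ∀ c : ℝ, c ^ 2 = 1 → normal1 1 (v + c) =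
      normal1 1 v * (Real.exp (-(1 / 2)) * Real.exp (-c * v)) := by
    intro c hc
    unfold normal1
    rw [mul_assoc (√(2 * Real.pi * 1))⁻¹, ← Real.exp_add, ← Real.exp_add]
    congr 2
    linear_combination (-(1 / 2)) * hc
  have h1 : 2⁻¹ ≤ Real.exp (-(1 / 2)) := by
    have := Real.add_one_le_exp (-(1 / 2) : ℝ)
    linarith
  have h2 : v ^ 2 / 2 ≤ Real.exp (-1 * v) + Real.exp (-(-1) * v) := by
    have h := Real.quadratic_le_exp_of_nonneg (abs_nonneg v)
    rw [sq_abs] at h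
    have := abs_nonneg v
    rcases abs_cases v with ⟨h', h''⟩ | ⟨h', h''⟩
    · rw [neg_neg, one_mul]; rw [h'] at h; linarith [Real.exp_pos (-1 * v)]
    · rw [neg_neg, one_mul, neg_one_mul]; rw [h'] at h
      have := Real.exp_pos v
      linarith
  have hn := normal1_pos one_pos v
  rw [e 1 (by norm_num), e (-1) (by norm_num), ← mul_add, ← mul_add, mul_left_comm 4,
    mul_comm (v ^ 2)]
  refine mul_le_mul_of_nonneg_left ?_ hn.le
  have h3 : 0 ≤ Real.exp (-1 * v) + Real.exp (-(-1) * v) := by positivity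
  nlinarith

/-- A prior whose smoothing is finite everywhere has moments against the kernel. -/
lemma integrable_mul_gk (hπ : AEStronglyMeasurable π) (h0 : ∀ b, 0 ≤ π b)
    (hfin : ∀ z, smooth V (fun _ => 1) (fun b => ENNReal.ofReal (π b)) z ≠ ⊤) (z : Fin p → ℝ) :
    Integrable fun b => π b * gk V (fun _ => 1) (b - z) := by
  have hg : ∀ u, 0 < gk V (fun _ => 1) u := gk_pos fun _ => one_pos
  have hm : AEStronglyMeasurable (fun b => π b * gk V (fun _ => 1) (b - z)) :=
    hπ.mul (continuous_gk.comp (continuous_id.sub continuous_const)).aestronglyMeasurable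
  refine (lintegral_ofReal_ne_top_iff_integrable hm
    (Eventually.of_forall fun b => mul_nonneg (h0 b) (hg _).le)).1 ?_
  convert! hfin z using 1
  unfold smooth
  refine lintegral_congr fun b => ?_
  rw [ENNReal.ofReal_mul (h0 b), mul_comm, gk_sub_comm]

/-- Finiteness of the marginal at every z also controls second moments: each squared coordinate
times the kernel is bounded by two kernels translated by a column of W. This supplies the majorant
for every dominated convergence below. -/
lemma integrable_mul_quadWeight_mul_gk (hVW : V * W = 1) (hπ : AEStronglyMeasurable π)
    (h0 : ∀ b, 0 ≤ π b)
    (hfin : ∀ z, smooth V (fun _ => 1) (fun b => ENNReal.ofReal (π b)) z ≠ ⊤) (z : Fin p → ℝ) :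
    Integrable fun b => π b * (quadWeight V (b - z) * gk V (fun _ => 1) (b - z)) := by
  have hg : ∀ u, 0 < gk V (fun _ => 1) u := gk_pos fun _ => one_pos
  have hc : Continuous fun b : Fin p → ℝ => quadWeight V (b - z) * gk V (fun _ => 1) (b - z) :=
    (continuous_quadWeight.comp (continuous_id.sub continuous_const)).mul
      (continuous_gk.comp (continuous_id.sub continuous_const))
  have hI := integrable_mul_gk hπ h0 hfin
  have hbound : Integrable fun b => π b * gk V (fun _ => 1) (b - z) +
      ∑ i, 4 * (π b * gk V (fun _ => 1) (b - (z - W.col i)) +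
        π b * gk V (fun _ => 1) (b - (z + W.col i))) :=
    (hI z).add (integrable_finsetSum _ fun i _ => ((hI _).add (hI _)).const_mul 4)
  refine hbound.mono' (hπ.mul hc.aestronglyMeasurable) (Eventually.of_forall fun b => ?_)
  have hq : 0 < quadWeight V (b - z) := zero_lt_one.trans_le (one_le_quadWeight _)
  rw [Real.norm_eq_abs, abs_of_nonneg (mul_nonneg (h0 b) (mul_pos hq (hg _)).le), quadWeight,
    add_mul, one_mul, mul_add, Finset.sum_mul, Finset.mul_sum]
  refine add_le_add le_rfl (Finset.sum_le_sum fun i _ => ?_)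
  rw [← mul_add, mul_left_comm 4]
  refine mul_le_mul_of_nonneg_left ?_ (h0 b)
  have e1 : b - (z - W.col i) = b - z + (1 : ℝ) • W.col i := by rw [one_smul]; abel
  have e2 : b - (z + W.col i) = b - z + (-1 : ℝ) • W.col i := by rw [neg_one_smul]; abel
  rw [e1, e2, gk_add_smul_col hVW, gk_add_smul_col hVW, gk_eq_mul_erase i (b - z), ← add_mul,
    ← mul_assoc, ← mul_assoc]
  refine mul_le_mul_of_nonneg_right (sq_mul_normal1_le _) ?_
  exact Finset.prod_nonneg fun j _ => (normal1_pos one_pos _).le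

/-- Uniform bounds for the kernel and its derivatives. -/
lemma exists_gk_bound (hd : ∀ i, 0 < d i) : ∃ C : ℝ, 0 ≤ C ∧ ∀ a : Fin p → ℝ, (∀ i, d i ≤ a i) →
    (∀ i, a i ≤ 1) → ∀ u, gk V a u ≤ C * (quadWeight V u * gk V (fun _ => 1) u) ∧ ∀ i,
      |-((V *ᵥ u) i / a i) * gk V a u| ≤ C * (quadWeight V u * gk V (fun _ => 1) u) ∧
      |((V *ᵥ u) i ^ 2 / a i ^ 2 - 1 / a i) * gk V a u| ≤
        C * (quadWeight V u * gk V (fun _ => 1) u) := by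
  -- C₁ compares the kernel with the unit kernel, and C₂ bounds the polynomial prefactors of the
  -- derivatives. Both depend only on the lower bound d, so the estimate is uniform over variances
  -- in [d, 1].
  set C₁ : ℝ := ∏ i, (Real.sqrt (d i))⁻¹ with hC₁
  set C₂ : ℝ := 1 + ∑ i, (1 / d i + 1 / d i ^ 2) with hC₂
  have p1 : 0 ≤ C₁ := Finset.prod_nonneg fun i _ => by positivity
  have hsum : ∀ i, 1 / d i + 1 / d i ^ 2 ≤ C₂ := by
    intro i
    have := Finset.single_le_sum (f := fun i => 1 / d i + 1 / d i ^ 2)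
      (fun i _ => by have := hd i; positivity) (Finset.mem_univ i)
    linarith
  have p2 : 1 ≤ C₂ := by
    have : 0 ≤ ∑ i, (1 / d i + 1 / d i ^ 2) :=
      Finset.sum_nonneg fun i _ => by have := hd i; positivity
    linarith
  refine ⟨C₁ * C₂, by positivity, fun a hda ha1 u => ?_⟩
  have ha : ∀ i, 0 < a i := fun i => (hd i).trans_le (hda i)
  have hg1 : 0 < gk V (fun _ => 1) u := gk_pos (fun _ => one_pos) u
  have hga : 0 < gk V a u := gk_pos ha u
  have hk : gk V a u ≤ C₁ * gk V (fun _ => 1) u := by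
    refine (gk_le ha ha1 u).trans (mul_le_mul_of_nonneg_right ?_ hg1.le)
    refine Finset.prod_le_prod (fun i _ => by positivity) fun i _ => ?_
    exact inv_anti₀ (Real.sqrt_pos.2 (hd i)) (Real.sqrt_le_sqrt (hda i))
  have hq := one_le_quadWeight (V := V) u
  have key : ∀ c : ℝ, |c| ≤ C₂ * quadWeight V u →
      |c * gk V a u| ≤ C₁ * C₂ * (quadWeight V u * gk V (fun _ => 1) u) := by
    intro c hc
    rw [abs_mul, abs_of_pos hga]
    calc |c| * gk V a u ≤ (C₂ * quadWeight V u) * (C₁ * gk V (fun _ => 1) u) :=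
          mul_le_mul hc hk hga.le (by positivity)
      _ = _ := by ring
  refine ⟨?_, fun i => ⟨key _ ?_, key _ ?_⟩⟩
  · have := key 1 (by rw [abs_one]; nlinarith)
    rwa [one_mul, abs_of_pos hga] at this
  · rw [abs_neg, abs_div, abs_of_pos (ha i)]
    have h1 : |(V *ᵥ u) i| ≤ quadWeight V u := by
      have := one_add_sq_le_quadWeight (V := V) u i
      nlinarith [sq_nonneg (|(V *ᵥ u) i| - 1), sq_abs ((V *ᵥ u) i)]
    have h2 : 1 / a i ≤ C₂ := by
      have := one_div_le_one_div_of_le (hd i) (hda i)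
      have h3 := hsum i
      have : 0 < 1 / d i ^ 2 := by have := hd i; positivity
      linarith
    calc |(V *ᵥ u) i| / a i = 1 / a i * |(V *ᵥ u) i| := by ring
      _ ≤ C₂ * quadWeight V u := mul_le_mul h2 h1 (abs_nonneg _) (by linarith)
  · have h1 := one_div_le_one_div_of_le (hd i) (hda i)
    have h2 : 1 / a i ^ 2 ≤ 1 / d i ^ 2 :=
      one_div_le_one_div_of_le (by have := hd i; positivity)
        (pow_le_pow_left₀ (hd i).le (hda i) 2)
    have h3 : 0 ≤ 1 / a i := by have := ha i; positivity
    have h4 : 0 ≤ 1 / a i ^ 2 := by have := ha i; positivity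
    have h5 := hsum i
    have h6 := one_add_sq_le_quadWeight (V := V) u i
    have h7 := sq_nonneg ((V *ᵥ u) i)
    have h8 : (V *ᵥ u) i ^ 2 / a i ^ 2 = (V *ᵥ u) i ^ 2 * (1 / a i ^ 2) := by ring
    have h9 : (V *ᵥ u) i ^ 2 * (1 / a i ^ 2) ≤ (V *ᵥ u) i ^ 2 * C₂ :=
      mul_le_mul_of_nonneg_left (by linarith) h7
    have h10 : C₂ * (1 + (V *ᵥ u) i ^ 2) ≤ C₂ * quadWeight V u :=
      mul_le_mul_of_nonneg_left h6 (by linarith)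
    rw [h8, abs_le]
    constructor
    · nlinarith [mul_nonneg h7 h4]
    · nlinarith [mul_nonneg h7 h4]

/-- The distributional inequality extends to the normal kernels as test functions. -/
lemma integral_mul_kernel_nonpos (hVW : V * W = 1) (hd : ∀ i, 0 < d i)
    (hπ : DistribTraceHessianNonpos π (W * diagonal (fun i => 1 - d i) * Wᵀ))
    (h0 : ∀ b, 0 ≤ π b)
    (hfin : ∀ z, smooth V (fun _ => 1) (fun b => ENNReal.ofReal (π b)) z ≠ ⊤)
    (hda : ∀ i, d i ≤ a i) (ha1 : ∀ i, a i ≤ 1) (z : Fin p → ℝ) :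
    ∫ b, π b * ∑ i, (1 - d i) * (((V *ᵥ (b - z)) i ^ 2 / a i ^ 2 - 1 / a i) * gk V a (b - z)) ≤
      0 := by
  -- The cutoff need not be 1 near the origin: only χ(0) = 1 is used, since χ(r_N b) → χ(0)
  -- pointwise and each derivative of the rescaled cutoff carries a factor r_N → 0.
  obtain ⟨χ, -, hχc, hχ, hχr, hχ0⟩ := exists_contDiff_tsupport_subset (n := (⊤ : ℕ∞))
    (s := Set.univ) (x := (0 : Fin p → ℝ)) Filter.univ_mem
  have hχ : ContDiff ℝ ∞ χ := hχ
  have ha : ∀ i, 0 < a i := fun i => (hd i).trans_le (hda i)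
  obtain ⟨C, hC0, hC⟩ := exists_gk_bound (V := V) hd
  have hπm := hπ.1.aestronglyMeasurable
  have hG := integrable_mul_quadWeight_mul_gk hVW hπm h0 hfin z
  let χ1 : Fin p → (Fin p → ℝ) → ℝ := fun i b => fderiv ℝ χ b (W.col i)
  let χ2 : Fin p → (Fin p → ℝ) → ℝ := fun i b => fderiv ℝ (fderiv ℝ χ) b (W.col i) (W.col i)
  have cχ1 : ∀ i, Continuous (χ1 i) := fun i => (contDiff_fderiv_apply hχ _).continuous
  have eχ2 : ∀ i, χ2 i = fun b => fderiv ℝ (χ1 i) b (W.col i) := fun i => funext fun b =>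
    fderiv_fderiv_of_hasLineDerivAt hχ (fun β => hasLineDerivAt_fderiv hχ β _)
      (fun β => hasLineDerivAt_fderiv (contDiff_fderiv_apply hχ _) β _) b
  have cχ2 : ∀ i, Continuous (χ2 i) := fun i => by
    rw [eχ2]; exact (contDiff_fderiv_apply (contDiff_fderiv_apply hχ _) _).continuous
  have sχ1 : ∀ i, HasCompactSupport (χ1 i) := fun i => hχc.fderiv_apply ℝ _
  have sχ2 : ∀ i, HasCompactSupport (χ2 i) := fun i => by
    rw [eχ2]; exact (sχ1 i).fderiv_apply ℝ _
  choose M1 hM1 using fun i => (sχ1 i).exists_bound_of_continuous (cχ1 i)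
  choose M2 hM2 using fun i => (sχ2 i).exists_bound_of_continuous (cχ2 i)
  set k : (Fin p → ℝ) → ℝ := fun b => gk V a (b - z) with hk
  let k1 : Fin p → (Fin p → ℝ) → ℝ := fun i b => -((V *ᵥ (b - z)) i / a i) * gk V a (b - z)
  let k2 : Fin p → (Fin p → ℝ) → ℝ := fun i b =>
    ((V *ᵥ (b - z)) i ^ 2 / a i ^ 2 - 1 / a i) * gk V a (b - z)
  have cV : ∀ i, Continuous fun b : Fin p → ℝ => (V *ᵥ (b - z)) i := fun i =>
    (continuous_mulVec_apply V i).comp (continuous_id.sub continuous_const)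
  have ck : Continuous k := (contDiff_gk z).continuous
  have ck1 : ∀ i, Continuous (k1 i) := fun i => (((cV i).div_const _).neg).mul ck
  have ck2 : ∀ i, Continuous (k2 i) := fun i =>
    ((((cV i).pow 2).div_const _).sub continuous_const).mul ck
  let r : ℕ → ℝ := fun N => 1 / ((N : ℝ) + 1)
  have r0 : ∀ N, 0 < r N := fun N => by positivity
  have r1 : ∀ N, r N ≤ 1 := fun N => by
    rw [div_le_one (by positivity)]; linarith [Nat.cast_nonneg (α := ℝ) N]
  have rlim : Tendsto r atTop (𝓝 0) := tendsto_one_div_add_atTop_nhds_zero_nat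
  -- The Leibniz expansion of the second derivative of χ(r_N b) k(b) along the i-th column. Only the
  -- first term survives in the limit.
  let T : ℕ → Fin p → (Fin p → ℝ) → ℝ := fun N i b =>
    χ (r N • b) * k2 i b + 2 * (r N * χ1 i (r N • b)) * k1 i b +
      r N * (r N * χ2 i (r N • b)) * k b
  have cT : ∀ N i, Continuous (T N i) := by
    intro N i
    have cs : Continuous fun b : Fin p → ℝ => r N • b := continuous_const_smul (r N)
    exact (((hχ.continuous.comp cs).mul (ck2 i)).add
      (((continuous_const.mul (continuous_const.mul ((cχ1 i).comp cs)))).mul (ck1 i))).add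
      ((continuous_const.mul (continuous_const.mul ((cχ2 i).comp cs))).mul ck)
  have test : ∀ N, ∫ b, π b * ∑ i, (1 - d i) * T N i b ≤ 0 := by
    intro N
    have hsm : ContDiff ℝ ∞ fun b : Fin p → ℝ => χ (r N • b) :=
      hχ.comp (contDiff_const_smul (r N))
    have hφ : ContDiff ℝ ∞ fun b => χ (r N • b) * k b := hsm.mul (contDiff_gk z)
    have hφc : HasCompactSupport fun b => χ (r N • b) * k b :=
      (hχc.comp_smul (r0 N).ne').mul_right
    have hφ0 : ∀ b, 0 ≤ χ (r N • b) * k b := fun b =>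
      mul_nonneg (hχr ⟨_, rfl⟩).1 (gk_pos ha _).le
    have h2 : ∀ i b, fderiv ℝ (fderiv ℝ fun b => χ (r N • b) * k b) b (W.col i) (W.col i) =
        T N i b := by
      intro i b
      have l1 : ∀ b, HasLineDerivAt ℝ (fun b => χ (r N • b)) (r N * χ1 i (r N • b)) b
          (W.col i) := fun b =>
        hasLineDerivAt_comp_smul (r N) (hasLineDerivAt_fderiv hχ (r N • b) (W.col i))
      have l2 : ∀ b, HasLineDerivAt ℝ (fun b => r N * χ1 i (r N • b))
          (r N * (r N * χ2 i (r N • b))) b (W.col i) := fun b =>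
        hasLineDerivAt_const_mul (r N)
          (hasLineDerivAt_comp_smul (r N) (hasLineDerivAt_fderiv_fderiv hχ (r N • b) (W.col i)))
      have l3 := fun b => hasLineDerivAt_gk (a := a) hVW i z b
      have l4 := fun b => hasLineDerivAt_deriv_gk (a := a) hVW i z b
      have f1 := fun b => hasLineDerivAt_mul (l1 b) (l3 b)
      have f2 := fun b => hasLineDerivAt_add (hasLineDerivAt_mul (l2 b) (l3 b))
        (hasLineDerivAt_mul (l1 b) (l4 b))
      rw [fderiv_fderiv_of_hasLineDerivAt hφ f1 f2]
      simp only [T, k2, k1, k]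
      ring
    have := hπ.2 _ hφ hφc hφ0
    simp_rw [trace_hessian_mul, h2] at this
    exact this
  set M : ℝ := ∑ i, |1 - d i| * (C + 2 * |M1 i| * C + |M2 i| * C) with hM
  have lim : Tendsto (fun N => ∫ b, π b * ∑ i, (1 - d i) * T N i b) atTop
      (𝓝 (∫ b, π b * ∑ i, (1 - d i) * k2 i b)) := by
    refine tendsto_integral_of_dominated_convergence
      (fun b => M * (π b * (quadWeight V (b - z) * gk V (fun _ => 1) (b - z)))) ?_ ?_ ?_ ?_
    · intro N
      exact hπm.mul (continuous_finsetSum _ fun i _ =>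
        continuous_const.mul (cT N i)).aestronglyMeasurable
    · exact hG.const_mul M
    · intro N
      refine Eventually.of_forall fun b => ?_
      set Q := quadWeight V (b - z) * gk V (fun _ => 1) (b - z) with hQ
      have hb := hC a hda ha1 (b - z)
      rw [norm_mul, Real.norm_eq_abs, abs_of_nonneg (h0 b), mul_left_comm]
      refine mul_le_mul_of_nonneg_left ?_ (h0 b)
      rw [hM, Finset.sum_mul]
      refine (norm_sum_le _ _).trans (Finset.sum_le_sum fun i _ => ?_)
      rw [norm_mul, Real.norm_eq_abs, mul_assoc]
      refine mul_le_mul_of_nonneg_left ?_ (abs_nonneg _)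
      have hχ1 : |χ (r N • b)| ≤ 1 := by
        rw [abs_of_nonneg (hχr ⟨_, rfl⟩).1]; exact (hχr ⟨_, rfl⟩).2
      have b1 : |χ1 i (r N • b)| ≤ |M1 i| := (hM1 i _).trans (le_abs_self _)
      have b2 : |χ2 i (r N • b)| ≤ |M2 i| := (hM2 i _).trans (le_abs_self _)
      have rabs : |r N| ≤ 1 := by rw [abs_of_pos (r0 N)]; exact r1 N
      have b3 : |2 * (r N * χ1 i (r N • b))| ≤ 2 * |M1 i| := by
        rw [abs_mul, abs_mul, abs_two]
        have := mul_le_mul rabs b1 (abs_nonneg _) zero_le_one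
        linarith
      have b4 : |r N * (r N * χ2 i (r N • b))| ≤ |M2 i| := by
        rw [abs_mul, abs_mul]
        have := mul_le_mul rabs b2 (abs_nonneg _) zero_le_one
        have := mul_le_mul rabs this (by positivity) zero_le_one
        linarith
      have hkb : |k b| ≤ C * Q := by rw [abs_of_pos (gk_pos ha _)]; exact hb.1
      rw [Real.norm_eq_abs]
      calc |T N i b| ≤ |χ (r N • b) * k2 i b| + |2 * (r N * χ1 i (r N • b)) * k1 i b| +
            |r N * (r N * χ2 i (r N • b)) * k b| :=
            (abs_add_le _ _).trans (add_le_add (abs_add_le _ _) le_rfl)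
        _ ≤ 1 * (C * Q) + 2 * |M1 i| * (C * Q) + |M2 i| * (C * Q) := by
            rw [abs_mul, abs_mul (2 * _), abs_mul (r N * _)]
            exact add_le_add (add_le_add
              (mul_le_mul hχ1 (hb.2 i).2 (abs_nonneg _) zero_le_one)
              (mul_le_mul b3 (hb.2 i).1 (abs_nonneg _) (by positivity)))
              (mul_le_mul b4 hkb (abs_nonneg _) (by positivity))
        _ = _ := by ring
    · refine Eventually.of_forall fun b => ?_
      have ls : Tendsto (fun N => r N • b) atTop (𝓝 0) := by
        have := rlim.smul_const b
        rwa [zero_smul] at this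
      have t0 : Tendsto (fun N => χ (r N • b)) atTop (𝓝 1) := by
        rw [← hχ0]; exact (hχ.continuous.tendsto 0).comp ls
      refine Tendsto.const_mul _ (tendsto_finsetSum _ fun i _ => Tendsto.const_mul _ ?_)
      have t1 := ((cχ1 i).tendsto 0).comp ls
      have t2 := ((cχ2 i).tendsto 0).comp ls
      have := ((t0.mul_const (k2 i b)).add (((rlim.mul t1).const_mul 2).mul_const (k1 i b))).add
        ((rlim.mul (rlim.mul t2)).mul_const (k b))
      simpa using this
  exact le_of_tendsto' lim test

/-- Smoothing more decreases a prior with `trace {H(π) Q} ≤ 0`. -/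
lemma smooth_one_le_smooth (hVW : V * W = 1) (hd : ∀ i, 0 < d i) (hd1 : ∀ i, d i ≤ 1)
    (hπ : DistribTraceHessianNonpos π (W * diagonal (fun i => 1 - d i) * Wᵀ))
    (h0 : ∀ b, 0 ≤ π b)
    (hfin : ∀ z, smooth V (fun _ => 1) (fun b => ENNReal.ofReal (π b)) z ≠ ⊤) (z : Fin p → ℝ) :
    smooth V (fun _ => 1) (fun b => ENNReal.ofReal (π b)) z ≤
      smooth V d (fun b => ENNReal.ofReal (π b)) z := by
  obtain ⟨C, hC0, hC⟩ := exists_gk_bound (V := V) hd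
  have hπm := hπ.1.aestronglyMeasurable
  have hG := (integrable_mul_quadWeight_mul_gk hVW hπm h0 hfin z).const_mul C
  -- The straight path of variances from d to 1 has velocity 1 - d, so the derivative of the
  -- smoothing is governed by Σ_A - Σ_C at every time.
  let a : ℝ → Fin p → ℝ := fun s i => d i + s * (1 - d i)
  have hda : ∀ s, 0 ≤ s → ∀ i, d i ≤ a s i := fun s hs i => by
    have := mul_nonneg hs (sub_nonneg.2 (hd1 i)); simp only [a]; linarith
  have ha1 : ∀ s, s ≤ 1 → ∀ i, a s i ≤ 1 := fun s hs i => by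
    have := mul_le_mul_of_nonneg_right hs (sub_nonneg.2 (hd1 i)); simp only [a]; linarith
  have hpos : ∀ s, 0 ≤ s → ∀ i, 0 < a s i := fun s hs i => (hd i).trans_le (hda s hs i)
  have cg : ∀ a : Fin p → ℝ, Continuous fun b : Fin p → ℝ => gk V a (b - z) := fun a =>
    continuous_gk.comp (continuous_id.sub continuous_const)
  have hmeas : ∀ s, AEStronglyMeasurable fun b => π b * gk V (a s) (b - z) := fun s =>
    hπm.mul (cg (a s)).aestronglyMeasurable
  have hbound : ∀ s ∈ Set.Icc (0 : ℝ) 1, ∀ b, ‖π b * gk V (a s) (b - z)‖ ≤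
      C * (π b * (quadWeight V (b - z) * gk V (fun _ => 1) (b - z))) := by
    intro s hs b
    rw [Real.norm_eq_abs, abs_of_nonneg (mul_nonneg (h0 b) (gk_pos (hpos s hs.1) _).le),
      mul_left_comm]
    exact mul_le_mul_of_nonneg_left (hC (a s) (hda s hs.1) (ha1 s hs.2) (b - z)).1 (h0 b)
  have hint : ∀ s ∈ Set.Icc (0 : ℝ) 1, Integrable fun b => π b * gk V (a s) (b - z) :=
    fun s hs => hG.mono' (hmeas s) (Eventually.of_forall (hbound s hs))
  let F : ℝ → ℝ := fun s => ∫ b, π b * gk V (a s) (b - z)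
  have hder : ∀ s, 0 ≤ s → ∀ b, HasDerivAt (fun s => π b * gk V (a s) (b - z))
      (π b * (2⁻¹ * ∑ i, (1 - d i) * (((V *ᵥ (b - z)) i ^ 2 / (a s i) ^ 2 - 1 / (a s i)) *
        gk V (a s) (b - z)))) s := fun s hs b =>
    (hasDerivAt_gk_variance (q := fun i => 1 - d i) (hpos s hs) (b - z)).const_mul (π b)
  have hcont : ContinuousOn F (Set.Icc 0 1) := by
    refine continuousOn_of_dominated (fun s _ => hmeas s)
      (fun s hs => Eventually.of_forall (hbound s hs)) hG (Eventually.of_forall fun b s hs => ?_)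
    exact (hder s hs.1 b).continuousAt.continuousWithinAt
  have hderF : ∀ s ∈ Set.Ioo (0 : ℝ) 1, HasDerivAt F
      (∫ b, π b * (2⁻¹ * ∑ i, (1 - d i) * (((V *ᵥ (b - z)) i ^ 2 / (a s i) ^ 2 - 1 / (a s i)) *
        gk V (a s) (b - z)))) s := by
    intro s hs
    refine (hasDerivAt_integral_of_dominated_loc_of_deriv_le
      (F' := fun s b => π b * (2⁻¹ * ∑ i, (1 - d i) * (((V *ᵥ (b - z)) i ^ 2 / (a s i) ^ 2 -
        1 / (a s i)) * gk V (a s) (b - z))))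
      (bound := fun b => (2⁻¹ * ∑ i, |1 - d i|) *
        (C * (π b * (quadWeight V (b - z) * gk V (fun _ => 1) (b - z)))))
      (isOpen_Ioo.mem_nhds hs) (Eventually.of_forall hmeas) (hint s ⟨hs.1.le, hs.2.le⟩) ?_ ?_
      (hG.const_mul _) (Eventually.of_forall fun b s hs => hder s hs.1.le b)).2
    · refine hπm.mul (Continuous.aestronglyMeasurable ?_)
      refine continuous_const.mul (continuous_finsetSum _ fun i _ => continuous_const.mul ?_)
      have cV : Continuous fun b : Fin p → ℝ => (V *ᵥ (b - z)) i :=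
        (continuous_mulVec_apply V i).comp (continuous_id.sub continuous_const)
      exact (((cV.pow 2).div_const _).sub continuous_const).mul (cg _)
    · refine Eventually.of_forall fun b s hs => ?_
      have hb := hC (a s) (hda s hs.1.le) (ha1 s hs.2.le) (b - z)
      rw [norm_mul, Real.norm_eq_abs, abs_of_nonneg (h0 b), norm_mul, Real.norm_eq_abs,
        abs_of_pos (by norm_num : (0 : ℝ) < 2⁻¹)]
      have hs : ‖∑ i, (1 - d i) * (((V *ᵥ (b - z)) i ^ 2 / (a s i) ^ 2 - 1 / (a s i)) *
          gk V (a s) (b - z))‖ ≤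
          (∑ i, |1 - d i|) * (C * (quadWeight V (b - z) * gk V (fun _ => 1) (b - z))) := by
        rw [Finset.sum_mul]
        refine (norm_sum_le _ _).trans (Finset.sum_le_sum fun i _ => ?_)
        rw [norm_mul, Real.norm_eq_abs]
        exact mul_le_mul_of_nonneg_left (hb.2 i).2 (abs_nonneg _)
      calc _ ≤ π b * (2⁻¹ * ((∑ i, |1 - d i|) *
            (C * (quadWeight V (b - z) * gk V (fun _ => 1) (b - z))))) := by
            refine mul_le_mul_of_nonneg_left (mul_le_mul_of_nonneg_left hs (by norm_num)) (h0 b)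
        _ = _ := by ring
  have hanti : AntitoneOn F (Set.Icc 0 1) := by
    refine antitoneOn_of_deriv_nonpos (convex_Icc 0 1) hcont ?_ ?_
    · rw [interior_Icc]
      exact fun s hs => (hderF s hs).differentiableAt.differentiableWithinAt
    · rw [interior_Icc]
      intro s hs
      rw [(hderF s hs).deriv]
      -- The variances along the path lie between d and 1, so the derivative is half of an integral
      -- already known to be nonpositive.
      have := integral_mul_kernel_nonpos hVW hd hπ h0 hfin (hda s hs.1.le) (ha1 s hs.2.le) z
      simp_rw [mul_left_comm (π _) 2⁻¹]
      rw [integral_const_mul]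
      linarith
  have hle : F 1 ≤ F 0 := hanti (by simp) (by simp) zero_le_one
  have conv : ∀ s ∈ Set.Icc (0 : ℝ) 1,
      smooth V (a s) (fun b => ENNReal.ofReal (π b)) z = ENNReal.ofReal (F s) := by
    intro s hs
    rw [ofReal_integral_eq_lintegral_ofReal (hint s hs)
      (Eventually.of_forall fun b => mul_nonneg (h0 b) (gk_pos (hpos s hs.1) _).le)]
    refine lintegral_congr fun b => ?_
    rw [ENNReal.ofReal_mul (h0 b), mul_comm, gk_sub_comm]
  have a0 : a 0 = d := by funext i; simp [a]
  have a1 : a 1 = fun _ => 1 := by funext i; simp [a]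
  rw [← a0, ← a1, conv 0 (by simp), conv 1 (by simp)]
  exact ENNReal.ofReal_le_ofReal hle

end Heat

/-! ### The regularized harmonic prior -/

section Regularized
variable {p : ℕ} {V W : Matrix (Fin p) (Fin p) ℝ} {d : Fin p → ℝ} {φ : (Fin p → ℝ) → ℝ}

/-- The quadratic form of the scaled harmonic prior. -/
def activeForm (V : Matrix (Fin p) (Fin p) ℝ) (d : Fin p → ℝ) (b : Fin p → ℝ) : ℝ :=
  ∑ i ∈ activeSet d, (V *ᵥ b) i ^ 2 / (1 - d i)

lemma mem_activeSet {i : Fin p} : i ∈ activeSet d ↔ d i < 1 := by simp [activeSet]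

lemma activeForm_nonneg (b : Fin p → ℝ) : 0 ≤ activeForm V d b :=
  Finset.sum_nonneg fun _ hi => div_nonneg (sq_nonneg _) (sub_nonneg.2 (mem_activeSet.1 hi).le)

lemma continuous_activeForm : Continuous (activeForm V d) :=
  continuous_finsetSum _ fun i _ => ((continuous_mulVec_apply V i).pow 2).div_const _

lemma scaledHarmonic_eq (b : Fin p → ℝ) : scaledHarmonic W d b =
    activeForm W⁻¹ d b ^ (-((((activeSet d).card : ℝ) - 2) / 2)) := by
  change √(activeForm W⁻¹ d b) ^ _ = _
  rw [Real.sqrt_eq_rpow, ← Real.rpow_mul (activeForm_nonneg b)]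
  congr 1
  ring

lemma hasLineDerivAt_activeForm (hVW : V * W = 1) {i : Fin p} (hi : d i < 1) (b : Fin p → ℝ) :
    HasLineDerivAt ℝ (activeForm V d) (2 * (V *ᵥ b) i / (1 - d i)) b (W.col i) := by
  unfold HasLineDerivAt activeForm
  simp_rw [mulVec_add_smul_col hVW]
  have h : ∀ j ∈ activeSet d, HasDerivAt
      (fun t : ℝ => ((V *ᵥ b) j + if j = i then t else 0) ^ 2 / (1 - d j))
      (if j = i then 2 * (V *ᵥ b) j / (1 - d j) else 0) 0 := by
    intro j _
    by_cases hj : j = i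
    · simp only [hj, if_true]
      have := (((hasDerivAt_id (0 : ℝ)).const_add ((V *ᵥ b) i)).pow 2).div_const (1 - d i)
      simpa using this
    · simp only [hj, if_false]
      exact hasDerivAt_const _ _
  have := HasDerivAt.fun_sum h
  rwa [Finset.sum_ite_eq' _ _ _, if_pos (mem_activeSet.2 hi)] at this

lemma hasLineDerivAt_rpow_activeForm (hVW : V * W = 1) {i : Fin p} (hi : d i < 1) {ε : ℝ}
    (hε : 0 < ε) (c : ℝ) (b : Fin p → ℝ) :
    HasLineDerivAt ℝ (fun b => (ε + activeForm V d b) ^ c)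
      (2 * (V *ᵥ b) i / (1 - d i) * c * (ε + activeForm V d b) ^ (c - 1)) b (W.col i) := by
  have h : HasDerivAt (fun t : ℝ => ε + activeForm V d (b + t • W.col i))
      (2 * (V *ᵥ b) i / (1 - d i)) 0 :=
    HasDerivAt.const_add ε (hasLineDerivAt_activeForm hVW hi b)
  have := h.rpow_const (p := c) (Or.inl (by
    have := activeForm_nonneg (V := V) (d := d) (b + (0 : ℝ) • W.col i); linarith))
  simpa [HasLineDerivAt] using this

/-- The second directional derivative of the regularized prior. -/
lemma hasLineDerivAt_deriv_rpow_activeForm (hVW : V * W = 1) {i : Fin p} (hi : d i < 1) {ε : ℝ}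
    (hε : 0 < ε) (c : ℝ) (b : Fin p → ℝ) :
    HasLineDerivAt ℝ
      (fun b => 2 * (V *ᵥ b) i / (1 - d i) * c * (ε + activeForm V d b) ^ (c - 1))
      (2 * c / (1 - d i) * (ε + activeForm V d b) ^ (c - 1) + 4 * c * (c - 1) *
        ((V *ᵥ b) i / (1 - d i)) ^ 2 * (ε + activeForm V d b) ^ (c - 2)) b (W.col i) := by
  have h1 : HasLineDerivAt ℝ (fun b => (V *ᵥ b) i) 1 b (W.col i) := by
    simpa using hasLineDerivAt_coord hVW i 0 b
  have h2 := hasLineDerivAt_mul (hasLineDerivAt_const_mul (2 * c / (1 - d i)) h1)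
    (hasLineDerivAt_rpow_activeForm hVW hi hε (c - 1) b)
  convert! h2 using 1
  · funext b; ring
  · rw [sub_sub, one_add_one_eq_two]; ring

lemma fderiv_fderiv_eq (hφ : ContDiff ℝ ∞ φ) (w : Fin p → ℝ) :
    (fun b => fderiv ℝ (fderiv ℝ φ) b w w) = fun b => fderiv ℝ (fun b => fderiv ℝ φ b w) b w :=
  funext fun b => fderiv_fderiv_of_hasLineDerivAt hφ (fun β => hasLineDerivAt_fderiv hφ β _)
    (fun β => hasLineDerivAt_fderiv (contDiff_fderiv_apply hφ _) β _) b

lemma continuous_fderiv_fderiv (hφ : ContDiff ℝ ∞ φ) (w : Fin p → ℝ) :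
    Continuous fun b => fderiv ℝ (fderiv ℝ φ) b w w := by
  rw [fderiv_fderiv_eq hφ]
  exact (contDiff_fderiv_apply (contDiff_fderiv_apply hφ _) _).continuous

lemma hasCompactSupport_fderiv_fderiv (hφ : ContDiff ℝ ∞ φ) (hφc : HasCompactSupport φ)
    (w : Fin p → ℝ) : HasCompactSupport fun b => fderiv ℝ (fderiv ℝ φ) b w w := by
  rw [fderiv_fderiv_eq hφ]
  exact (hφc.fderiv_apply ℝ w).fderiv_apply ℝ w

/-- Two integrations by parts along w; the compact support of φ makes every product integrable, so f
needs no decay. -/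
lemma integral_mul_fderiv_fderiv {f f₁ f₂ : (Fin p → ℝ) → ℝ} {w : Fin p → ℝ}
    (cf : Continuous f) (cf₁ : Continuous f₁) (cf₂ : Continuous f₂)
    (h₁ : ∀ b, HasLineDerivAt ℝ f (f₁ b) b w) (h₂ : ∀ b, HasLineDerivAt ℝ f₁ (f₂ b) b w)
    (hφ : ContDiff ℝ ∞ φ) (hφc : HasCompactSupport φ) :
    ∫ b, f b * fderiv ℝ (fderiv ℝ φ) b w w = ∫ b, f₂ b * φ b := by
  have key : ∀ {f f' g g' : (Fin p → ℝ) → ℝ}, Continuous f → Continuous f' → Continuous g →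
      Continuous g' → HasCompactSupport g → HasCompactSupport g' →
      (∀ b, HasLineDerivAt ℝ f (f' b) b w) → (∀ b, HasLineDerivAt ℝ g (g' b) b w) →
      ∫ b, f b * g' b = -∫ b, f' b * g b := by
    intro f f' g g' cf cf' cg cg' sg sg' hf hg
    exact integral_bilinear_hasLineDerivAt_right_eq_neg_left_of_integrable (μ := volume)
      (B := ContinuousLinearMap.mul ℝ ℝ)
      ((cf'.mul cg).integrable_of_hasCompactSupport sg.mul_left)
      ((cf.mul cg').integrable_of_hasCompactSupport sg'.mul_left)
      ((cf.mul cg).integrable_of_hasCompactSupport sg.mul_left)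
      (fun b _ => hf b) (fun b _ => hg b)
  have c1 := contDiff_fderiv_apply hφ w
  have s1 : HasCompactSupport fun b => fderiv ℝ φ b w := hφc.fderiv_apply ℝ _
  rw [key cf cf₁ c1.continuous (continuous_fderiv_fderiv hφ w) s1
    (hasCompactSupport_fderiv_fderiv hφ hφc w) h₁ fun b => hasLineDerivAt_fderiv_fderiv hφ b w,
    key cf₁ cf₂ hφ.continuous c1.continuous hφc s1 h₂ fun b => hasLineDerivAt_fderiv hφ b w,
    neg_neg]

/-- In the scaled active coordinates this is the superharmonicity of (ε + ‖u‖²)^(-(r-2)/2) in r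
dimensions, moved to the test function by parts. Adding ε removes the singularity, so classical
derivatives suffice. -/
lemma trace_integral_regularized_nonpos (hVW : V * W = 1) (hd1 : ∀ i, d i ≤ 1)
    (hr : 2 ≤ (activeSet d).card) {ε : ℝ} (hε : 0 < ε)
    (hφ : ContDiff ℝ ∞ φ) (hφc : HasCompactSupport φ) (hφ0 : ∀ b, 0 ≤ φ b) :
    ∫ b, (ε + activeForm V d b) ^ (-((((activeSet d).card : ℝ) - 2) / 2)) *
      ∑ i, (1 - d i) * fderiv ℝ (fderiv ℝ φ) b (W.col i) (W.col i) ≤ 0 := by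
  set r : ℝ := ((activeSet d).card : ℝ) with hr'
  set c : ℝ := -((r - 2) / 2) with hc
  have hr2 : 2 ≤ r := by rw [hr']; exact_mod_cast hr
  have pos : ∀ b, 0 < ε + activeForm V d b := fun b => by
    have := activeForm_nonneg (V := V) (d := d) b; linarith
  have crpow : ∀ c : ℝ, Continuous fun b => (ε + activeForm V d b) ^ c := fun c =>
    (continuous_const.add continuous_activeForm).rpow_const fun b => Or.inl (pos b).ne'
  let D : Fin p → (Fin p → ℝ) → ℝ := fun i b =>
    2 * c / (1 - d i) * (ε + activeForm V d b) ^ (c - 1) + 4 * c * (c - 1) *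
      ((V *ᵥ b) i / (1 - d i)) ^ 2 * (ε + activeForm V d b) ^ (c - 2)
  have cD : ∀ i, Continuous (D i) := fun i =>
    (continuous_const.mul (crpow _)).add ((continuous_const.mul
      (((continuous_mulVec_apply V i).div_const _).pow 2)).mul (crpow _))
  have parts : ∀ i ∈ activeSet d, ∫ b, (ε + activeForm V d b) ^ c *
      fderiv ℝ (fderiv ℝ φ) b (W.col i) (W.col i) = ∫ b, D i b * φ b := by
    intro i hi
    rw [mem_activeSet] at hi
    refine integral_mul_fderiv_fderiv (crpow c) ?_ (cD i)
      (fun b => hasLineDerivAt_rpow_activeForm hVW hi hε c b)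
      (fun b => hasLineDerivAt_deriv_rpow_activeForm hVW hi hε c b) hφ hφc
    exact (((continuous_const.mul (continuous_mulVec_apply V i)).div_const _).mul
      continuous_const).mul (crpow _)
  have e1 : ∀ b, (ε + activeForm V d b) ^ c *
      ∑ i, (1 - d i) * fderiv ℝ (fderiv ℝ φ) b (W.col i) (W.col i) = ∑ i ∈ activeSet d,
        (1 - d i) * ((ε + activeForm V d b) ^ c *
          fderiv ℝ (fderiv ℝ φ) b (W.col i) (W.col i)) := by
    intro b
    -- Since d i ≤ 1, inactive indices have d i = 1 and weight zero.
    rw [Finset.mul_sum, ← Finset.sum_subset (Finset.subset_univ (activeSet d))]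
    · exact Finset.sum_congr rfl fun i _ => by ring
    · intro i _ hi
      rw [mem_activeSet, not_lt] at hi
      rw [le_antisymm (hd1 i) hi]; ring
  have iD : ∀ i, Integrable fun b => D i b * φ b := fun i =>
    ((cD i).mul hφ.continuous).integrable_of_hasCompactSupport hφc.mul_left
  simp_rw [e1]
  have iL : ∀ i, Integrable fun b => (1 - d i) * ((ε + activeForm V d b) ^ c *
      fderiv ℝ (fderiv ℝ φ) b (W.col i) (W.col i)) := fun i =>
    (((crpow c).mul (continuous_fderiv_fderiv hφ _)).integrable_of_hasCompactSupport
      (hasCompactSupport_fderiv_fderiv hφ hφc _).mul_left).const_mul _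
  rw [integral_finsetSum _ fun i _ => iL i]
  simp_rw [integral_const_mul]
  rw [Finset.sum_congr rfl fun i hi => by rw [parts i hi, ← integral_const_mul],
    ← integral_finsetSum _ fun i _ => (iD i).const_mul _]
  refine integral_nonpos fun b => ?_
  have hsum : ∑ i ∈ activeSet d, (1 - d i) * (D i b * φ b) =
      φ b * (ε + activeForm V d b) ^ (c - 2) * (4 * c * (c - 1)) * (-ε) := by
    have hp : (ε + activeForm V d b) ^ (c - 1) =
        (ε + activeForm V d b) ^ (c - 2) * (ε + activeForm V d b) := by
      conv_rhs => rw [← Real.rpow_add_one (pos b).ne']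
      congr 1; ring
    have h1 : ∀ i ∈ activeSet d, (1 - d i) * (D i b * φ b) =
        φ b * (ε + activeForm V d b) ^ (c - 2) * (2 * c * (ε + activeForm V d b)) +
        φ b * (ε + activeForm V d b) ^ (c - 2) * (4 * c * (c - 1)) *
          ((V *ᵥ b) i ^ 2 / (1 - d i)) := by
      intro i hi
      have hq : 1 - d i ≠ 0 := (sub_pos.2 (mem_activeSet.1 hi)).ne'
      simp only [D]
      rw [hp]
      field_simp
    rw [Finset.sum_congr rfl h1, Finset.sum_add_distrib, Finset.sum_const, nsmul_eq_mul,
      ← Finset.mul_sum, ← hr']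
    change _ + _ * activeForm V d b = _
    -- The exponent c is chosen for this relation: 2 c r = -4 c (c - 1), so the terms in the
    -- quadratic form cancel and only a multiple of -ε remains. Its coefficient c (c - 1) is
    -- nonnegative because c ≤ 0.
    have : r = -(2 * c) + 2 := by rw [hc]; ring
    rw [this]
    ring
  rw [Pi.zero_apply]
  beta_reduce
  rw [hsum]
  have hcn : c ≤ 0 := by rw [hc]; linarith
  have : 0 ≤ φ b * (ε + activeForm V d b) ^ (c - 2) * (4 * c * (c - 1)) :=
    mul_nonneg (mul_nonneg (hφ0 b) (Real.rpow_nonneg (pos b).le _)) (by nlinarith)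
  nlinarith

end Regularized

/-! ### Integrability and superharmonicity of the harmonic prior -/

section Harmonic
variable {p : ℕ} {V W : Matrix (Fin p) (Fin p) ℝ} {d : Fin p → ℝ} {φ π : (Fin p → ℝ) → ℝ}

/-- A Gaussian integrates the singularity `|t|^{-2τ}`, `τ < 1/2`. -/
lemma lintegral_normal1_mul_rpow_ne_top {τ : ℝ} (h0 : 0 ≤ τ) (h1 : τ < 1 / 2) (c : ℝ) :
    ∫⁻ t, ENNReal.ofReal (normal1 1 t) * ENNReal.ofReal ((t + c) ^ 2) ^ (-τ) ≠ ⊤ := by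
  -- For |t + c| ≥ 1 the power is at most 1 and the Gaussian alone is a majorant. For |t + c| < 1
  -- the Gaussian is bounded by its maximum M, and g, reflected for negative arguments, carries the
  -- integrable power.
  let g : ℝ → ℝ := (Set.Ioc 0 1).indicator fun t => t ^ (-(2 * τ))
  have hg : Integrable g := by
    rw [integrable_indicator_iff measurableSet_Ioc]
    exact (intervalIntegrable_iff_integrableOn_Ioc_of_le zero_le_one).1
      (intervalIntegral.intervalIntegrable_rpow' (by linarith))
  have hg0 : ∀ t, 0 ≤ g t := fun t =>
    Set.indicator_nonneg (fun x hx => Real.rpow_nonneg hx.1.le _) t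
  have hN : Integrable fun t => normal1 1 t := by
    refine (lintegral_ofReal_ne_top_iff_integrable
      (continuous_normal1 1).aestronglyMeasurable
      (Eventually.of_forall fun t => (normal1_pos one_pos t).le)).1 ?_
    rw [lintegral_normal1 one_pos]
    exact ENNReal.one_ne_top
  set M : ℝ := (Real.sqrt (2 * Real.pi * 1))⁻¹ with hM
  have hNM : ∀ t, normal1 1 t ≤ M := fun t => by
    unfold normal1
    refine mul_le_of_le_one_right (by positivity) (Real.exp_le_one_iff.2 ?_)
    rw [neg_div]
    exact neg_nonpos.2 (by positivity)
  have hI : Integrable fun t => normal1 1 t + M * (g (t + c) + g (-(t + c))) :=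
    hN.add (((hg.comp_add_right c).add (hg.comp_neg.comp_add_right c)).const_mul M)
  refine ne_top_of_le_ne_top (hI.lintegral_lt_top.ne) (lintegral_mono_ae ?_)
  have hne : ∀ᵐ t : ℝ, t ≠ -c := by
    rw [ae_iff]; simp
  filter_upwards [hne] with t ht
  have hs : t + c ≠ 0 := fun h => ht (by linarith)
  generalize t + c = s at hs
  have hs2 : 0 < s ^ 2 := by positivity
  rw [ENNReal.ofReal_rpow_of_pos hs2, ← ENNReal.ofReal_mul (normal1_pos one_pos t).le]
  refine ENNReal.ofReal_le_ofReal ?_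
  have hn := normal1_pos one_pos t
  have hM0 : 0 ≤ M := hn.le.trans (hNM t)
  have g1 := hg0 s
  have g2 := hg0 (-s)
  rcases le_or_gt 1 (s ^ 2) with h | h
  · have := Real.rpow_le_one_of_one_le_of_nonpos h (neg_nonpos.2 h0)
    nlinarith [mul_nonneg hM0 (add_nonneg g1 g2)]
  · have hb : (s ^ 2) ^ (-τ) ≤ g s + g (-s) := by
      have e : (s ^ 2) ^ (-τ) = |s| ^ (-(2 * τ)) := by
        rw [← sq_abs, ← Real.rpow_natCast, ← Real.rpow_mul (abs_nonneg s)]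
        congr 1
        push_cast
        ring
      have hs1 : |s| < 1 := by rwa [sq_lt_one_iff_abs_lt_one] at h
      rw [e]
      rcases abs_cases s with ⟨h', h''⟩ | ⟨h', h''⟩
      · have : g s = |s| ^ (-(2 * τ)) := by
          simp only [g]
          rw [Set.indicator_of_mem, h']
          rw [h'] at hs1
          exact ⟨lt_of_le_of_ne h'' hs.symm, hs1.le⟩
        linarith
      · have : g (-s) = |s| ^ (-(2 * τ)) := by
          simp only [g]
          rw [Set.indicator_of_mem, h']
          rw [h'] at hs1
          exact ⟨by linarith, hs1.le⟩
        linarith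
    calc normal1 1 t * (s ^ 2) ^ (-τ) ≤ M * (g s + g (-s)) :=
          mul_le_mul (hNM t) hb (Real.rpow_nonneg hs2.le _) hM0
      _ ≤ _ := le_add_of_nonneg_left hn.le

/-- The singularity of the harmonic prior is at most a product of one-dimensional ones. -/
lemma ofReal_activeForm_rpow_le (hd : ∀ i, 0 < d i) (hr : 2 ≤ (activeSet d).card)
    (b : Fin p → ℝ) :
    ENNReal.ofReal (activeForm V d b ^ (-((((activeSet d).card : ℝ) - 2) / 2))) ≤
      ∏ i ∈ activeSet d, ENNReal.ofReal ((V *ᵥ b) i ^ 2) ^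
        (-((((activeSet d).card : ℝ) - 2) / (2 * (activeSet d).card))) := by
  set r : ℝ := ((activeSet d).card : ℝ) with hr'
  have hr2 : (2 : ℝ) ≤ r := by rw [hr']; exact_mod_cast hr
  have h1 : ENNReal.ofReal (activeForm V d b ^ (-((r - 2) / 2))) ≤
      ENNReal.ofReal (activeForm V d b) ^ (-((r - 2) / 2)) := by
    -- At a zero of the form a negative real power is 0 while the power in [0, ∞] is ∞, hence only
    -- an inequality; for r = 2 the exponent vanishes and both are 1.
    rcases (activeForm_nonneg (V := V) (d := d) b).eq_or_lt with h | h
    · rcases hr2.eq_or_lt with h2 | h2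
      · simp [← h2]
      · rw [← h, ENNReal.ofReal_zero, ENNReal.zero_rpow_of_neg (by linarith)]
        exact le_top
    · rw [ENNReal.ofReal_rpow_of_pos h]
  refine h1.trans ?_
  -- The power is split evenly over the r active indices; each factor is then bounded by its own
  -- coordinate, since the form is at least (V b)_i² because 0 < 1 - d i ≤ 1.
  have h2 : ENNReal.ofReal (activeForm V d b) ^ (-((r - 2) / 2)) =
      ∏ _i ∈ activeSet d, ENNReal.ofReal (activeForm V d b) ^ (-((r - 2) / (2 * r))) := by
    rw [Finset.prod_const, ← ENNReal.rpow_natCast, ← ENNReal.rpow_mul, ← hr']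
    congr 1
    field_simp
  rw [h2]
  refine Finset.prod_le_prod' fun i hi => ?_
  rw [ENNReal.rpow_neg, ENNReal.rpow_neg, ENNReal.inv_le_inv]
  refine ENNReal.rpow_le_rpow (ENNReal.ofReal_le_ofReal ?_) (by
    exact div_nonneg (by linarith) (by linarith))
  have h3 : (V *ᵥ b) i ^ 2 / (1 - d i) ≤ activeForm V d b :=
    Finset.single_le_sum (f := fun i => (V *ᵥ b) i ^ 2 / (1 - d i)) (fun j hj =>
      div_nonneg (sq_nonneg _) (sub_nonneg.2 (mem_activeSet.1 hj).le)) hi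
  refine le_trans ?_ h3
  exact le_div_self (sq_nonneg _) (sub_pos.2 (mem_activeSet.1 hi)) (by linarith [hd i])

/-- The product bound has exponent τ = (r - 2) / (2r) < 1/2 in each squared coordinate, so by
Tonelli the integral is at most a product of finite one-dimensional Gaussian integrals. -/
lemma smooth_activeForm_rpow_ne_top (hVW : V * W = 1) (hd : ∀ i, 0 < d i)
    (hr : 2 ≤ (activeSet d).card) (z : Fin p → ℝ) :
    smooth V (fun _ => 1) (fun b => ENNReal.ofReal
      (activeForm V d b ^ (-((((activeSet d).card : ℝ) - 2) / 2)))) z ≠ ⊤ := by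
  have hV : V.det ≠ 0 := by
    intro h
    have := congrArg Matrix.det hVW
    rw [Matrix.det_mul, h, zero_mul, Matrix.det_one] at this
    exact zero_ne_one this
  set τ : ℝ := (((activeSet d).card : ℝ) - 2) / (2 * (activeSet d).card) with hτ
  have hr2 : (2 : ℝ) ≤ (activeSet d).card := by exact_mod_cast hr
  have hτ0 : 0 ≤ τ := div_nonneg (by linarith) (by linarith)
  have hτ1 : τ < 1 / 2 := by
    rw [hτ, div_lt_div_iff₀ (by linarith) two_pos]
    linarith
  let F : Fin p → ℝ → ℝ≥0∞ := fun i t =>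
    if i ∈ activeSet d then ENNReal.ofReal ((t + (V *ᵥ z) i) ^ 2) ^ (-τ) else 1
  have hF : ∀ i, Measurable (F i) := by
    intro i
    by_cases hi : i ∈ activeSet d
    · simp only [F, hi, if_true]
      fun_prop
    · simp only [F, hi, if_false]
      fun_prop
  have hle : smooth V (fun _ => 1) (fun b => ENNReal.ofReal
      (activeForm V d b ^ (-((((activeSet d).card : ℝ) - 2) / 2)))) z ≤
      ∫⁻ b, ENNReal.ofReal (gk V (fun _ => 1) (b - z)) * ∏ i, F i ((V *ᵥ (b - z)) i) := by
    unfold smooth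
    refine lintegral_mono fun b => ?_
    rw [gk_sub_comm]
    refine mul_le_mul' le_rfl ((ofReal_activeForm_rpow_le hd hr b).trans_eq ?_)
    rw [← Finset.prod_subset (Finset.subset_univ (activeSet d))]
    · refine Finset.prod_congr rfl fun i hi => ?_
      simp only [F, hi, if_true, Matrix.mulVec_sub, Pi.sub_apply, sub_add_cancel, hτ]
    · intro i _ hi
      simp only [F, hi, if_false]
  refine ne_top_of_le_ne_top ?_ hle
  rw [lintegral_sub_right_eq_self
    (fun u => ENNReal.ofReal (gk V (fun _ => 1) u) * ∏ i, F i ((V *ᵥ u) i)) z,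
    lintegral_gk_mul hV (fun _ => one_pos) F hF]
  refine ENNReal.mul_ne_top ENNReal.ofReal_ne_top (ENNReal.prod_ne_top fun i _ => ?_)
  by_cases hi : i ∈ activeSet d
  · simp only [F, hi, if_true]
    exact lintegral_normal1_mul_rpow_ne_top hτ0 hτ1 _
  · simp only [F, hi, if_false, mul_one]
    rw [lintegral_normal1 one_pos]
    exact ENNReal.one_ne_top

/-- The prior times the kernel is integrable, and the kernel is continuous and positive, so it can
be divided out locally. -/
lemma locallyIntegrable_of_smooth_ne_top (hπ : AEStronglyMeasurable π) (h0 : ∀ b, 0 ≤ π b)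
    (hfin : ∀ z, smooth V (fun _ => 1) (fun b => ENNReal.ofReal (π b)) z ≠ ⊤) :
    LocallyIntegrable π := by
  have hI := (integrable_mul_gk hπ h0 hfin 0).locallyIntegrable
  have hc : Continuous fun b : Fin p → ℝ => (gk V (fun _ => 1) (b - 0))⁻¹ :=
    (continuous_gk.comp (continuous_id.sub continuous_const)).inv₀ fun b =>
      (gk_pos (fun _ => one_pos) _).ne'
  have := (hI.locallyIntegrableOn Set.univ).continuousOn_mul hc.continuousOn
    isOpen_univ.isLocallyClosed
  rw [locallyIntegrableOn_univ] at this
  refine this.congr (Eventually.of_forall fun b => ?_)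
  have := (gk_pos (V := V) (fun _ => one_pos) (b - 0)).ne'
  field_simp

/-- The zero set lies in the kernel of a nonzero linear functional, a proper subspace, which is a
null set. -/
lemma ae_activeForm_pos (hVW : V * W = 1) (hne : (activeSet d).Nonempty) :
    ∀ᵐ b, 0 < activeForm V d b := by
  obtain ⟨i, hi⟩ := hne
  let L : (Fin p → ℝ) →ₗ[ℝ] ℝ := LinearMap.proj i ∘ₗ V.mulVecLin
  have hL : ∀ b, L b = (V *ᵥ b) i := fun b => rfl
  have htop : LinearMap.ker L ≠ ⊤ := by
    intro h
    have : W.col i ∈ LinearMap.ker L := h ▸ Submodule.mem_top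
    rw [LinearMap.mem_ker, hL, mulVec_col_eq_single hVW, Pi.single_eq_same] at this
    exact one_ne_zero this
  have hnull := Measure.addHaar_submodule volume (LinearMap.ker L) htop
  filter_upwards [compl_mem_ae_iff.2 hnull] with b hb
  have hb' : (V *ᵥ b) i ≠ 0 := hb
  have hq := sub_pos.2 (mem_activeSet.1 hi)
  refine lt_of_lt_of_le (by positivity : 0 < (V *ᵥ b) i ^ 2 / (1 - d i)) ?_
  exact Finset.single_le_sum (f := fun i => (V *ᵥ b) i ^ 2 / (1 - d i)) (fun j hj =>
    div_nonneg (sq_nonneg _) (sub_nonneg.2 (mem_activeSet.1 hj).le)) hi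

/-- Let ε → 0 in the regularized inequality. As the exponent is nonpositive, the regularized powers
increase to the singular one off a null set, and the latter is a locally integrable majorant. -/
lemma distribTraceHessianNonpos_activeForm (hVW : V * W = 1) (hd : ∀ i, 0 < d i)
    (hd1 : ∀ i, d i ≤ 1) (hr : 2 ≤ (activeSet d).card) :
    DistribTraceHessianNonpos
      (fun b => activeForm V d b ^ (-((((activeSet d).card : ℝ) - 2) / 2)))
      (W * diagonal (fun i => 1 - d i) * Wᵀ) := by
  set c : ℝ := -((((activeSet d).card : ℝ) - 2) / 2) with hc
  have hr2 : (2 : ℝ) ≤ (activeSet d).card := by exact_mod_cast hr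
  have hc0 : c ≤ 0 := by rw [hc]; linarith
  have hm : Measurable fun b => activeForm V d b ^ c :=
    continuous_activeForm.measurable.pow_const c
  have hli : LocallyIntegrable fun b => activeForm V d b ^ c :=
    locallyIntegrable_of_smooth_ne_top hm.aestronglyMeasurable
      (fun b => Real.rpow_nonneg (activeForm_nonneg b) _)
      (smooth_activeForm_rpow_ne_top hVW hd hr)
  refine ⟨hli, fun φ hφ hφc hφ0 => ?_⟩
  simp_rw [trace_hessian_mul]
  let ψ : (Fin p → ℝ) → ℝ := fun b =>
    ∑ i, (1 - d i) * fderiv ℝ (fderiv ℝ φ) b (W.col i) (W.col i)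
  have cψ : Continuous ψ := continuous_finsetSum _ fun i _ =>
    continuous_const.mul (continuous_fderiv_fderiv hφ _)
  have sψ : HasCompactSupport ψ := by
    refine hφc.mono' fun b hb => ?_
    by_contra hb'
    refine hb (Finset.sum_eq_zero fun i _ => ?_)
    have h1 : b ∉ tsupport (fderiv ℝ (fderiv ℝ φ)) := fun h =>
      hb' (tsupport_fderiv_subset ℝ (tsupport_fderiv_subset ℝ h))
    rw [image_eq_zero_of_notMem_tsupport h1]
    simp
  have hint : Integrable fun b => activeForm V d b ^ c * ψ b := by
    simpa [mul_comm] using hli.integrable_smul_left_of_hasCompactSupport cψ sψ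
  let ε : ℕ → ℝ := fun N => 1 / ((N : ℝ) + 1)
  have ε0 : ∀ N, 0 < ε N := fun N => by positivity
  have εlim : Tendsto ε atTop (𝓝 0) := tendsto_one_div_add_atTop_nhds_zero_nat
  have hpos := ae_activeForm_pos (V := V) (W := W) (d := d) hVW
    (Finset.card_pos.1 (by omega))
  have lim : Tendsto (fun N => ∫ b, (ε N + activeForm V d b) ^ c * ψ b) atTop
      (𝓝 (∫ b, activeForm V d b ^ c * ψ b)) := by
    refine tendsto_integral_of_dominated_convergence (fun b => ‖activeForm V d b ^ c * ψ b‖)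
      (fun N => ?_) hint.norm (fun N => ?_) ?_
    · exact (((continuous_const.add continuous_activeForm).measurable.pow_const c).mul
        cψ.measurable).aestronglyMeasurable
    · filter_upwards [hpos] with b hb
      rw [norm_mul, norm_mul]
      refine mul_le_mul_of_nonneg_right ?_ (norm_nonneg _)
      rw [Real.norm_of_nonneg (Real.rpow_nonneg (by linarith [ε0 N]) _),
        Real.norm_of_nonneg (Real.rpow_nonneg hb.le _)]
      exact Real.rpow_le_rpow_of_nonpos hb (by linarith [ε0 N]) hc0
    · filter_upwards [hpos] with b hb
      have h1 : Tendsto (fun N => ε N + activeForm V d b) atTop (𝓝 (activeForm V d b)) := by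
        simpa using εlim.add_const (activeForm V d b)
      exact (h1.rpow_const (Or.inl hb.ne')).mul_const _
  exact le_of_tendsto' lim fun N =>
    trace_integral_regularized_nonpos hVW hd1 hr (ε0 N) hφ hφc hφ0

lemma DistribTraceHessianNonpos.const_mul {Q : Matrix (Fin p) (Fin p) ℝ}
    (h : DistribTraceHessianNonpos π Q) {κ : ℝ} (hκ : 0 ≤ κ) :
    DistribTraceHessianNonpos (fun b => κ * π b) Q := by
  refine ⟨h.1.smul κ, fun φ hφ hφc hφ0 => ?_⟩
  simp_rw [mul_assoc]
  rw [integral_const_mul]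
  exact mul_nonpos_of_nonneg_of_nonpos hκ (h.2 φ hφ hφc hφ0)

end Harmonic

/-! ### Conclusion for general priors and for harmonic priors -/

section Minimax
variable {m n p : ℕ} {A : Matrix (Fin m) (Fin p) ℝ} {B : Matrix (Fin n) (Fin p) ℝ}
  {W : Matrix (Fin p) (Fin p) ℝ} {d : Fin p → ℝ} {π : (Fin p → ℝ) → ℝ}

/-- Expanding the trace into entries and moving each derivative from the test function to π by the
definition of the weak Hessian leaves the integral of φ ≥ 0 against a function that is nonpositive
almost everywhere. -/
lemma HasWeakHessian.distribTraceHessianNonpos {H : (Fin p → ℝ) → Matrix (Fin p) (Fin p) ℝ}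
    (h : HasWeakHessian π H) {Q : Matrix (Fin p) (Fin p) ℝ} (hQ : ∀ᵐ β, (H β * Q).trace ≤ 0) :
    DistribTraceHessianNonpos π Q := by
  refine ⟨h.locallyIntegrable, fun φ hφ hφc hφ0 => ?_⟩
  have ch : ∀ i j, Continuous fun β => hessian φ β i j := fun i j =>
    (ContinuousMultilinearMap.apply ℝ (fun _ : Fin 2 => Fin p → ℝ) ℝ
      ![Pi.single i 1, Pi.single j 1]).continuous.comp
      (hφ.continuous_iteratedFDeriv (m := 2) (by norm_cast))
  have sh : ∀ i j, HasCompactSupport fun β => hessian φ β i j := fun i j =>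
    (hφc.iteratedFDeriv (𝕜 := ℝ) 2).comp_left
      (g := fun L : (Fin p → ℝ) [×2]→L[ℝ] ℝ => L ![Pi.single i 1, Pi.single j 1]) rfl
  have i1 : ∀ i j, Integrable fun β => Q j i * (π β * hessian φ β i j) := fun i j => by
    have := h.locallyIntegrable.integrable_smul_left_of_hasCompactSupport (ch i j) (sh i j)
    simp only [smul_eq_mul] at this
    simpa only [mul_comm (π _)] using this.const_mul (Q j i)
  have i2 : ∀ i j, Integrable fun β => Q j i * (H β i j * φ β) := fun i j => by
    have := (h.locallyIntegrable_hessian i j).integrable_smul_left_of_hasCompactSupport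
      hφ.continuous hφc
    simp only [smul_eq_mul] at this
    simpa only [mul_comm (H _ i j)] using this.const_mul (Q j i)
  have e1 : ∀ β, π β * (hessian φ β * Q).trace =
      ∑ i, ∑ j, Q j i * (π β * hessian φ β i j) := fun β => by
    simp only [Matrix.trace, Matrix.diag_apply, Matrix.mul_apply, Finset.mul_sum]
    exact Finset.sum_congr rfl fun i _ => Finset.sum_congr rfl fun j _ => by ring
  have e2 : ∀ β, φ β * (H β * Q).trace = ∑ i, ∑ j, Q j i * (H β i j * φ β) := fun β => by
    simp only [Matrix.trace, Matrix.diag_apply, Matrix.mul_apply, Finset.mul_sum]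
    exact Finset.sum_congr rfl fun i _ => Finset.sum_congr rfl fun j _ => by ring
  have e3 : ∫ β, π β * (hessian φ β * Q).trace = ∫ β, φ β * (H β * Q).trace := by
    simp_rw [e1, e2]
    rw [integral_finsetSum _ fun i _ => integrable_finsetSum _ fun j _ => i1 i j,
      integral_finsetSum _ fun i _ => integrable_finsetSum _ fun j _ => i2 i j]
    refine Finset.sum_congr rfl fun i _ => ?_
    rw [integral_finsetSum _ fun j _ => i1 i j, integral_finsetSum _ fun j _ => i2 i j]
    refine Finset.sum_congr rfl fun j _ => ?_
    rw [integral_const_mul, integral_const_mul, h.integral_eq i j φ hφ hφc]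
  rw [e3]
  refine integral_nonpos_of_ae ?_
  filter_upwards [hQ] with β hβ
  exact mul_nonpos_of_nonneg_of_nonpos (hφ0 β) hβ

lemma Diagonalizes.inv_mul (h : Diagonalizes A B W d) : W⁻¹ * W = 1 :=
  Matrix.nonsing_inv_mul _ ((Matrix.isUnit_iff_isUnit_det _).1 h.isUnit)

lemma Diagonalizes.exists_marginal_eq (h : Diagonalizes A B W d) (hA : A.rank = p)
    (hπ : ∀ β, 0 ≤ π β) : ∃ c : ℝ, 0 < c ∧ ∀ z, marginal π (covA A) z =
      ENNReal.ofReal c * smooth W⁻¹ (fun _ => 1) (fun b => ENNReal.ofReal (π b)) z := by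
  obtain ⟨c, hc, hN⟩ := (h.whitening hA).exists_normalDensity_eq hA
  refine ⟨c, hc, fun z => ?_⟩
  unfold marginal smooth
  rw [← lintegral_const_mul' _ _ ENNReal.ofReal_ne_top]
  refine lintegral_congr fun b => ?_
  rw [hN, ENNReal.ofReal_mul' (hπ b), ENNReal.ofReal_mul hc.le, mul_assoc]

lemma Diagonalizes.marginal_lt_top_iff (h : Diagonalizes A B W d) (hA : A.rank = p)
    (hπ : ∀ β, 0 ≤ π β) (z : Fin p → ℝ) : marginal π (covA A) z < ⊤ ↔
      smooth W⁻¹ (fun _ => 1) (fun b => ENNReal.ofReal (π b)) z ≠ ⊤ := by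
  obtain ⟨c, hc, hm⟩ := h.exists_marginal_eq hA hπ
  rw [hm, lt_top_iff_ne_top, not_iff_not, ENNReal.mul_eq_top]
  simp [hc]

/-- Neither the hypotheses nor the conclusion involve a diagonalization, so one is chosen here for
the proof; it need not be the one that defines a given harmonic prior. -/
theorem isMinimax_bayesPred (hA : A.rank = p) (hπ : IsPrior π)
    (hfin : ∀ z, marginal π (covA A) z < ⊤)
    (hQ : DistribTraceHessianNonpos π (covA A - covC A B)) : IsMinimax A B (bayesPred A B π) := by
  obtain ⟨W, d, h⟩ := exists_diagonalizes A B hA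
  have hw := h.whitening hA
  have hs : ∀ z, smooth W⁻¹ (fun _ => 1) (fun b => ENNReal.ofReal (π b)) z ≠ ⊤ := fun z =>
    (h.marginal_lt_top_iff hA hπ.nonneg z).1 (hfin z)
  rw [h.covA_sub_covC] at hQ
  rw [bayesPred_eq_priorPred]
  refine hw.isMinimax_priorPred ⟨hπ.measurable.ennreal_ofReal, fun h0 => hπ.not_ae_zero ?_, hs⟩
    (smooth_one_le_smooth h.inv_mul hw.pos hw.le_one hQ hπ.nonneg hs)
  filter_upwards [h0] with b hb
  exact le_antisymm (ENNReal.ofReal_eq_zero.1 hb) (hπ.nonneg b)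

lemma Diagonalizes.isPrior_scaledHarmonic (h : Diagonalizes A B W d)
    (hr : 3 ≤ (activeSet d).card) {κ : ℝ} (hκ : 0 < κ) :
    IsPrior fun β => κ * scaledHarmonic W d β := by
  refine ⟨?_, fun β => ?_, fun h0 => ?_⟩
  · simp_rw [scaledHarmonic_eq]
    exact (continuous_activeForm.measurable.pow_const _).const_mul κ
  · rw [scaledHarmonic_eq]
    exact mul_nonneg hκ.le (Real.rpow_nonneg (activeForm_nonneg _) _)
  · have hpos := ae_activeForm_pos (d := d) h.inv_mul (Finset.card_pos.1 (by omega))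
    have : ∀ᵐ _ : Fin p → ℝ, False := by
      filter_upwards [h0, hpos] with β h1 h2
      rw [scaledHarmonic_eq] at h1
      exact (mul_pos hκ (Real.rpow_pos_of_pos h2 _)).ne' h1
    simpa using this.exists

lemma Diagonalizes.marginal_scaledHarmonic_lt_top (h : Diagonalizes A B W d) (hA : A.rank = p)
    (hr : 3 ≤ (activeSet d).card) {κ : ℝ} (hκ : 0 < κ) (z : Fin p → ℝ) :
    marginal (fun β => κ * scaledHarmonic W d β) (covA A) z < ⊤ := by
  have h0 : ∀ β, 0 ≤ κ * scaledHarmonic W d β := (h.isPrior_scaledHarmonic hr hκ).nonneg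
  rw [h.marginal_lt_top_iff hA h0]
  have e : smooth W⁻¹ (fun _ => 1) (fun b => ENNReal.ofReal (κ * scaledHarmonic W d b)) z =
      ENNReal.ofReal κ * smooth W⁻¹ (fun _ => 1) (fun b => ENNReal.ofReal
        (activeForm W⁻¹ d b ^ (-((((activeSet d).card : ℝ) - 2) / 2)))) z := by
    unfold smooth
    rw [← lintegral_const_mul' _ _ ENNReal.ofReal_ne_top]
    refine lintegral_congr fun b => ?_
    beta_reduce
    rw [scaledHarmonic_eq, ENNReal.ofReal_mul hκ.le, mul_left_comm]
  rw [e]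
  exact ENNReal.mul_ne_top ENNReal.ofReal_ne_top
    (smooth_activeForm_rpow_ne_top h.inv_mul (h.whitening hA).pos (by omega) z)

lemma Diagonalizes.distribTraceHessianNonpos_scaledHarmonic (h : Diagonalizes A B W d)
    (hA : A.rank = p) (hr : 3 ≤ (activeSet d).card) {κ : ℝ} (hκ : 0 < κ) :
    DistribTraceHessianNonpos (fun β => κ * scaledHarmonic W d β) (covA A - covC A B) := by
  have hw := h.whitening hA
  rw [h.covA_sub_covC]
  simp_rw [scaledHarmonic_eq]
  exact (distribTraceHessianNonpos_activeForm h.inv_mul hw.pos hw.le_one (by omega)).const_mul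
    hκ.le

end Minimax

end PredReg

end

theorem corollary2 {m n p : ℕ} (A : Matrix (Fin m) (Fin p) ℝ) (B : Matrix (Fin n) (Fin p) ℝ)
    (hA : A.rank = p) :
    -- priors with a weak Hessian that satisfies the trace inequality almost everywhere
    (∀ (π : (Fin p → ℝ) → ℝ) (H : (Fin p → ℝ) → Matrix (Fin p) (Fin p) ℝ),
      PredReg.IsPrior π →
      (∀ z, PredReg.marginal π (PredReg.covA A) z < ⊤) →
      PredReg.HasWeakHessian π H →
      (∀ᵐ β, (H β * (PredReg.covA A - PredReg.covC A B)).trace ≤ 0) →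
      PredReg.IsMinimax A B (PredReg.bayesPred A B π)) ∧
    -- priors that satisfy the trace inequality in the sense of distributions
    (∀ π : (Fin p → ℝ) → ℝ,
      PredReg.IsPrior π →
      (∀ z, PredReg.marginal π (PredReg.covA A) z < ⊤) →
      PredReg.DistribTraceHessianNonpos π (PredReg.covA A - PredReg.covC A B) →
      PredReg.IsMinimax A B (PredReg.bayesPred A B π)) ∧
    -- scaled harmonic priors
    (∃ (W : Matrix (Fin p) (Fin p) ℝ) (d : Fin p → ℝ), PredReg.Diagonalizes A B W d) ∧
    (∀ (W : Matrix (Fin p) (Fin p) ℝ) (d : Fin p → ℝ) (π : (Fin p → ℝ) → ℝ) (κ : ℝ),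
      PredReg.Diagonalizes A B W d → 3 ≤ (PredReg.activeSet d).card → 0 < κ →
      (∀ β, π β = κ * PredReg.scaledHarmonic W d β) →
      PredReg.IsPrior π ∧
      (∀ z, PredReg.marginal π (PredReg.covA A) z < ⊤) ∧
      PredReg.DistribTraceHessianNonpos π (PredReg.covA A - PredReg.covC A B) ∧
      PredReg.IsMinimax A B (PredReg.bayesPred A B π)) := by
  refine ⟨fun π H hπ hfin hH hQ =>
      PredReg.isMinimax_bayesPred hA hπ hfin (hH.distribTraceHessianNonpos hQ),
    fun π hπ hfin hQ => PredReg.isMinimax_bayesPred hA hπ hfin hQ,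
    PredReg.exists_diagonalizes A B hA, fun W d π κ h hr hκ hπ => ?_⟩
  obtain rfl : π = fun β => κ * PredReg.scaledHarmonic W d β := funext hπ
  have h1 := h.isPrior_scaledHarmonic hr hκ
  have h2 := h.marginal_scaledHarmonic_lt_top hA hr hκ
  have h3 := h.distribTraceHessianNonpos_scaledHarmonic hA hr hκ
  exact ⟨h1, h2, h3, PredReg.isMinimax_bayesPred hA h1 h2 h3⟩
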